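/- **Setting.** Let $n\ge 3$, let $(X_i,\Sigma_i,\mu_i)$, $i\in[n]$, be probability spaces, let $(\boldsymbol X,\boldsymbol\mu)$ be their product and, for nonempty $e\subseteq[n]$, let $(\boldsymbol X_e,\boldsymbol\mu_e)$ be the product of the spaces with $i\in e$, with projection $\pi_e:\boldsymbol X\to\boldsymbol X_e$. A random variable in $L_p(\boldsymbol X,\mathcal B_e,\boldsymbol\mu)$, where $\mathcal B_e=\{\pi_e^{-1}(A): A\subseteq \boldsymbol X_e \text{ measurable}\}$, is written $f=\boldsymbol f\circ\pi_e$ with $\boldsymbol f\in L_p(\boldsymbol X_e,\boldsymbol\mu_e)$. For points $\boldsymbol x^{(0)},\dots,\boldsymbol x^{(\ell-1)}$ and $\omega\in\{0,\dots,\ell-1\}^e$ put $\boldsymbol x_e^{(\omega)}=(x_i^{(\omega_i)})_{i\in e}$. For $1\le p<\infty$ let $$\|\boldsymbol f\|_{\square_{\ell,p}(\boldsymbol X_e)}=\mathbb E\Big[\prod_{\omega\in\{0,\dots,\ell-1\}^e}|\boldsymbol f(\boldsymbol x_e^{(\omega)})|^p\,\Big|\,\boldsymbol x_e^{(0)},\dots,\boldsymbol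 x_e^{(\ell-1)}\in\boldsymbol X_e\Big]^{1/(p\,\ell^{|e|})}\in[0,\infty],$$ and $\|\boldsymbol f\|_{\square_{\ell,\infty}(\boldsymbol X_e)}=\|\boldsymbol f\|_{L_\infty}$. For $C\ge1$ and $1<p\le\infty$ with conjugate exponent $q$ let $$\ell(C,p)=\min\{2k: k\in\mathbb N,\ 2k\ge 2q+(1-1/C)+1/p\}\qquad(1/\infty=0).$$ For $|e|\ge2$ the cut norm of $f\in L_1(\boldsymbol X,\mathcal B_e,\boldsymbol\mu)$ is $\|f\|_{\mathcal S_{\partial e}}=\sup_A|\int_A f\,d\boldsymbol\mu|$, over the sets $A=\bigcap_{e'\subseteq e,\,|e'|=|e|-1}A_{e'}$ with $A_{e'}\in\mathcal B_{e'}$. **Conditions (C1)–(C3).** Let $\mathcal H$ be the hypergraph of all $(n-1)$-element subsets of $[n]$, and let $\nu_e\in L_1(\boldsymbol X,\mathcal B_e,\boldsymbol\mu)$, $e\in\mathcal H$, be nonnegative. For constants $C,\eta,p$ and a moment order $m$ consider the following conditions (finiteness of all the expectations that appear is part of them). * (C1) $\mathbb E[\prod_{e\in\mathcal G}\nu_e]\ge1-\eta$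 for every nonempty $\mathcal G\subseteq\mathcal H$. * (C2) For every $e\in\mathcal H$ there is $\psi_e\in L_p(\boldsymbol X,\mathcal B_e,\boldsymbol\mu)$ with $\|\psi_e\|_{L_p}\le C$ such that (a) $\|\nu_e-\psi_e\|_{\mathcal S_{\partial e}}\le\eta$; (b) whenever for every $e'\in\mathcal H\setminus\{e\}$ and $\omega\in\{0,1\}$ we are given $g_{e'}^{(\omega)}\in L_1(\boldsymbol X,\mathcal B_{e'},\boldsymbol\mu)$ with $0\le g_{e'}^{(\omega)}\le\nu_{e'}$ or $0\le g_{e'}^{(\omega)}\le1$, then $$\Big|\mathbb E\Big[(\boldsymbol\nu_e-\boldsymbol\psi_e)(\boldsymbol x_e)\prod_{\omega\in\{0,1\}}\mathbb E\big[\prod_{e'\in\mathcal H\setminus\{e\}}g_{e'}^{(\omega)}(\boldsymbol x_e,\boldsymbol x_{[n]\setminus e})\,\big|\,\boldsymbol x_{[n]\setminus e}\big]\,\Big|\,\boldsymbol x_e\in\boldsymbol X_e\Big]\Big|\le\eta.$$ * (C3) For every $e\in\mathcal H$ and every nonempty $\mathcal G\subseteq\mathcal H\setminus\{e\}$ the function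 $\boldsymbol\nu_{e,\mathcal G}(\boldsymbol x_e)=\mathbb E[\prod_{e'\in\mathcal G}\nu_{e'}(\boldsymbol x_e,\boldsymbol x_{[n]\setminus e})\,|\,\boldsymbol x_{[n]\setminus e}]$ satisfies $\mathbb E[\boldsymbol\nu_{e,\mathcal G}^{\,m}]\le C+\eta$. The family $\langle\nu_e:e\in\mathcal H\rangle$ is $(C,\eta,p)$-pseudorandom if (C1)–(C3) hold with $m=\ell(C,p)$. **Theorem 4.2.** Let $n\ge3$, $C\ge1$, $1<p\le\infty$, $\ell=\ell(C,p)$ and $0<\eta\le(4C)^{-n\ell^n}$. For every $e\in\mathcal H$ let $\lambda_e\in L_1(\boldsymbol X,\mathcal B_e,\boldsymbol\mu)$ and $\varphi_e\in L_p(\boldsymbol X,\mathcal B_e,\boldsymbol\mu)$ be nonnegative. Assume that * (I) for every choice of $n_{e,\omega}\in\{0,1\}$, $$1-\eta\le\mathbb E\Big[\prod_{e\in\mathcal H}\ \prod_{\omega\in\{0,\dots,\ell-1\}^e}\boldsymbol\lambda_e^{n_{e,\omega}}(\boldsymbol x_e^{(\omega)})\,\Big|\,\boldsymbol x^{(0)},\dots,\boldsymbol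 x^{(\ell-1)}\in\boldsymbol X\Big]\le1+\eta;$$ * (II) $\|\boldsymbol\varphi_e\|_{\square_{\ell,p}(\boldsymbol X_e)}\le C$ for every $e\in\mathcal H$. Put $C'=(4C)^{n\ell}$ and $\eta'=(4C)^{n\ell}\,\eta^{1/\ell^{n-1}}$. Then the family $\langle\lambda_e+\varphi_e:e\in\mathcal H\rangle$ satisfies (C1)–(C3) with the constants $C',\eta',p$, where the moment order in (C3) is the above $\ell=\ell(C,p)$. In particular, whenever $\ell(C',p)=\ell(C,p)$, it is $(C',\eta',p)$-pseudorandom. -/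

import Mathlib

open MeasureTheory
open scoped ENNReal

namespace BoxHypergraph

noncomputable section

/-! A hypergraph system consists of probability spaces `(X i, μ i)`, `i : Fin n`, and a hypergraph
`ℋ : Finset (Finset (Fin n))`. A random variable in `L_1(𝑿, ℬ_e, 𝝁)` is given by the corresponding
random variable `f` on `𝑿_e`; as a function on `𝑿` it is `fun x => f (e.restrict x)`. -/

/-- The points of the product space `𝑿_e`. -/
abbrev PartSpace {n : ℕ} (X : Fin n → Type*) (e : Finset (Fin n)) : Type _ :=
  ∀ i : e, X i

/-- The product measure `𝝁_e` on `𝑿_e`. -/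
abbrev partMeasure {n : ℕ} {X : Fin n → Type*} [∀ i, MeasurableSpace (X i)]
    (μ : ∀ i, Measure (X i)) (e : Finset (Fin n)) : Measure (PartSpace X e) :=
  Measure.pi fun i : e => μ i

/-- The product measure on `𝑿_{[n] ∖ e}`. -/
abbrev complMeasure {n : ℕ} {X : Fin n → Type*} [∀ i, MeasurableSpace (X i)]
    (μ : ∀ i, Measure (X i)) (e : Finset (Fin n)) : Measure (∀ i : {i // i ∉ e}, X i) :=
  Measure.pi fun i : {i // i ∉ e} => μ i

/-- The point `(x_e, x_{[n] ∖ e})` of `𝑿`. -/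
def glue {n : ℕ} {X : Fin n → Type*} (e : Finset (Fin n))
    (x : PartSpace X e) (y : ∀ i : {i // i ∉ e}, X i) : ∀ i, X i :=
  (Equiv.piEquivPiSubtypeProd (fun i => i ∈ e) X).symm (x, y)

/-- The point `x_e^{(ω)} = (x_i^{(ω_i)})_{i ∈ e}` for `ℓ` points of `𝑿_e`. -/
def mixPart {n : ℕ} {X : Fin n → Type*} {ℓ : ℕ} (e : Finset (Fin n))
    (x : Fin ℓ → PartSpace X e) (ω : e → Fin ℓ) : PartSpace X e :=
  fun i => x (ω i) i

/-- The point `x_e^{(ω)} = (x_i^{(ω_i)})_{i ∈ e}` for `ℓ` points of `𝑿`. -/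
def mix {n : ℕ} {X : Fin n → Type*} {ℓ : ℕ} (e : Finset (Fin n))
    (x : Fin ℓ → ∀ i, X i) (ω : e → Fin ℓ) : PartSpace X e :=
  fun i => x (ω i) i

/-- The `ℓ`-box norm of a nonnegative function on `𝑿_e`, with value `∞` allowed. -/
def boxNorm {n : ℕ} {X : Fin n → Type*} [∀ i, MeasurableSpace (X i)]
    (μ : ∀ i, Measure (X i)) (ℓ : ℕ) (e : Finset (Fin n)) (g : PartSpace X e → ℝ≥0∞) : ℝ≥0∞ :=
  (∫⁻ x : Fin ℓ → PartSpace X e, ∏ ω : e → Fin ℓ, g (mixPart e x ω)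
    ∂(Measure.pi fun _ : Fin ℓ => partMeasure μ e)) ^ (1 / ((ℓ : ℝ) ^ e.card))

open Classical in
/-- The `(ℓ,p)`-box norm: `‖ |f|^p ‖_{□_ℓ}^{1/p}` for finite `p`, and the `L_∞` norm for `p = ∞`. -/
def boxLpNorm {n : ℕ} {X : Fin n → Type*} [∀ i, MeasurableSpace (X i)]
    (μ : ∀ i, Measure (X i)) (ℓ : ℕ) (p : ℝ≥0∞) (e : Finset (Fin n))
    (f : PartSpace X e → ℝ) : ℝ≥0∞ :=
  if p = ∞ then eLpNorm f ∞ (partMeasure μ e)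
  else (boxNorm μ ℓ e fun x => ‖f x‖ₑ ^ p.toReal) ^ (1 / p.toReal)

/-- The sets `⋂_{e' ∈ ∂e} A_{e'}` with `A_{e'} ∈ ℬ_{e'}`, where `∂e` consists of the subsets
of `e` with one element fewer. -/
def boundarySets {n : ℕ} (X : Fin n → Type*) [∀ i, MeasurableSpace (X i)]
    (e : Finset (Fin n)) : Set (Set (∀ i, X i)) :=
  {A | ∃ B : Finset (Fin n) → Set (∀ i, X i),
    (∀ e' ∈ e.powersetCard (e.card - 1),
      MeasurableSet[MeasurableSpace.comap
        (e'.restrict : (∀ i, X i) → PartSpace X e') MeasurableSpace.pi] (B e')) ∧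
    A = ⋂ e' ∈ e.powersetCard (e.card - 1), B e'}

/-- The cut norm `sup {|∫_A f d𝝁| : A ∈ 𝒮_{∂e}}`. -/
def cutNorm {n : ℕ} {X : Fin n → Type*} [∀ i, MeasurableSpace (X i)]
    (μ : ∀ i, Measure (X i)) (e : Finset (Fin n)) (f : PartSpace X e → ℝ) : ℝ≥0∞ :=
  ⨆ A ∈ boundarySets X e, ENNReal.ofReal |∫ x in A, f (e.restrict x) ∂(Measure.pi μ)|

/-- `min {2k : k ∈ ℕ, 2k ≥ 2q + (1 - 1/C) + 1/p}` with `q` the conjugate exponent of `p`. -/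
def momentExponent (C : ℝ) (p : ℝ≥0∞) : ℕ :=
  sInf {m : ℕ | ∃ k : ℕ, m = 2 * k ∧
    2 * (ENNReal.conjExponent p).toReal + (1 - 1 / C) + (p⁻¹).toReal ≤ (m : ℝ)}

/-- `x_e ↦ 𝔼[∏_{e' ∈ 𝒢} ν_{e'}(x_e, x_{[n] ∖ e}) | x_{[n] ∖ e}]`. -/
def fiberMean {n : ℕ} {X : Fin n → Type*} [∀ i, MeasurableSpace (X i)]
    (μ : ∀ i, Measure (X i)) (e : Finset (Fin n)) (𝒢 : Finset (Finset (Fin n)))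
    (ν : ∀ e', PartSpace X e' → ℝ) (x : PartSpace X e) : ℝ :=
  ∫ y, ∏ e' ∈ 𝒢, ν e' (e'.restrict (glue e x y)) ∂(complMeasure μ e)

/-- The conditions (C1), (C2), (C3) with constants `C`, `η`, `p`, where `m` is the order of the
moments in (C3). The finiteness of the expectations is part of the conditions. -/
structure IsPseudorandomOfOrder {n : ℕ} {X : Fin n → Type*} [∀ i, MeasurableSpace (X i)]
    (μ : ∀ i, Measure (X i)) (ℋ : Finset (Finset (Fin n))) (C η : ℝ) (p : ℝ≥0∞) (m : ℕ)
    (ν : ∀ e, PartSpace X e → ℝ) : Prop where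
  integrable : ∀ e ∈ ℋ, Integrable (ν e) (partMeasure μ e)
  nonneg : ∀ e ∈ ℋ, 0 ≤ᵐ[partMeasure μ e] ν e
  c1 : ∀ 𝒢 ⊆ ℋ, 𝒢.Nonempty →
    Integrable (fun x => ∏ e ∈ 𝒢, ν e (e.restrict x)) (Measure.pi μ) ∧
    1 - η ≤ ∫ x, ∏ e ∈ 𝒢, ν e (e.restrict x) ∂(Measure.pi μ)
  c2 : ∀ e ∈ ℋ, ∃ ψ : PartSpace X e → ℝ,
    MemLp ψ p (partMeasure μ e) ∧ eLpNorm ψ p (partMeasure μ e) ≤ ENNReal.ofReal C ∧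
    cutNorm μ e (fun x => ν e x - ψ x) ≤ ENNReal.ofReal η ∧
    ∀ g : Fin 2 → ∀ e', PartSpace X e' → ℝ,
      (∀ ω, ∀ e' ∈ ℋ.erase e, Integrable (g ω e') (partMeasure μ e') ∧
        0 ≤ᵐ[partMeasure μ e'] g ω e' ∧
        (g ω e' ≤ᵐ[partMeasure μ e'] ν e' ∨ g ω e' ≤ᵐ[partMeasure μ e'] fun _ => 1)) →
      Integrable (fun x => (ν e x - ψ x) * ∏ ω, fiberMean μ e (ℋ.erase e) (g ω) x)
        (partMeasure μ e) ∧
      |∫ x, (ν e x - ψ x) * ∏ ω, fiberMean μ e (ℋ.erase e) (g ω) x ∂(partMeasure μ e)| ≤ η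
  c3 : ∀ e ∈ ℋ, ∀ 𝒢 ⊆ ℋ.erase e, 𝒢.Nonempty →
    Integrable (fun x => fiberMean μ e 𝒢 ν x ^ m) (partMeasure μ e) ∧
    ∫ x, fiberMean μ e 𝒢 ν x ^ m ∂(partMeasure μ e) ≤ C + η

/-- `(C, η, p)`-pseudorandom families: the order of the moments in (C3) is determined by the
constants `C` and `p` of the family. -/
def IsPseudorandom {n : ℕ} {X : Fin n → Type*} [∀ i, MeasurableSpace (X i)]
    (μ : ∀ i, Measure (X i)) (ℋ : Finset (Finset (Fin n))) (C η : ℝ) (p : ℝ≥0∞)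
    (ν : ∀ e, PartSpace X e → ℝ) : Prop :=
  IsPseudorandomOfOrder μ ℋ C η p (momentExponent C p) ν

/-- The two-sided linear forms condition on the `ℓ`-blow-up of `ℋ`. For `η < 1` and nonnegative
`lam` the lower bound forces the products to be integrable. -/
def LinearForms {n : ℕ} {X : Fin n → Type*} [∀ i, MeasurableSpace (X i)]
    (μ : ∀ i, Measure (X i)) (ℋ : Finset (Finset (Fin n))) (ℓ : ℕ) (η : ℝ)
    (lam : ∀ e, PartSpace X e → ℝ) : Prop :=
  ∀ k : ∀ e : Finset (Fin n), (e → Fin ℓ) → Fin 2,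
    1 - η ≤ ∫ x : Fin ℓ → ∀ i, X i,
        ∏ e ∈ ℋ, ∏ ω : e → Fin ℓ, lam e (mix e x ω) ^ (k e ω : ℕ)
          ∂(Measure.pi fun _ : Fin ℓ => Measure.pi μ) ∧
    ∫ x : Fin ℓ → ∀ i, X i,
        ∏ e ∈ ℋ, ∏ ω : e → Fin ℓ, lam e (mix e x ω) ^ (k e ω : ℕ)
          ∂(Measure.pi fun _ : Fin ℓ => Measure.pi μ) ≤ 1 + η

end

end BoxHypergraph

open MeasureTheory
open scoped ENNReal

set_option linter.unusedSectionVars false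

/-! Take `ψ_e = φ_e + 1`, so that `ν_e - ψ_e = λ_e - 1`. Both halves of (C2) then ask for
cancellation of `λ_e - 1` against products of functions dominated by `λ_{e'} + φ_{e'}` or by `1`. A
facet is the complement of a vertex, so all functions are read on the whole product space, the
`i`-th one not depending on coordinate `i`. For `e = [n] ∖ {j}` everything reduces to `𝔼[(λ_j - 1)
∏_{k < ℓ} 𝔼_u ∏_{i ≠ j} h_{i,k}]`, with `ℓ` copies `u` of coordinate `j`. Condition (C2)(b) uses two
copies and the cut norm one copy filled with indicators; unused copies carry the function `1`.

Each `h` splits into `min(h, λ)` and a remainder that is at most `φ` or at most `1`. Multiplying out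
gives `2^((n-1)ℓ)` terms, in which every factor with `i ≠ j` is bounded by a weight (`λ` or `1`)
times a majorant (`1` or `φ`). Coordinates `i ≠ j` are then treated one at a time by weighted Hölder
with exponents `ℓ'` and `ℓ`: the factors not depending on `x_i` are pulled out and replaced by their
weight, while `x_i` is replaced by `ℓ` copies in the other factors. The price is a box moment of
weight times majorant to the power `ℓ'`. It is controlled by the linear forms condition for the
weight `λ`, and by the box norm for the majorant `φ`, because `ℓ' ≤ p`. Evenness of `ℓ` keeps the
absolute value outside the integral, so the cancellation in `λ_j - 1` survives.

After `n - 1` steps only weights are left. The product of `λ_j - 1` over the box expands into an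
alternating sum of linear forms, each within `η` of `1`; the ones cancel, leaving at most
`2^(ℓ^(n-1)) η`. Taking the root of order `ℓ^(n-1)` produces the power of `η` and the constant. The
same scheme with `1` or `λ_j` in place of `λ_j - 1` gives absolute bounds, hence (C3) and the
integrability in (C1); the lower bound in (C1) follows from `λ ≤ λ + φ`.

The load is carried by `lintegral_weighted_holder`, `enorm_integral_pow_le_of_replicated`,
`pow_le_of_step`, `FormsData.weightedBound`, `FormsData.integral_fibre_sub_one` and
`FormsData.lintegral_fibre_le`. -/

namespace BoxHypergraph

noncomputable section

/-! ### Index vectors supported on a set of coordinates. -/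

section Subbox

variable {ι : Type*} [Fintype ι] [DecidableEq ι] {ℓ : ℕ} [NeZero ℓ]

/-- The index vectors in `{0, …, ℓ-1}^ι` that vanish outside `S`. -/
def subbox (ℓ : ℕ) [NeZero ℓ] (S : Finset ι) : Finset (ι → Fin ℓ) :=
  Fintype.piFinset fun i => if i ∈ S then Finset.univ else {0}

lemma mem_subbox {S : Finset ι} {ω : ι → Fin ℓ} : ω ∈ subbox ℓ S ↔ ∀ i ∉ S, ω i = 0 := by
  simp only [subbox, Fintype.mem_piFinset]
  refine forall_congr' fun i => ?_
  by_cases h : i ∈ S <;> simp [h]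

lemma subbox_empty : subbox ℓ (∅ : Finset ι) = {0} := by
  ext ω
  simp [mem_subbox, funext_iff]

lemma card_subbox (S : Finset ι) : (subbox ℓ S).card = ℓ ^ S.card := by
  have : ∀ i, (if i ∈ S then (Finset.univ : Finset (Fin ℓ)) else {0}).card
      = if i ∈ S then ℓ else 1 := by
    intro i; split_ifs <;> simp
  simp only [subbox, Fintype.card_piFinset, this]
  simp

lemma prod_subbox_insert {R : Type*} [CommMonoid R] {S : Finset ι} {i : ι} (hi : i ∉ S)
    (g : (ι → Fin ℓ) → R) :
    ∏ ω ∈ subbox ℓ (insert i S), g ω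
      = ∏ k : Fin ℓ, ∏ ω ∈ subbox ℓ S, g (Function.update ω i k) := by
  rw [← Finset.prod_product']
  refine Finset.prod_bij' (fun ω _ => (ω i, Function.update ω i 0))
    (fun q _ => Function.update q.2 i q.1) ?_ ?_ ?_ ?_ ?_
  · intro ω hω
    simp only [Finset.mem_product, Finset.mem_univ, true_and, mem_subbox] at hω ⊢
    intro k hk
    by_cases hki : k = i
    · subst hki; simp
    · simpa [hki] using hω k (by simp [hki, hk])
  · rintro ⟨k, ω⟩ h
    simp only [Finset.mem_product, Finset.mem_univ, true_and, mem_subbox] at h ⊢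
    intro m hm
    simp only [Finset.mem_insert, not_or] at hm
    simpa [hm.1] using h m hm.2
  · intro ω _; simp
  · rintro ⟨k, ω⟩ h
    simp only [Finset.mem_product, Finset.mem_univ, true_and, mem_subbox] at h
    simp [← h i hi]
  · intro ω _; simp

end Subbox

/-! ### Resampling one coordinate of `ℓ` independent points. -/

section Substitution

variable {ι : Type*} {X : ι → Type*} {ℓ : ℕ}

/-- The point `x^{(ω)} = (x_i^{(ω_i)})_i`. -/
def mixAll (x : Fin ℓ → ∀ i, X i) (ω : ι → Fin ℓ) : ∀ i, X i := fun i => x (ω i) i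

lemma mixAll_zero [NeZero ℓ] (x : Fin ℓ → ∀ i, X i) : mixAll x 0 = x 0 := rfl

@[fun_prop]
lemma measurable_mixAll [∀ i, MeasurableSpace (X i)] (ω : ι → Fin ℓ) :
    Measurable (fun x : Fin ℓ → ∀ i, X i => mixAll x ω) := by
  unfold mixAll; fun_prop

variable [DecidableEq ι]

/-- Replace the `i`-th coordinates of `ℓ` points by the `ℓ` coordinates of `z`. -/
def substCoord (i : ι) (x : Fin ℓ → ∀ i, X i) (z : Fin ℓ → X i) : Fin ℓ → ∀ i, X i :=
  fun k => Function.update (x k) i (z k)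

lemma mixAll_substCoord (i : ι) (x : Fin ℓ → ∀ i, X i) (z : Fin ℓ → X i) (ω : ι → Fin ℓ) :
    mixAll (substCoord i x z) ω = Function.update (mixAll x ω) i (z (ω i)) := by
  ext m
  by_cases h : m = i
  · subst h; simp [mixAll, substCoord]
  · simp [mixAll, substCoord, h]

lemma mixAll_substCoord_update (i : ι) (x : Fin ℓ → ∀ i, X i) (z : Fin ℓ → X i)
    (ω : ι → Fin ℓ) (k : Fin ℓ) :
    mixAll (substCoord i x z) (Function.update ω i k)
      = Function.update (mixAll x ω) i (z k) := by
  ext m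
  by_cases h : m = i
  · subst h; simp [mixAll, substCoord]
  · simp [mixAll, substCoord, h]

variable [∀ i, MeasurableSpace (X i)]

lemma measurable_update_mixAll (i : ι) (ω : ι → Fin ℓ) :
    Measurable fun q : (Fin ℓ → ∀ i, X i) × X i => Function.update (mixAll q.1 ω) i q.2 :=
  measurable_update'.comp
    (((measurable_mixAll ω).comp measurable_fst).prodMk measurable_snd)

variable [Fintype ι] (μ : ∀ i, Measure (X i)) [∀ i, IsProbabilityMeasure (μ i)]

/-- Overwriting coordinate `i` by an independent sample keeps the product law. This gives Fubini in
one coordinate without ever leaving the full product space. -/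
lemma measurePreserving_update (i : ι) :
    MeasurePreserving (fun q : (∀ i, X i) × X i => Function.update q.1 i q.2)
      ((Measure.pi μ).prod (μ i)) (Measure.pi μ) := by
  have hm : Measurable (fun q : (∀ i, X i) × X i => Function.update q.1 i q.2) :=
    measurable_update'
  refine ⟨hm, (Measure.pi_eq fun s hs => ?_).symm⟩
  rw [Measure.map_apply hm (MeasurableSet.univ_pi hs)]
  have : (fun q : (∀ i, X i) × X i => Function.update q.1 i q.2) ⁻¹' (Set.univ.pi s)
      = (Set.univ.pi fun m => if m = i then Set.univ else s m) ×ˢ s i := by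
    ext ⟨x, u⟩
    simp only [Set.mem_preimage, Set.mem_pi, Set.mem_univ, forall_const, Set.mem_prod]
    constructor
    · intro h
      refine ⟨fun m => ?_, by simpa using h i⟩
      by_cases hm : m = i
      · simp [hm]
      · simpa [hm] using h m
    · rintro ⟨h1, h2⟩ m
      by_cases hm : m = i
      · subst hm; simpa using h2
      · simpa [hm] using h1 m
  rw [this, Measure.prod_prod, Measure.pi_pi, ← Finset.mul_prod_erase _ _ (Finset.mem_univ i),
    ← Finset.mul_prod_erase (Finset.univ) (fun m => μ m (s m)) (Finset.mem_univ i), mul_comm]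
  simp only [if_true, measure_univ, one_mul]
  congr 1
  refine Finset.prod_congr rfl fun m hm => ?_
  rw [if_neg (Finset.ne_of_mem_erase hm)]

lemma measurePreserving_substCoord (i : ι) :
    MeasurePreserving (fun q : (Fin ℓ → ∀ i, X i) × (Fin ℓ → X i) => substCoord i q.1 q.2)
      ((Measure.pi fun _ => Measure.pi μ).prod (Measure.pi fun _ => μ i))
      (Measure.pi fun _ => Measure.pi μ) := by
  have h1 := (measurePreserving_arrowProdEquivProdArrow (∀ i, X i) (X i) (Fin ℓ)
    (fun _ => Measure.pi μ) (fun _ => μ i)).symm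
  have h2 := measurePreserving_pi (fun _ : Fin ℓ => (Measure.pi μ).prod (μ i))
    (fun _ : Fin ℓ => Measure.pi μ) (fun _ => measurePreserving_update μ i)
  exact h2.comp h1

end Substitution

/-! ### Fubini for functions that factor over the copies of one coordinate. -/

section Fubini

lemma integral_comp_measurePreserving {α β : Type*} [MeasurableSpace α] [MeasurableSpace β]
    {m : Measure α} {m' : Measure β} {T : α → β} (hT : MeasurePreserving T m m') {g : β → ℝ}
    (hg : AEStronglyMeasurable g m') : ∫ x, g (T x) ∂m = ∫ y, g y ∂m' := by
  rw [← hT.map_eq] at hg ⊢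
  exact (integral_map hT.measurable.aemeasurable hg).symm

lemma lintegral_pi_prod {E κ : Type*} [Fintype κ] [MeasurableSpace E] (m : Measure E)
    [IsProbabilityMeasure m] (f : κ → E → ℝ≥0∞) (hf : ∀ k, Measurable (f k)) :
    ∫⁻ z : κ → E, ∏ k, f k (z k) ∂(Measure.pi fun _ => m) = ∏ k, ∫⁻ u, f k u ∂m := by
  have h := ProbabilityTheory.lintegral_prod_eq_prod_lintegral_of_indepFun
    (μ := Measure.pi fun _ : κ => m) Finset.univ (fun k (z : κ → E) => f k (z k))
    (ProbabilityTheory.iIndepFun_pi (μ := fun _ : κ => m) fun k => (hf k).aemeasurable)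
    (fun k => (hf k).comp (measurable_pi_apply k))
  rw [h]
  refine Finset.prod_congr rfl fun k _ => ?_
  exact (measurePreserving_eval (fun _ : κ => m) k).lintegral_comp (hf k)

variable {ι : Type*} [Fintype ι] [DecidableEq ι] {X : ι → Type*} [∀ i, MeasurableSpace (X i)]
  (μ : ∀ i, Measure (X i)) [∀ i, IsProbabilityMeasure (μ i)] {ℓ : ℕ}

/-- Once the `i`-th coordinates are resampled, the integrand is a product of functions of
independent variables `z k`, so the inner integral factors. -/
lemma lintegral_eq_lintegral_prod_lintegral {i : ι} {G : (Fin ℓ → ∀ i, X i) → ℝ≥0∞}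
    (hG : Measurable G) {a : Fin ℓ → (Fin ℓ → ∀ i, X i) → X i → ℝ≥0∞}
    (ha : ∀ k x, Measurable (a k x))
    (hGa : ∀ x z, G (substCoord i x z) = ∏ k, a k x (z k)) :
    ∫⁻ x, G x ∂(Measure.pi fun _ => Measure.pi μ)
      = ∫⁻ x, ∏ k, ∫⁻ u, a k x u ∂(μ i) ∂(Measure.pi fun _ => Measure.pi μ) := by
  rw [← (measurePreserving_substCoord (ℓ := ℓ) μ i).lintegral_comp hG,
    lintegral_prod _ (by
      exact (hG.comp (measurePreserving_substCoord μ i).measurable).aemeasurable)]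
  refine lintegral_congr fun x => ?_
  simp only [hGa]
  exact lintegral_pi_prod _ _ fun k => ha k x

lemma integral_eq_integral_prod_integral {i : ι} {G : (Fin ℓ → ∀ i, X i) → ℝ}
    (hG : Integrable G (Measure.pi fun _ => Measure.pi μ))
    {a : Fin ℓ → (Fin ℓ → ∀ i, X i) → X i → ℝ}
    (hGa : ∀ x z, G (substCoord i x z) = ∏ k, a k x (z k)) :
    Integrable (fun x => ∏ k, ∫ u, a k x u ∂(μ i)) (Measure.pi fun _ => Measure.pi μ) ∧
    ∫ x, G x ∂(Measure.pi fun _ => Measure.pi μ)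
      = ∫ x, ∏ k, ∫ u, a k x u ∂(μ i) ∂(Measure.pi fun _ => Measure.pi μ) := by
  have hs := measurePreserving_substCoord (ℓ := ℓ) μ i
  have hi : Integrable (fun q : (Fin ℓ → ∀ i, X i) × (Fin ℓ → X i) => G (substCoord i q.1 q.2))
      ((Measure.pi fun _ => Measure.pi μ).prod (Measure.pi fun _ => μ i)) :=
    hs.integrable_comp_of_integrable hG
  have h2 : ∀ x, ∫ z, G (substCoord i x z) ∂(Measure.pi fun _ => μ i)
      = ∏ k, ∫ u, a k x u ∂(μ i) := fun x => by
    simp only [hGa]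
    exact integral_fintype_prod_eq_prod _
  constructor
  · simpa only [h2] using hi.integral_prod_left
  · rw [← integral_comp_measurePreserving hs hG.1, integral_prod _ hi]
    exact integral_congr_ae (.of_forall h2)

end Fubini

/-! ### Weighted Hölder inequality with exponents `ℓ'` and `ℓ`. -/

section Holder

/-- The exponent conjugate to `ℓ`. -/
def dualExp (ℓ : ℕ) : ℝ := ℓ / (ℓ - 1)

lemma dualExp_holderConjugate {ℓ : ℕ} (hℓ : 2 ≤ ℓ) : (dualExp ℓ).HolderConjugate ℓ := by
  have h : (2 : ℝ) ≤ ℓ := by exact_mod_cast hℓ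
  have := Real.HolderConjugate.conjExponent (p := (ℓ : ℝ)) (by linarith)
  exact this.symm

lemma one_le_dualExp {ℓ : ℕ} (hℓ : 2 ≤ ℓ) : 1 ≤ dualExp ℓ :=
  (dualExp_holderConjugate hℓ).lt.le

lemma dualExp_mul_pred {ℓ : ℕ} (hℓ : 2 ≤ ℓ) : dualExp ℓ * ((ℓ - 1 : ℕ) : ℝ) = ℓ := by
  have h : (2 : ℝ) ≤ ℓ := by exact_mod_cast hℓ
  rw [Nat.cast_sub (by omega), dualExp]
  push_cast
  field_simp [show (ℓ : ℝ) - 1 ≠ 0 by linarith]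

variable {α : Type*} [MeasurableSpace α] (m : Measure α)

lemma lintegral_weighted_holder {ℓ : ℕ} (hℓ : 2 ≤ ℓ) {w f a : α → ℝ≥0∞} (hw : Measurable w)
    (hf : Measurable f) (ha : Measurable a) :
    (∫⁻ x, w x * f x * a x ∂m) ^ ℓ
      ≤ (∫⁻ x, w x * f x ^ dualExp ℓ ∂m) ^ (ℓ - 1) * ∫⁻ x, w x * a x ^ ℓ ∂m := by
  have hc := dualExp_holderConjugate hℓ
  have hs : 0 < dualExp ℓ := hc.pos
  have hl : (0 : ℝ) < ℓ := hc.symm.pos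
  -- The weight is shared as `w = w^(1/ℓ') * w^(1/ℓ)`; both exponents are nonnegative, so this is
  -- valid also where `w` is `0` or `∞`.
  have key := ENNReal.lintegral_mul_le_Lp_mul_Lq m hc
    (f := fun x => w x ^ (1 / dualExp ℓ) * f x) (g := fun x => w x ^ (1 / (ℓ : ℝ)) * a x)
    (by fun_prop) (by fun_prop)
  have e1 : ∀ x, ((fun x => w x ^ (1 / dualExp ℓ) * f x) * fun x => w x ^ (1 / (ℓ : ℝ)) * a x) x
      = w x * f x * a x := by
    intro x
    have : w x ^ (1 / dualExp ℓ) * w x ^ (1 / (ℓ : ℝ)) = w x := by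
      rw [← ENNReal.rpow_add_of_nonneg _ _ (by positivity) (by positivity)]
      have := hc.inv_add_inv_eq_one
      simp only [one_div, this, ENNReal.rpow_one]
    simp only [Pi.mul_apply]
    nth_rw 3 [← this]
    ring
  have e2 : ∀ x, (w x ^ (1 / dualExp ℓ) * f x) ^ dualExp ℓ = w x * f x ^ dualExp ℓ := by
    intro x
    rw [ENNReal.mul_rpow_of_nonneg _ _ hs.le, ← ENNReal.rpow_mul, one_div_mul_cancel hs.ne',
      ENNReal.rpow_one]
  have e3 : ∀ x, (w x ^ (1 / (ℓ : ℝ)) * a x) ^ (ℓ : ℝ) = w x * a x ^ ℓ := by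
    intro x
    rw [ENNReal.mul_rpow_of_nonneg _ _ hl.le, ← ENNReal.rpow_mul, one_div_mul_cancel hl.ne',
      ENNReal.rpow_one, ENNReal.rpow_natCast]
  simp only [e1, e2, e3] at key
  calc _ ≤ _ := pow_le_pow_left₀ (zero_le) key ℓ
    _ = _ := by
      rw [mul_pow, ← ENNReal.rpow_natCast, ← ENNReal.rpow_natCast, ← ENNReal.rpow_mul,
        ← ENNReal.rpow_mul, one_div_mul_cancel hl.ne', ENNReal.rpow_one, ← ENNReal.rpow_natCast]
      congr 2
      have := dualExp_mul_pred hℓ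
      field_simp
      linarith

end Holder

/-! ### The Hölder step in one coordinate, and monotonicity of box moments. -/

section Fubini

variable {ι : Type*} [Fintype ι] [DecidableEq ι] {X : ι → Type*} [∀ i, MeasurableSpace (X i)]
  (μ : ∀ i, Measure (X i)) [∀ i, IsProbabilityMeasure (μ i)] {ℓ : ℕ} [NeZero ℓ]

lemma lintegral_eq_of_single {i : ι} {G H : (Fin ℓ → ∀ i, X i) → ℝ≥0∞}
    (hG : Measurable G) {b : (Fin ℓ → ∀ i, X i) → X i → ℝ≥0∞} (hb : ∀ x, Measurable (b x))
    (hGb : ∀ x z, G (substCoord i x z) = H x * b x (z 0)) :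
    ∫⁻ x, G x ∂(Measure.pi fun _ => Measure.pi μ)
      = ∫⁻ x, H x * ∫⁻ u, b x u ∂(μ i) ∂(Measure.pi fun _ => Measure.pi μ) := by
  -- Only the copy `0` of coordinate `i` occurs; the other copies integrate to `1`.
  rw [lintegral_eq_lintegral_prod_lintegral μ (i := i) hG
    (a := fun k x u => if k = 0 then H x * b x u else 1)]
  · refine lintegral_congr fun x => ?_
    rw [Finset.prod_eq_single 0]
    · simp [lintegral_const_mul _ (hb x)]
    · intro k _ hk; simp [hk]
    · simp
  · intro k x
    split_ifs
    · exact (hb x).const_mul _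
    · exact measurable_const
  · intro x z; simp [hGb]

lemma lintegral_eq_of_replicated {i : ι} {G H : (Fin ℓ → ∀ i, X i) → ℝ≥0∞}
    (hG : Measurable G) {b : (Fin ℓ → ∀ i, X i) → X i → ℝ≥0∞} (hb : ∀ x, Measurable (b x))
    (hGb : ∀ x z, G (substCoord i x z) = H x * ∏ k, b x (z k)) :
    ∫⁻ x, G x ∂(Measure.pi fun _ => Measure.pi μ)
      = ∫⁻ x, H x * (∫⁻ u, b x u ∂(μ i)) ^ ℓ ∂(Measure.pi fun _ => Measure.pi μ) := by
  rw [lintegral_eq_lintegral_prod_lintegral μ (i := i) hG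
    (a := fun k x u => (if k = 0 then H x else 1) * b x u)]
  · refine lintegral_congr fun x => ?_
    simp only [lintegral_const_mul _ (hb x), Finset.prod_mul_distrib]
    simp
  · intro k x
    exact (hb x).const_mul _
  · intro x z; rw [hGb, Finset.prod_mul_distrib]; simp

lemma integral_eq_of_single {i : ι} {G H : (Fin ℓ → ∀ i, X i) → ℝ}
    (hG : Integrable G (Measure.pi fun _ => Measure.pi μ))
    {b : (Fin ℓ → ∀ i, X i) → X i → ℝ}
    (hGb : ∀ x z, G (substCoord i x z) = H x * b x (z 0)) :
    ∫ x, G x ∂(Measure.pi fun _ => Measure.pi μ)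
      = ∫ x, H x * ∫ u, b x u ∂(μ i) ∂(Measure.pi fun _ => Measure.pi μ) := by
  rw [(integral_eq_integral_prod_integral μ (i := i) hG
    (a := fun k x u => if k = 0 then H x * b x u else 1) ?_).2]
  · refine integral_congr_ae (.of_forall fun x => ?_)
    simp only
    rw [Finset.prod_eq_single 0]
    · simp [integral_const_mul]
    · intro k _ hk; simp [hk]
    · simp
  · intro x z; simp [hGb]

lemma integral_eq_of_replicated {i : ι} {G H : (Fin ℓ → ∀ i, X i) → ℝ}
    (hG : Integrable G (Measure.pi fun _ => Measure.pi μ))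
    {b : (Fin ℓ → ∀ i, X i) → X i → ℝ}
    (hGb : ∀ x z, G (substCoord i x z) = H x * ∏ k, b x (z k)) :
    Integrable (fun x => H x * (∫ u, b x u ∂(μ i)) ^ ℓ) (Measure.pi fun _ => Measure.pi μ) ∧
    ∫ x, G x ∂(Measure.pi fun _ => Measure.pi μ)
      = ∫ x, H x * (∫ u, b x u ∂(μ i)) ^ ℓ ∂(Measure.pi fun _ => Measure.pi μ) := by
  have h := integral_eq_integral_prod_integral μ (i := i) hG
    (a := fun k x u => (if k = 0 then H x else 1) * b x u)
    (by intro x z; rw [hGb, Finset.prod_mul_distrib]; simp)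
  have e : ∀ x, ∏ k : Fin ℓ, ∫ u, (if k = 0 then H x else 1) * b x u ∂(μ i)
      = H x * (∫ u, b x u ∂(μ i)) ^ ℓ := by
    intro x
    simp only [integral_const_mul, Finset.prod_mul_distrib]
    simp
  simpa only [e] using h

/-- With `B` the average of `b` over coordinate `i`, the left side is at most `(∫ W f B)^ℓ`. Hölder
with weight `W` leaves `∫ W B^ℓ`, and the power `B^ℓ` unfolds into `ℓ` independent copies of the
coordinate. -/
lemma lintegral_pow_le_of_replicated (hℓ : 2 ≤ ℓ) {i : ι}
    {G G' H W f : (Fin ℓ → ∀ i, X i) → ℝ≥0∞} {b : (Fin ℓ → ∀ i, X i) → X i → ℝ≥0∞}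
    (hG : Measurable G) (hG' : Measurable G') (hW : Measurable W) (hf : Measurable f)
    (hb : Measurable (Function.uncurry b)) (hH : ∀ x, H x ≤ W x * f x)
    (hGb : ∀ x z, G (substCoord i x z) = H x * b x (z 0))
    (hGb' : ∀ x z, G' (substCoord i x z) = W x * ∏ k, b x (z k)) :
    (∫⁻ x, G x ∂(Measure.pi fun _ => Measure.pi μ)) ^ ℓ
      ≤ (∫⁻ x, W x * f x ^ dualExp ℓ ∂(Measure.pi fun _ => Measure.pi μ)) ^ (ℓ - 1)
        * ∫⁻ x, G' x ∂(Measure.pi fun _ => Measure.pi μ) := by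
  have hbx : ∀ x, Measurable (b x) := fun x => hb.comp (measurable_prodMk_left (x := x))
  rw [lintegral_eq_of_single μ hG hbx hGb, lintegral_eq_of_replicated μ hG' hbx hGb']
  refine (pow_le_pow_left₀ zero_le (lintegral_mono fun x => mul_le_mul_left (hH x) _) ℓ).trans ?_
  exact lintegral_weighted_holder _ hℓ hW hf hb.lintegral_prod_right'

lemma enorm_integral_pow_le_of_replicated (hℓ : 2 ≤ ℓ) (hev : Even ℓ) {i : ι}
    {G G' H W : (Fin ℓ → ∀ i, X i) → ℝ} {f : (Fin ℓ → ∀ i, X i) → ℝ≥0∞}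
    {b : (Fin ℓ → ∀ i, X i) → X i → ℝ}
    (hG : Integrable G (Measure.pi fun _ => Measure.pi μ))
    (hG' : Integrable G' (Measure.pi fun _ => Measure.pi μ))
    (hW : Measurable W) (hf : Measurable f) (hW0 : ∀ x, 0 ≤ W x)
    (hb : Measurable (Function.uncurry b)) (hH : ∀ x, ‖H x‖ₑ ≤ ‖W x‖ₑ * f x)
    (hGb : ∀ x z, G (substCoord i x z) = H x * b x (z 0))
    (hGb' : ∀ x z, G' (substCoord i x z) = W x * ∏ k, b x (z k)) :
    ‖∫ x, G x ∂(Measure.pi fun _ => Measure.pi μ)‖ₑ ^ ℓ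
      ≤ (∫⁻ x, ‖W x‖ₑ * f x ^ dualExp ℓ ∂(Measure.pi fun _ => Measure.pi μ)) ^ (ℓ - 1)
        * ‖∫ x, G' x ∂(Measure.pi fun _ => Measure.pi μ)‖ₑ := by
  obtain ⟨hi, hr⟩ := integral_eq_of_replicated μ hG' hGb'
  have hbm : Measurable fun x => ∫ u, b x u ∂(μ i) :=
    (hb.stronglyMeasurable.integral_prod_right').measurable
  -- Here evenness of `ℓ` enters: the replicated integrand becomes nonnegative after averaging over
  -- coordinate `i`, so its integral needs no absolute value inside and signs are not lost.
  have hnn : ∀ x, 0 ≤ W x * (∫ u, b x u ∂(μ i)) ^ ℓ := fun x =>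
    mul_nonneg (hW0 x) (hev.pow_nonneg _)
  rw [integral_eq_of_single μ hG hGb, hr]
  have e : ‖∫ x, W x * (∫ u, b x u ∂(μ i)) ^ ℓ ∂(Measure.pi fun _ => Measure.pi μ)‖ₑ
      = ∫⁻ x, ‖W x‖ₑ * ‖∫ u, b x u ∂(μ i)‖ₑ ^ ℓ ∂(Measure.pi fun _ => Measure.pi μ) := by
    rw [Real.enorm_eq_ofReal (integral_nonneg hnn),
      ofReal_integral_eq_lintegral_ofReal hi (.of_forall hnn)]
    refine lintegral_congr fun x => ?_
    rw [← Real.enorm_eq_ofReal (hnn x), enorm_mul, enorm_pow]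
  rw [e]
  refine (pow_le_pow_left₀ zero_le ((enorm_integral_le_lintegral_enorm _).trans
    (lintegral_mono fun x => ?_)) ℓ).trans
    (lintegral_weighted_holder _ hℓ hW.enorm hf hbm.enorm)
  rw [enorm_mul]
  exact mul_le_mul_left (hH x) _

/-- The sub-box moment `𝔼 ∏_ω g(x^{(ω)})`, over the `ω` that vanish outside `S`. -/
def boxMoment (ℓ : ℕ) [NeZero ℓ] (S : Finset ι) (g : (∀ i, X i) → ℝ≥0∞) : ℝ≥0∞ :=
  ∫⁻ x, ∏ ω ∈ subbox ℓ S, g (mixAll x ω) ∂(Measure.pi fun _ : Fin ℓ => Measure.pi μ)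

/-- The Hölder step with trivial weight, that is, Jensen's inequality; normalised box moments
therefore increase with the set of copied coordinates. -/
lemma boxMoment_pow_le (hℓ : 2 ≤ ℓ) {S : Finset ι} {i : ι} (hi : i ∉ S) {g : (∀ i, X i) → ℝ≥0∞}
    (hg : Measurable g) : boxMoment μ ℓ S g ^ ℓ ≤ boxMoment μ ℓ (insert i S) g := by
  have h := lintegral_pow_le_of_replicated μ hℓ (i := i)
    (G := fun x => ∏ ω ∈ subbox ℓ S, g (mixAll x ω))
    (G' := fun x => ∏ ω ∈ subbox ℓ (insert i S), g (mixAll x ω)) (H := 1) (W := 1) (f := 1)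
    (b := fun x u => ∏ ω ∈ subbox ℓ S, g (Function.update (mixAll x ω) i u))
    (by fun_prop) (by fun_prop) measurable_one measurable_one
    (Finset.measurable_fun_prod _ fun ω _ => hg.comp (measurable_update_mixAll i ω))
    (by simp) ?_ ?_
  · simpa [boxMoment] using h
  · intro x z
    simp only [Pi.one_apply, one_mul]
    refine Finset.prod_congr rfl fun ω hω => ?_
    rw [mixAll_substCoord, mem_subbox.1 hω i hi]
  · intro x z
    simp only [Pi.one_apply, one_mul]
    rw [prod_subbox_insert hi]
    simp only [mixAll_substCoord_update]

lemma boxMoment_pow_le_of_subset (hℓ : 2 ≤ ℓ) {S T : Finset ι} (hST : S ⊆ T)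
    {g : (∀ i, X i) → ℝ≥0∞} (hg : Measurable g) :
    boxMoment μ ℓ S g ^ ℓ ^ (T.card - S.card) ≤ boxMoment μ ℓ T g := by
  obtain ⟨k, hk⟩ : ∃ k, (T \ S).card = k := ⟨_, rfl⟩
  induction k generalizing S with
  | zero =>
    have : T = S := (Finset.sdiff_eq_empty_iff_subset.1 (Finset.card_eq_zero.1 hk)).antisymm hST
    subst this; simp
  | succ k ih =>
    obtain ⟨i, hi⟩ : (T \ S).Nonempty := Finset.card_pos.1 (by omega)
    obtain ⟨hiT, hiS⟩ := Finset.mem_sdiff.1 hi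
    have hsub : insert i S ⊆ T := Finset.insert_subset hiT hST
    have hc := Finset.card_insert_of_notMem hiS
    have hle := Finset.card_le_card hsub
    have h2 := ih hsub (by
      rw [Finset.card_sdiff_of_subset hsub, hc]
      rw [Finset.card_sdiff_of_subset hST] at hk; omega)
    refine le_trans ?_ h2
    have : T.card - S.card = (T.card - (insert i S).card) + 1 := by omega
    rw [this, pow_succ', pow_mul]
    exact pow_le_pow_left₀ zero_le (boxMoment_pow_le μ hℓ hiS hg) _

/-- Hölder's inequality in the coordinate `j`: a bound for the moments of the functions `g k`
bounds the mixed moment, in which `g k` is used for the index vectors with `ω j = k`. -/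
lemma lintegral_prod_subbox_le (hℓ : 2 ≤ ℓ) {S : Finset ι} {j : ι} (hj : j ∈ S)
    {g : Fin ℓ → (∀ i, X i) → ℝ≥0∞} (hg : ∀ k, Measurable (g k)) {D : ℝ≥0∞}
    (hD : ∀ k, boxMoment μ ℓ S (g k) ≤ D) :
    ∫⁻ x, ∏ ω ∈ subbox ℓ S, g (ω j) (mixAll x ω) ∂(Measure.pi fun _ : Fin ℓ => Measure.pi μ)
      ≤ D := by
  obtain ⟨T, hjT, rfl⟩ : ∃ T, j ∉ T ∧ insert j T = S :=
    ⟨S.erase j, Finset.notMem_erase j S, Finset.insert_erase hj⟩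
  have hb : ∀ k, Measurable (Function.uncurry fun (x : Fin ℓ → ∀ i, X i) u =>
      ∏ ω ∈ subbox ℓ T, g k (Function.update (mixAll x ω) j u)) := fun k =>
    Finset.measurable_fun_prod _ fun ω _ => (hg k).comp (measurable_update_mixAll j ω)
  have hbx : ∀ k (x : Fin ℓ → ∀ i, X i), Measurable fun u =>
      ∏ ω ∈ subbox ℓ T, g k (Function.update (mixAll x ω) j u) := fun k x =>
    (hb k).comp (measurable_prodMk_left (x := x))
  have hA : ∀ k, Measurable fun x : Fin ℓ → ∀ i, X i => ∫⁻ u,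
      ∏ ω ∈ subbox ℓ T, g k (Function.update (mixAll x ω) j u) ∂(μ j) := fun k =>
    (hb k).lintegral_prod_right'
  have hl0 : (ℓ : ℝ) ≠ 0 := by exact_mod_cast NeZero.ne ℓ
  rw [lintegral_eq_lintegral_prod_lintegral μ (i := j)
    (by fun_prop)
    (a := fun k x u => ∏ ω ∈ subbox ℓ T, g k (Function.update (mixAll x ω) j u))
    (fun k x => hbx k x) (fun x z => by
      rw [prod_subbox_insert hjT]
      simp only [mixAll_substCoord_update, Function.update_self])]
  have h2 : ∀ k, ∫⁻ x, (∫⁻ u, ∏ ω ∈ subbox ℓ T, g k (Function.update (mixAll x ω) j u) ∂(μ j)) ^ ℓ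
      ∂(Measure.pi fun _ : Fin ℓ => Measure.pi μ) ≤ D := by
    intro k
    refine le_trans (le_of_eq ?_) (hD k)
    rw [boxMoment, lintegral_eq_of_replicated μ (i := j) (H := 1)
      (G := fun x => ∏ ω ∈ subbox ℓ (insert j T), g k (mixAll x ω)) (by fun_prop) (hbx k)]
    · simp
    · intro x z
      rw [prod_subbox_insert hjT]
      simp only [mixAll_substCoord_update, Pi.one_apply, one_mul]
  -- Hölder for `ℓ` factors, each with exponent `ℓ`: the `ℓ`-th moment of the `k`-th fibre integral
  -- is exactly the box moment of `g k`.
  calc _ = ∫⁻ x, ∏ k : Fin ℓ, ((∫⁻ u, ∏ ω ∈ subbox ℓ T,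
        g k (Function.update (mixAll x ω) j u) ∂(μ j)) ^ ℓ) ^ (1 / (ℓ : ℝ))
        ∂(Measure.pi fun _ : Fin ℓ => Measure.pi μ) := by
        refine lintegral_congr fun x => Finset.prod_congr rfl fun k _ => ?_
        rw [← ENNReal.rpow_natCast, ← ENNReal.rpow_mul, mul_one_div_cancel hl0, ENNReal.rpow_one]
    _ ≤ ∏ k : Fin ℓ, (∫⁻ x, (∫⁻ u, ∏ ω ∈ subbox ℓ T,
        g k (Function.update (mixAll x ω) j u) ∂(μ j)) ^ ℓ
          ∂(Measure.pi fun _ : Fin ℓ => Measure.pi μ)) ^ (1 / (ℓ : ℝ)) :=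
        ENNReal.lintegral_prod_norm_pow_le _ (fun k _ => ((hA k).pow_const ℓ).aemeasurable)
          (by simp [hl0]) (fun _ _ => by positivity)
    _ ≤ ∏ k : Fin ℓ, D ^ (1 / (ℓ : ℝ)) :=
        Finset.prod_le_prod' fun k _ => ENNReal.rpow_le_rpow (h2 k) (by positivity)
    _ = D := by
        simp only [Finset.prod_const, Finset.card_univ, Fintype.card_fin]
        rw [← ENNReal.rpow_natCast, ← ENNReal.rpow_mul, one_div_mul_cancel hl0, ENNReal.rpow_one]

end Fubini

/-! ### Iterating the Hölder step over the coordinates. -/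

section Iteration

variable {ι : Type*} [DecidableEq ι] {ℓ : ℕ}

/-- Iterating the inequality `q S ^ ℓ ≤ M ^ ℓ ^ |S| * q (S ∪ {i})`. -/
lemma pow_le_of_step {q : Finset ι → ℝ≥0∞} {j : ι} {M : ℝ≥0∞}
    (h : ∀ S i, j ∈ S → i ∉ S → q S ^ ℓ ≤ M ^ ℓ ^ S.card * q (insert i S)) {T : Finset ι}
    (hT : j ∉ T) : q {j} ^ ℓ ^ T.card ≤ (M ^ T.card) ^ ℓ ^ T.card * q (insert j T) := by
  induction T using Finset.induction_on with
  | empty => simp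
  | insert i T hi ih =>
    simp only [Finset.mem_insert, not_or] at hT
    have h1 := ih hT.2
    have h2 := h (insert j T) i (Finset.mem_insert_self _ _)
      (by simp [hi, Ne.symm hT.1])
    rw [Finset.card_insert_of_notMem hT.2] at h2
    rw [Finset.card_insert_of_notMem hi, pow_succ ℓ, pow_mul, Finset.insert_comm]
    calc _ ≤ ((M ^ T.card) ^ ℓ ^ T.card * q (insert j T)) ^ ℓ :=
          pow_le_pow_left₀ zero_le h1 _
      _ = (M ^ T.card) ^ (ℓ ^ T.card * ℓ) * q (insert j T) ^ ℓ := by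
          rw [mul_pow, ← pow_mul]
      _ ≤ (M ^ T.card) ^ (ℓ ^ T.card * ℓ) * (M ^ ℓ ^ (T.card + 1) * q (insert i (insert j T))) := by
          gcongr
      _ = _ := by
          rw [← mul_assoc, ← pow_succ ℓ, ← mul_pow, ← pow_succ]

/-- Finiteness descends from the full blow-up, where only weights occur, to all intermediate stages;
this is how their integrability is obtained. -/
lemma ne_top_of_step [Fintype ι] (hℓ : ℓ ≠ 0) {q : Finset ι → ℝ≥0∞} {j : ι} {M : ℝ≥0∞} (hM : M ≠ ∞)
    (h : ∀ S i, j ∈ S → i ∉ S → q S ^ ℓ ≤ M ^ ℓ ^ S.card * q (insert i S))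
    (hq : q Finset.univ ≠ ∞) {S : Finset ι} (hS : j ∈ S) : q S ≠ ∞ := by
  obtain ⟨k, hk⟩ : ∃ k, Sᶜ.card = k := ⟨_, rfl⟩
  induction k generalizing S with
  | zero =>
    have : S = Finset.univ := by simpa using hk
    rwa [this]
  | succ k ih =>
    obtain ⟨i, hi⟩ : Sᶜ.Nonempty := Finset.card_pos.1 (by omega)
    have hi' : i ∉ S := by simpa using hi
    have h1 := ih (S := insert i S) (Finset.mem_insert_of_mem hS) (by
      rw [Finset.compl_insert, Finset.card_erase_of_mem hi]; omega)
    have h2 := (h S i hS hi').trans_lt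
      (ENNReal.mul_lt_top (ENNReal.pow_lt_top hM.lt_top) h1.lt_top)
    exact fun h0 => by simp [h0, hℓ] at h2

end Iteration

/-! ### Partial blow-ups and the Hölder step applied to them. -/

section Blow

variable {ι : Type*} [Fintype ι] [DecidableEq ι] {X : ι → Type*} {ℓ : ℕ} [NeZero ℓ]

/-- The product of the functions `f i k` over the blow-up of the coordinates in `S`: the function
`f i k` is evaluated at `x^{(ω)}` for all `ω` that vanish outside `S ∖ {i}` and have `ω j = k`. -/
def blow {R : Type*} [CommMonoid R] (j : ι) (S : Finset ι) (f : ι → Fin ℓ → (∀ i, X i) → R)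
    (x : Fin ℓ → ∀ i, X i) : R :=
  ∏ i, ∏ ω ∈ subbox ℓ (S.erase i), f i (ω j) (mixAll x ω)

section Monoid

variable {R : Type*} [CommMonoid R] {j i : ι} {S : Finset ι}
  {f : ι → Fin ℓ → (∀ i, X i) → R}

/-- Since `i ∉ S`, every index vector involved has `ω i = 0`, so only `z 0` appears, and the factor
`f i` ignores it. This is the shape `H * b (z 0)` required by the Hölder step. -/
lemma blow_substCoord (hi : i ∉ S)
    (hf : ∀ k x u, f i k (Function.update x i u) = f i k x)
    (x : Fin ℓ → ∀ i, X i) (z : Fin ℓ → X i) :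
    blow j S f (substCoord i x z) = (∏ ω ∈ subbox ℓ S, f i (ω j) (mixAll x ω)) *
      ∏ m ∈ Finset.univ.erase i, ∏ ω ∈ subbox ℓ (S.erase m),
        f m (ω j) (Function.update (mixAll x ω) i (z 0)) := by
  rw [blow, ← Finset.mul_prod_erase _ _ (Finset.mem_univ i), Finset.erase_eq_of_notMem hi]
  congr 1
  · refine Finset.prod_congr rfl fun ω _ => ?_
    rw [mixAll_substCoord, hf]
  · refine Finset.prod_congr rfl fun m _ => Finset.prod_congr rfl fun ω hω => ?_
    rw [mixAll_substCoord, mem_subbox.1 hω i fun h => hi (Finset.mem_of_mem_erase h)]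

/-- Inserting `i` does not enlarge the box of the `i`-th factor, as `(insert i S).erase i = S`,
whereas every other factor is repeated once for each `z k`. This is the replicated integrand `W * ∏
b (z k)`. -/
lemma blow_insert_substCoord (hj : j ∈ S) (hi : i ∉ S) {w : Fin ℓ → (∀ i, X i) → R}
    (hw : ∀ k x u, w k (Function.update x i u) = w k x)
    (x : Fin ℓ → ∀ i, X i) (z : Fin ℓ → X i) :
    blow j (insert i S) (Function.update f i w) (substCoord i x z)
      = (∏ ω ∈ subbox ℓ S, w (ω j) (mixAll x ω)) *
      ∏ k, ∏ m ∈ Finset.univ.erase i, ∏ ω ∈ subbox ℓ (S.erase m),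
        f m (ω j) (Function.update (mixAll x ω) i (z k)) := by
  have hij : j ≠ i := fun h => hi (h ▸ hj)
  rw [blow, ← Finset.mul_prod_erase _ _ (Finset.mem_univ i), Finset.erase_insert hi]
  congr 1
  · refine Finset.prod_congr rfl fun ω _ => ?_
    rw [mixAll_substCoord, Function.update_self, hw]
  · rw [Finset.prod_comm]
    refine Finset.prod_congr rfl fun m hm => ?_
    have hmi : m ≠ i := Finset.ne_of_mem_erase hm
    rw [Finset.erase_insert_of_ne hmi.symm,
      prod_subbox_insert fun h => hi (Finset.mem_of_mem_erase h)]
    refine Finset.prod_congr rfl fun k _ => Finset.prod_congr rfl fun ω _ => ?_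
    rw [Function.update_of_ne hmi, Function.update_of_ne hij, mixAll_substCoord_update]

end Monoid

lemma enorm_finset_prod {κ : Type*} (s : Finset κ) (f : κ → ℝ) :
    ‖∏ i ∈ s, f i‖ₑ = ∏ i ∈ s, ‖f i‖ₑ := by
  classical
  induction s using Finset.induction_on with
  | empty => simp
  | insert a s ha ih => rw [Finset.prod_insert ha, Finset.prod_insert ha, enorm_mul, ih]

lemma enorm_blow (j : ι) (S : Finset ι) (f : ι → Fin ℓ → (∀ i, X i) → ℝ)
    (x : Fin ℓ → ∀ i, X i) : ‖blow j S f x‖ₑ = blow j S (fun i k x => ‖f i k x‖ₑ) x := by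
  simp only [blow, enorm_finset_prod]

variable [∀ i, MeasurableSpace (X i)]

lemma measurable_blow {R : Type*} [CommMonoid R] [MeasurableSpace R] [MeasurableMul₂ R] (j : ι)
    (S : Finset ι) {f : ι → Fin ℓ → (∀ i, X i) → R} (hf : ∀ i k, Measurable (f i k)) :
    Measurable (blow j S f) := by
  unfold blow
  exact Finset.measurable_fun_prod _ fun i _ => Finset.measurable_fun_prod _ fun ω _ =>
    (hf i _).comp (measurable_mixAll ω)

lemma measurable_blow_fibre {R : Type*} [CommMonoid R] [MeasurableSpace R] [MeasurableMul₂ R]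
    (i j : ι) (S : Finset ι) {f : ι → Fin ℓ → (∀ i, X i) → R} (hf : ∀ i k, Measurable (f i k)) :
    Measurable (Function.uncurry fun (x : Fin ℓ → ∀ i, X i) (u : X i) =>
      ∏ m ∈ Finset.univ.erase i, ∏ ω ∈ subbox ℓ (S.erase m),
        f m (ω j) (Function.update (mixAll x ω) i u)) :=
  Finset.measurable_fun_prod _ fun m _ => Finset.measurable_fun_prod _ fun ω _ =>
    (hf m _).comp (measurable_update_mixAll i ω)

variable (μ : ∀ i, Measure (X i)) [∀ i, IsProbabilityMeasure (μ i)]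

lemma boxMoment_le_of_subset (hℓ : 2 ≤ ℓ) {S T : Finset ι} (hST : S ⊆ T)
    {g : (∀ i, X i) → ℝ≥0∞} (hg : Measurable g) {D : ℝ≥0∞}
    (hD : boxMoment μ ℓ T g ≤ D ^ ℓ ^ T.card) : boxMoment μ ℓ S g ≤ D ^ ℓ ^ S.card := by
  refine (ENNReal.pow_le_pow_left_iff (n := ℓ ^ (T.card - S.card))
    (pow_ne_zero _ (NeZero.ne ℓ))).1 ?_
  rw [← pow_mul, ← pow_add, Nat.add_sub_cancel' (Finset.card_le_card hST)]
  exact (boxMoment_pow_le_of_subset μ hℓ hST hg).trans hD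

lemma prod_mul_prod_rpow {κ : Type*} (s : Finset κ) (a b : κ → ℝ≥0∞) {r : ℝ} (hr : 0 ≤ r) :
    (∏ i ∈ s, a i) * (∏ i ∈ s, b i) ^ r = ∏ i ∈ s, a i * b i ^ r := by
  rw [Finset.prod_mul_distrib, ENNReal.prod_rpow_of_nonneg hr]

/-- Hölder in coordinate `j` separates the functions belonging to different `k`; monotonicity in the
box then replaces `S` by all coordinates other than `i`. -/
lemma lintegral_prod_subbox_mul_le (hℓ : 2 ≤ ℓ) {S : Finset ι} {i j : ι} (hj : j ∈ S) (hi : i ∉ S)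
    {w φ : Fin ℓ → (∀ i, X i) → ℝ≥0∞} (hw : ∀ k, Measurable (w k)) (hφ : ∀ k, Measurable (φ k))
    {D : ℝ≥0∞} (hD : ∀ k, boxMoment μ ℓ (Finset.univ.erase i) (fun x => w k x * φ k x ^ dualExp ℓ)
      ≤ D ^ ℓ ^ (Finset.univ.erase i).card) :
    ∫⁻ x, (∏ ω ∈ subbox ℓ S, w (ω j) (mixAll x ω)) *
        (∏ ω ∈ subbox ℓ S, φ (ω j) (mixAll x ω)) ^ dualExp ℓ
          ∂(Measure.pi fun _ : Fin ℓ => Measure.pi μ) ≤ D ^ ℓ ^ S.card := by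
  have hs : 0 ≤ dualExp ℓ := zero_le_one.trans (one_le_dualExp hℓ)
  simp only [prod_mul_prod_rpow _ _ _ hs]
  exact lintegral_prod_subbox_le μ hℓ hj (g := fun k x => w k x * φ k x ^ dualExp ℓ)
    (fun k => (hw k).mul ((hφ k).pow_const _)) fun k =>
      boxMoment_le_of_subset μ hℓ (fun m hm => Finset.mem_erase.2
        ⟨fun h => hi (by rwa [← h]), Finset.mem_univ m⟩) ((hw k).mul ((hφ k).pow_const _)) (hD k)

lemma lintegral_blow_pow_le (hℓ : 2 ≤ ℓ) {S : Finset ι} {i j : ι} (hj : j ∈ S) (hi : i ∉ S)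
    {f : ι → Fin ℓ → (∀ i, X i) → ℝ≥0∞} (hf : ∀ i k, Measurable (f i k))
    (hfi : ∀ k x u, f i k (Function.update x i u) = f i k x)
    {w φ : Fin ℓ → (∀ i, X i) → ℝ≥0∞} (hw : ∀ k, Measurable (w k)) (hφ : ∀ k, Measurable (φ k))
    (hwi : ∀ k x u, w k (Function.update x i u) = w k x) (hle : ∀ k x, f i k x ≤ w k x * φ k x)
    {D : ℝ≥0∞} (hD : ∀ k, boxMoment μ ℓ (Finset.univ.erase i) (fun x => w k x * φ k x ^ dualExp ℓ)
      ≤ D ^ ℓ ^ (Finset.univ.erase i).card) :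
    (∫⁻ x, blow j S f x ∂(Measure.pi fun _ : Fin ℓ => Measure.pi μ)) ^ ℓ
      ≤ (D ^ (ℓ - 1)) ^ ℓ ^ S.card * ∫⁻ x, blow j (insert i S) (Function.update f i w) x
          ∂(Measure.pi fun _ : Fin ℓ => Measure.pi μ) := by
  have hu : ∀ m k, Measurable (Function.update f i w m k) := by
    intro m k
    by_cases h : m = i
    · subst h; simpa using hw k
    · simpa [h] using hf m k
  have key := lintegral_pow_le_of_replicated μ hℓ (i := i) (measurable_blow j S hf)
    (measurable_blow j (insert i S) hu)
    (W := fun x => ∏ ω ∈ subbox ℓ S, w (ω j) (mixAll x ω))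
    (f := fun x => ∏ ω ∈ subbox ℓ S, φ (ω j) (mixAll x ω))
    (by fun_prop) (by fun_prop) (measurable_blow_fibre i j S hf)
    (fun x => by
      rw [← Finset.prod_mul_distrib]
      exact Finset.prod_le_prod' fun ω _ => hle _ _)
    (blow_substCoord hi hfi) (blow_insert_substCoord hj hi hwi)
  refine key.trans (mul_le_mul_left ?_ _)
  -- The cost is arranged as `D^(ℓ-1)` per index vector in the box of `S`, the form in which the
  -- final root removes the outer exponent.
  rw [← pow_mul, mul_comm (ℓ - 1), pow_mul]
  exact pow_le_pow_left₀ zero_le (lintegral_prod_subbox_mul_le μ hℓ hj hi hw hφ hD) _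

lemma enorm_integral_blow_pow_le (hℓ : 2 ≤ ℓ) (hev : Even ℓ) {S : Finset ι} {i j : ι}
    (hj : j ∈ S) (hi : i ∉ S)
    {f : ι → Fin ℓ → (∀ i, X i) → ℝ} (hf : ∀ i k, Measurable (f i k))
    (hfi : ∀ k x u, f i k (Function.update x i u) = f i k x)
    {w : Fin ℓ → (∀ i, X i) → ℝ} {φ : Fin ℓ → (∀ i, X i) → ℝ≥0∞} (hw : ∀ k, Measurable (w k))
    (hw0 : ∀ k x, 0 ≤ w k x) (hφ : ∀ k, Measurable (φ k))
    (hwi : ∀ k x u, w k (Function.update x i u) = w k x)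
    (hle : ∀ k x, ‖f i k x‖ₑ ≤ ‖w k x‖ₑ * φ k x)
    {D : ℝ≥0∞} (hD : ∀ k, boxMoment μ ℓ (Finset.univ.erase i)
      (fun x => ‖w k x‖ₑ * φ k x ^ dualExp ℓ) ≤ D ^ ℓ ^ (Finset.univ.erase i).card)
    (h1 : Integrable (blow j S f) (Measure.pi fun _ : Fin ℓ => Measure.pi μ))
    (h2 : Integrable (blow j (insert i S) (Function.update f i w))
      (Measure.pi fun _ : Fin ℓ => Measure.pi μ)) :
    ‖∫ x, blow j S f x ∂(Measure.pi fun _ : Fin ℓ => Measure.pi μ)‖ₑ ^ ℓ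
      ≤ (D ^ (ℓ - 1)) ^ ℓ ^ S.card * ‖∫ x, blow j (insert i S) (Function.update f i w) x
          ∂(Measure.pi fun _ : Fin ℓ => Measure.pi μ)‖ₑ := by
  have key := enorm_integral_pow_le_of_replicated μ hℓ hev (i := i) h1 h2
    (W := fun x => ∏ ω ∈ subbox ℓ S, w (ω j) (mixAll x ω))
    (f := fun x => ∏ ω ∈ subbox ℓ S, φ (ω j) (mixAll x ω))
    (by fun_prop) (by fun_prop) (fun x => Finset.prod_nonneg fun ω _ => hw0 _ _)
    (measurable_blow_fibre i j S hf)
    (fun x => by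
      rw [enorm_finset_prod, enorm_finset_prod, ← Finset.prod_mul_distrib]
      exact Finset.prod_le_prod' fun ω _ => hle _ _)
    (blow_substCoord hi hfi) (blow_insert_substCoord hj hi hwi)
  refine key.trans (mul_le_mul_left ?_ _)
  rw [← pow_mul, mul_comm (ℓ - 1), pow_mul]
  simp only [enorm_finset_prod]
  exact pow_le_pow_left₀ zero_le (lintegral_prod_subbox_mul_le μ hℓ hj hi
    (w := fun k x => ‖w k x‖ₑ) (fun k => (hw k).enorm) hφ hD) _

end Blow

/-! ### Eliminating all functions in favour of their weights. -/

section Weighted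

variable {ι : Type*} [Fintype ι] [DecidableEq ι] {X : ι → Type*} [∀ i, MeasurableSpace (X i)]
  (μ : ∀ i, Measure (X i)) {ℓ : ℕ} [NeZero ℓ]

/-- Away from `j`, the function `f i k` does not depend on the coordinate `i` and is dominated by
the product of a weight `w i k` and a function `φ i k` for which `w i k * φ i k ^ ℓ'` has bounded
box moments, where `ℓ'` is conjugate to `ℓ`. -/
structure WeightedBound (j : ι) (f w : ι → Fin ℓ → (∀ i, X i) → ℝ)
    (φ : ι → Fin ℓ → (∀ i, X i) → ℝ≥0∞) (D : ℝ≥0∞) : Prop where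
  measurable_f : ∀ i k, Measurable (f i k)
  measurable_w : ∀ i k, Measurable (w i k)
  measurable_φ : ∀ i k, Measurable (φ i k)
  f_update : ∀ i ≠ j, ∀ k x u, f i k (Function.update x i u) = f i k x
  w_update : ∀ i ≠ j, ∀ k x u, w i k (Function.update x i u) = w i k x
  w_nonneg : ∀ i ≠ j, ∀ k x, 0 ≤ w i k x
  le : ∀ i ≠ j, ∀ k x, ‖f i k x‖ₑ ≤ ‖w i k x‖ₑ * φ i k x
  moment : ∀ i ≠ j, ∀ k, boxMoment μ ℓ (Finset.univ.erase i)
    (fun x => ‖w i k x‖ₑ * φ i k x ^ dualExp ℓ) ≤ D ^ ℓ ^ (Finset.univ.erase i).card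
  eq : f j = w j

namespace WeightedBound

variable {μ} {j : ι} {f w : ι → Fin ℓ → (∀ i, X i) → ℝ}
  {φ : ι → Fin ℓ → (∀ i, X i) → ℝ≥0∞} {D : ℝ≥0∞}

lemma measurable_piecewise (h : WeightedBound μ j f w φ D) (S : Finset ι) (i : ι) (k : Fin ℓ) :
    Measurable (S.piecewise w f i k) := by
  by_cases hi : i ∈ S
  · simpa [hi] using h.measurable_w i k
  · simpa [hi] using h.measurable_f i k

lemma singleton_piecewise (h : WeightedBound μ j f w φ D) : ({j} : Finset ι).piecewise w f = f := by
  rw [Finset.piecewise_singleton, ← h.eq, Function.update_eq_self]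

variable [∀ i, IsProbabilityMeasure (μ i)]

lemma lintegral_step (h : WeightedBound μ j f w φ D) (hℓ : 2 ≤ ℓ) {S : Finset ι} {i : ι}
    (hj : j ∈ S) (hi : i ∉ S) :
    (∫⁻ x, ‖blow j S (S.piecewise w f) x‖ₑ ∂(Measure.pi fun _ : Fin ℓ => Measure.pi μ)) ^ ℓ
      ≤ (D ^ (ℓ - 1)) ^ ℓ ^ S.card *
        ∫⁻ x, ‖blow j (insert i S) ((insert i S).piecewise w f) x‖ₑ
          ∂(Measure.pi fun _ : Fin ℓ => Measure.pi μ) := by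
  have hij : i ≠ j := fun e => hi (e ▸ hj)
  have key := lintegral_blow_pow_le μ hℓ hj hi
    (f := fun m k x => ‖S.piecewise w f m k x‖ₑ) (w := fun k x => ‖w i k x‖ₑ) (φ := φ i)
    (fun m k => (h.measurable_piecewise S m k).enorm)
    (fun k x u => by simp [hi, h.f_update i hij])
    (fun k => (h.measurable_w i k).enorm) (h.measurable_φ i)
    (fun k x u => by simp [h.w_update i hij])
    (fun k x => by simpa [hi] using h.le i hij k x) (h.moment i hij)
  have e : (Function.update (fun m k x => ‖S.piecewise w f m k x‖ₑ) i fun k x => ‖w i k x‖ₑ)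
      = fun m k x => ‖(insert i S).piecewise w f m k x‖ₑ := by
    rw [Finset.piecewise_insert]
    ext m k x
    by_cases hm : m = i
    · subst hm; simp
    · simp [hm]
  rw [e] at key
  simpa only [enorm_blow] using key

lemma lintegral_le (h : WeightedBound μ j f w φ D) (hℓ : 2 ≤ ℓ) :
    (∫⁻ x, ‖blow j {j} f x‖ₑ ∂(Measure.pi fun _ : Fin ℓ => Measure.pi μ))
        ^ ℓ ^ (Finset.univ.erase j).card
      ≤ ((D ^ (ℓ - 1)) ^ (Finset.univ.erase j).card) ^ ℓ ^ (Finset.univ.erase j).card *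
        ∫⁻ x, ‖blow j Finset.univ w x‖ₑ ∂(Measure.pi fun _ : Fin ℓ => Measure.pi μ) := by
  have key := pow_le_of_step (ℓ := ℓ) (j := j) (M := D ^ (ℓ - 1)) (q := fun S =>
    ∫⁻ x, ‖blow j S (S.piecewise w f) x‖ₑ ∂(Measure.pi fun _ : Fin ℓ => Measure.pi μ))
    (fun S i hj hi => h.lintegral_step hℓ hj hi) (Finset.notMem_erase j Finset.univ)
  rw [Finset.insert_erase (Finset.mem_univ j)] at key
  simpa only [h.singleton_piecewise, Finset.piecewise_univ] using key

/-- The signed step needs integrability at every stage; it comes from running the step with absolute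
values downwards from the full blow-up. -/
lemma integrable_blow (h : WeightedBound μ j f w φ D) (hℓ : 2 ≤ ℓ) (hD : D ≠ ∞)
    (hw : Integrable (blow j Finset.univ w) (Measure.pi fun _ : Fin ℓ => Measure.pi μ))
    {S : Finset ι} (hS : j ∈ S) :
    Integrable (blow j S (S.piecewise w f)) (Measure.pi fun _ : Fin ℓ => Measure.pi μ) := by
  refine ⟨(measurable_blow j S (h.measurable_piecewise S)).aestronglyMeasurable, ?_⟩
  refine lt_top_iff_ne_top.2 (ne_top_of_step (ℓ := ℓ) (by omega) (M := D ^ (ℓ - 1)) (q := fun S =>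
    ∫⁻ x, ‖blow j S (S.piecewise w f) x‖ₑ ∂(Measure.pi fun _ : Fin ℓ => Measure.pi μ))
    (ENNReal.pow_ne_top hD) (fun S i hj hi => h.lintegral_step hℓ hj hi) ?_ hS)
  rw [Finset.piecewise_univ]
  exact hw.2.ne

lemma enorm_integral_le (h : WeightedBound μ j f w φ D) (hℓ : 2 ≤ ℓ) (hev : Even ℓ) (hD : D ≠ ∞)
    (hw : Integrable (blow j Finset.univ w) (Measure.pi fun _ : Fin ℓ => Measure.pi μ)) :
    ‖∫ x, blow j {j} f x ∂(Measure.pi fun _ : Fin ℓ => Measure.pi μ)‖ₑ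
        ^ ℓ ^ (Finset.univ.erase j).card
      ≤ ((D ^ (ℓ - 1)) ^ (Finset.univ.erase j).card) ^ ℓ ^ (Finset.univ.erase j).card *
        ‖∫ x, blow j Finset.univ w x ∂(Measure.pi fun _ : Fin ℓ => Measure.pi μ)‖ₑ := by
  have key := pow_le_of_step (ℓ := ℓ) (j := j) (M := D ^ (ℓ - 1)) (q := fun S =>
    ‖∫ x, blow j S (S.piecewise w f) x ∂(Measure.pi fun _ : Fin ℓ => Measure.pi μ)‖ₑ)
    (fun S i hj hi => ?_) (Finset.notMem_erase j Finset.univ)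
  · rw [Finset.insert_erase (Finset.mem_univ j)] at key
    simpa only [h.singleton_piecewise, Finset.piecewise_univ] using key
  · have hij : i ≠ j := fun e => hi (e ▸ hj)
    have h1 := h.integrable_blow hℓ hD hw hj
    have h2 := h.integrable_blow hℓ hD hw (Finset.mem_insert_of_mem (b := i) hj)
    rw [Finset.piecewise_insert] at h2 ⊢
    exact enorm_integral_blow_pow_le μ hℓ hev hj hi (h.measurable_piecewise S)
      (fun k x u => by simp [hi, h.f_update i hij]) (h.measurable_w i) (h.w_nonneg i hij)
      (h.measurable_φ i) (h.w_update i hij) (fun k x => by simpa [hi] using h.le i hij k x)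
      (h.moment i hij) h1 h2

end WeightedBound

end Weighted

/-! ### The initial stage, where only coordinate `j` has been copied. -/

section Singleton

variable {ι : Type*} [Fintype ι] [DecidableEq ι] {X : ι → Type*} {ℓ : ℕ} [NeZero ℓ]

lemma prod_subbox_singleton {R : Type*} [CommMonoid R] (j : ι) (g : (ι → Fin ℓ) → R) :
    ∏ ω ∈ subbox ℓ {j}, g ω = ∏ k : Fin ℓ, g (Function.update 0 j k) := by
  rw [← insert_empty_eq, prod_subbox_insert (Finset.notMem_empty j)]
  simp [subbox_empty]

lemma blow_singleton {R : Type*} [CommMonoid R] (j : ι) (f : ι → Fin ℓ → (∀ i, X i) → R)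
    (x : Fin ℓ → ∀ i, X i) :
    blow j {j} f x = f j 0 (x 0) * ∏ q ∈ Finset.univ.erase j ×ˢ Finset.univ,
      f q.1 q.2 (mixAll x (Function.update 0 j q.2)) := by
  rw [blow, ← Finset.mul_prod_erase _ _ (Finset.mem_univ j), Finset.prod_product]
  congr 1
  · simp [subbox_empty, mixAll_zero]
  · refine Finset.prod_congr rfl fun i hi => ?_
    rw [Finset.erase_eq_of_notMem (by simpa using Finset.ne_of_mem_erase hi),
      prod_subbox_singleton]
    simp

lemma blow_singleton_substCoord {R : Type*} [CommMonoid R] {j : ι}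
    {f : ι → Fin ℓ → (∀ i, X i) → R}
    (hf : ∀ x u, f j 0 (Function.update x j u) = f j 0 x)
    (x : Fin ℓ → ∀ i, X i) (z : Fin ℓ → X j) :
    blow j {j} f (substCoord j x z) = ∏ k, (if k = 0 then f j 0 (x 0) else 1) *
      ∏ i ∈ Finset.univ.erase j, f i k (Function.update (x 0) j (z k)) := by
  rw [blow_singleton, Finset.prod_product_right, Finset.prod_mul_distrib]
  simp only [mixAll_substCoord_update, mixAll_zero]
  simp [substCoord, hf]

/-- The pieces of `∏ (f + g)` when the products over the coordinates `i ≠ j` are multiplied out. -/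
def splitFamily {R : Type*} (j : ι) (f g : ι → Fin ℓ → (∀ i, X i) → R)
    (t : Finset (ι × Fin ℓ)) : ι → Fin ℓ → (∀ i, X i) → R :=
  fun i k => if i = j ∨ (i, k) ∈ t then f i k else g i k

lemma blow_singleton_add {R : Type*} [CommSemiring R] (j : ι)
    (f g : ι → Fin ℓ → (∀ i, X i) → R) (x : Fin ℓ → ∀ i, X i) :
    blow j {j} (fun i k x => if i = j then f i k x else f i k x + g i k x) x
      = ∑ t ∈ (Finset.univ.erase j ×ˢ Finset.univ).powerset, blow j {j} (splitFamily j f g t) x := by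
  rw [blow_singleton]
  have e : ∏ q ∈ Finset.univ.erase j ×ˢ (Finset.univ : Finset (Fin ℓ)),
      (if q.1 = j then f q.1 q.2 (mixAll x (Function.update 0 j q.2)) else
        f q.1 q.2 (mixAll x (Function.update 0 j q.2))
          + g q.1 q.2 (mixAll x (Function.update 0 j q.2)))
      = ∏ q ∈ Finset.univ.erase j ×ˢ (Finset.univ : Finset (Fin ℓ)),
        (f q.1 q.2 (mixAll x (Function.update 0 j q.2))
          + g q.1 q.2 (mixAll x (Function.update 0 j q.2))) := by
    refine Finset.prod_congr rfl fun q hq => if_neg ?_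
    exact Finset.ne_of_mem_erase (Finset.mem_product.1 hq).1
  rw [e, Finset.prod_add, Finset.mul_sum]
  refine Finset.sum_congr rfl fun t ht => ?_
  rw [Finset.mem_powerset] at ht
  rw [blow_singleton, ← Finset.prod_sdiff ht, mul_comm (∏ i ∈ t, _)]
  have hj : ∀ q ∈ Finset.univ.erase j ×ˢ (Finset.univ : Finset (Fin ℓ)), q.1 ≠ j := fun q hq =>
    Finset.ne_of_mem_erase (Finset.mem_product.1 hq).1
  congr 1
  · simp [splitFamily]
  · congr 1
    · refine Finset.prod_congr rfl fun q hq => ?_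
      rw [Finset.mem_sdiff] at hq
      simp [splitFamily, hj q hq.1, hq.2]
    · refine Finset.prod_congr rfl fun q hq => ?_
      simp [splitFamily, hq]

variable [∀ i, MeasurableSpace (X i)] (μ : ∀ i, Measure (X i)) [∀ i, IsProbabilityMeasure (μ i)]

lemma measurable_prod_update {R : Type*} [CommMonoid R] [MeasurableSpace R] [MeasurableMul₂ R]
    {κ : Type*} (j : ι) {f : ι → κ → (∀ i, X i) → R} (hf : ∀ i k, Measurable (f i k)) (k : κ) :
    Measurable fun q : (∀ i, X i) × X j =>
      ∏ i ∈ Finset.univ.erase j, f i k (Function.update q.1 j q.2) :=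
  Finset.measurable_fun_prod _ fun i _ => (hf i k).comp measurable_update'

/-- Links blow-ups to the conditions: integrating out the `ℓ` copies of coordinate `j` turns the
initial stage into one factor times a product of `ℓ` fibre averages. -/
lemma lintegral_blow_singleton {j : ι} {f : ι → Fin ℓ → (∀ i, X i) → ℝ≥0∞}
    (hm : ∀ i k, Measurable (f i k)) (hf : ∀ x u, f j 0 (Function.update x j u) = f j 0 x) :
    ∫⁻ x, blow j {j} f x ∂(Measure.pi fun _ : Fin ℓ => Measure.pi μ)
      = ∫⁻ y, f j 0 y * ∏ k, ∫⁻ u, ∏ i ∈ Finset.univ.erase j, f i k (Function.update y j u) ∂(μ j)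
        ∂(Measure.pi μ) := by
  have hb := measurable_prod_update j hm
  have hbx : ∀ k (y : ∀ i, X i), Measurable fun u =>
      ∏ i ∈ Finset.univ.erase j, f i k (Function.update y j u) := fun k y =>
    (hb k).comp (measurable_prodMk_left (x := y))
  have hb' : ∀ k, Measurable fun y : ∀ i, X i => ∫⁻ u,
      ∏ i ∈ Finset.univ.erase j, f i k (Function.update y j u) ∂(μ j) := fun k =>
    (hb k).lintegral_prod_right'
  have hmeas : Measurable fun y => f j 0 y *
      ∏ k, ∫⁻ u, ∏ i ∈ Finset.univ.erase j, f i k (Function.update y j u) ∂(μ j) :=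
    (hm j 0).mul (Finset.measurable_fun_prod _ fun k _ => hb' k)
  rw [← (measurePreserving_eval (fun _ : Fin ℓ => Measure.pi μ) 0).lintegral_comp hmeas,
    lintegral_eq_lintegral_prod_lintegral μ (i := j) (measurable_blow j {j} hm)
    (fun k x => (hbx k (x 0)).const_mul _) (blow_singleton_substCoord hf)]
  refine lintegral_congr fun x => ?_
  simp only [lintegral_const_mul _ (hbx _ _), Finset.prod_mul_distrib]
  simp

lemma integral_blow_singleton {j : ι} {f : ι → Fin ℓ → (∀ i, X i) → ℝ}
    (hm : ∀ i k, Measurable (f i k)) (hf : ∀ x u, f j 0 (Function.update x j u) = f j 0 x)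
    (hi : Integrable (blow j {j} f) (Measure.pi fun _ : Fin ℓ => Measure.pi μ)) :
    Integrable (fun y => f j 0 y *
      ∏ k, ∫ u, ∏ i ∈ Finset.univ.erase j, f i k (Function.update y j u) ∂(μ j)) (Measure.pi μ) ∧
    ∫ x, blow j {j} f x ∂(Measure.pi fun _ : Fin ℓ => Measure.pi μ)
      = ∫ y, f j 0 y * ∏ k, ∫ u, ∏ i ∈ Finset.univ.erase j, f i k (Function.update y j u) ∂(μ j)
        ∂(Measure.pi μ) := by
  have hb' : ∀ k, Measurable fun y : ∀ i, X i => ∫ u,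
      ∏ i ∈ Finset.univ.erase j, f i k (Function.update y j u) ∂(μ j) := fun k =>
    ((measurable_prod_update j hm k).stronglyMeasurable.integral_prod_right').measurable
  have hmeas : Measurable fun y => f j 0 y *
      ∏ k, ∫ u, ∏ i ∈ Finset.univ.erase j, f i k (Function.update y j u) ∂(μ j) :=
    (hm j 0).mul (Finset.measurable_fun_prod _ fun k _ => hb' k)
  have hp := measurePreserving_eval (fun _ : Fin ℓ => Measure.pi μ) 0
  obtain ⟨h1, h2⟩ := integral_eq_integral_prod_integral μ (i := j) hi
    (a := fun k x u => (if k = 0 then f j 0 (x 0) else 1) *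
      ∏ i ∈ Finset.univ.erase j, f i k (Function.update (x 0) j u))
    (blow_singleton_substCoord hf)
  have e : ∀ x : Fin ℓ → ∀ i, X i, ∏ k, ∫ u, (if k = 0 then f j 0 (x 0) else 1) *
      ∏ i ∈ Finset.univ.erase j, f i k (Function.update (x 0) j u) ∂(μ j)
      = f j 0 (x 0) * ∏ k, ∫ u,
        ∏ i ∈ Finset.univ.erase j, f i k (Function.update (x 0) j u) ∂(μ j) := by
    intro x
    simp only [integral_const_mul, Finset.prod_mul_distrib]
    simp
  simp only [e] at h1 h2
  refine ⟨(hp.integrable_comp hmeas.aestronglyMeasurable).1 h1, ?_⟩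
  rw [h2]
  exact integral_comp_measurePreserving hp hmeas.aestronglyMeasurable

end Singleton

/-! ### Linear forms, splitting of the functions, and their weights. -/

section Forms

variable {ι : Type*} [Fintype ι] [DecidableEq ι] {X : ι → Type*}

/-- A product of values `L i (x^{(ω)})` over index vectors `ω` of the full blow-up. -/
def formProd {ℓ : ℕ} [NeZero ℓ] (L : ι → (∀ i, X i) → ℝ) (A : ι → Finset (ι → Fin ℓ))
    (x : Fin ℓ → ∀ i, X i) : ℝ :=
  ∏ i, ∏ ω ∈ subbox ℓ (Finset.univ.erase i), if ω ∈ A i then L i (mixAll x ω) else 1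

/-- The weights that remain after all coordinates are blown up. -/
def weightFamily {ℓ : ℕ} (L : ι → (∀ i, X i) → ℝ) (j : ι) (F : (∀ i, X i) → ℝ)
    (t : Finset (ι × Fin ℓ)) : ι → Fin ℓ → (∀ i, X i) → ℝ :=
  fun i k => if i = j then F else if (i, k) ∈ t then L i else 1

open Classical in
/-- The unweighted parts of the majorants of the pieces of the functions `h i k`. -/
def majorantFamily {ℓ : ℕ} (L Φ : ι → (∀ i, X i) → ℝ) (h : ι → Fin ℓ → (∀ i, X i) → ℝ)
    (t : Finset (ι × Fin ℓ)) : ι → Fin ℓ → (∀ i, X i) → ℝ≥0∞ :=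
  fun i k => if (i, k) ∈ t then 1 else
    if ∀ x, h i k x ≤ L i x + Φ i x then fun x => ‖Φ i x‖ₑ else 1

/-- The function `F` for `i = j` and the part `min (h i k) (L i)` of `h i k` for `i ≠ j`. -/
def lowerPart {ℓ : ℕ} (L : ι → (∀ i, X i) → ℝ) (j : ι) (F : (∀ i, X i) → ℝ)
    (h : ι → Fin ℓ → (∀ i, X i) → ℝ) : ι → Fin ℓ → (∀ i, X i) → ℝ :=
  fun i k x => if i = j then F x else min (h i k x) (L i x)

/-- The remaining part of `h i k`. -/
def upperPart {ℓ : ℕ} (L : ι → (∀ i, X i) → ℝ) (h : ι → Fin ℓ → (∀ i, X i) → ℝ) :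
    ι → Fin ℓ → (∀ i, X i) → ℝ :=
  fun i k x => h i k x - min (h i k x) (L i x)

lemma lowerPart_of_ne {ℓ : ℕ} {L : ι → (∀ i, X i) → ℝ} {i j : ι} (hij : i ≠ j)
    (F : (∀ i, X i) → ℝ) (h : ι → Fin ℓ → (∀ i, X i) → ℝ) (k : Fin ℓ) (x : ∀ i, X i) :
    lowerPart L j F h i k x = min (h i k x) (L i x) := if_neg hij

lemma upperPart_apply {ℓ : ℕ} {L : ι → (∀ i, X i) → ℝ} (h : ι → Fin ℓ → (∀ i, X i) → ℝ) (i : ι)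
    (k : Fin ℓ) (x : ∀ i, X i) : upperPart L h i k x = h i k x - min (h i k x) (L i x) := rfl

/-- The family `h` with `h j` replaced by `F`. -/
def fullFamily {ℓ : ℕ} (j : ι) (F : (∀ i, X i) → ℝ) (h : ι → Fin ℓ → (∀ i, X i) → ℝ) :
    ι → Fin ℓ → (∀ i, X i) → ℝ :=
  fun i k x => if i = j then F x else h i k x

lemma blow_fullFamily {ℓ : ℕ} [NeZero ℓ] (L : ι → (∀ i, X i) → ℝ) (j : ι) (F : (∀ i, X i) → ℝ)
    (h : ι → Fin ℓ → (∀ i, X i) → ℝ) (x : Fin ℓ → ∀ i, X i) :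
    blow j {j} (fullFamily j F h) x = ∑ t ∈ (Finset.univ.erase j ×ˢ Finset.univ).powerset,
      blow j {j} (splitFamily j (lowerPart L j F h) (upperPart L h) t) x := by
  rw [← blow_singleton_add]
  congr 1
  ext i k x
  by_cases hi : i = j <;> simp [fullFamily, lowerPart, upperPart, hi]

section Products

variable {ℓ : ℕ} [NeZero ℓ] {L : ι → (∀ i, X i) → ℝ} {j : ι} {t : Finset (ι × Fin ℓ)}

/-- The choice of index vectors given by `T` for `i = j` and by `t` for `i ≠ j`. -/
def formIndex (j : ι) (t : Finset (ι × Fin ℓ)) (T : Finset (ι → Fin ℓ)) :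
    ι → Finset (ι → Fin ℓ) :=
  fun i => if i = j then T else Finset.univ.filter fun ω => (i, ω j) ∈ t

lemma formIndex_self (T : Finset (ι → Fin ℓ)) : formIndex j t T j = T := by simp [formIndex]

lemma mem_formIndex_of_ne {i : ι} (hi : i ≠ j) {T : Finset (ι → Fin ℓ)} {ω : ι → Fin ℓ} :
    ω ∈ formIndex j t T i ↔ (i, ω j) ∈ t := by simp [formIndex, hi]

lemma blow_weightFamily (F : (∀ i, X i) → ℝ) (x : Fin ℓ → ∀ i, X i) :
    blow j Finset.univ (weightFamily L j F t) x
      = (∏ ω ∈ subbox ℓ (Finset.univ.erase j), F (mixAll x ω)) *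
        formProd L (formIndex j t ∅) x := by
  rw [blow, formProd, ← Finset.mul_prod_erase _ _ (Finset.mem_univ j),
    ← Finset.mul_prod_erase (a := j) (f := fun i => ∏ ω ∈ subbox ℓ (Finset.univ.erase i),
      if ω ∈ formIndex j t ∅ i then L i (mixAll x ω) else 1) _ (Finset.mem_univ j)]
  simp only [weightFamily, formIndex_self, if_true, Finset.notMem_empty, if_false,
    Finset.prod_const_one, one_mul]
  congr 1
  refine Finset.prod_congr rfl fun i hi => Finset.prod_congr rfl fun ω _ => ?_
  simp only [mem_formIndex_of_ne (Finset.ne_of_mem_erase hi), Finset.ne_of_mem_erase hi, if_false]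
  by_cases h : (i, ω j) ∈ t <;> simp [h]

lemma formProd_formIndex (T : Finset (ι → Fin ℓ)) (hT : T ⊆ subbox ℓ (Finset.univ.erase j))
    (x : Fin ℓ → ∀ i, X i) :
    formProd L (formIndex j t T) x
      = (∏ ω ∈ T, L j (mixAll x ω)) * formProd L (formIndex j t ∅) x := by
  rw [formProd, formProd, ← Finset.mul_prod_erase _ _ (Finset.mem_univ j),
    ← Finset.mul_prod_erase (a := j) (f := fun i => ∏ ω ∈ subbox ℓ (Finset.univ.erase i),
      if ω ∈ formIndex j t ∅ i then L i (mixAll x ω) else 1) _ (Finset.mem_univ j)]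
  simp only [formIndex_self, Finset.notMem_empty, if_false, Finset.prod_const_one, one_mul]
  congr 1
  · rw [Finset.prod_ite_mem, Finset.inter_eq_right.2 hT]
  · refine Finset.prod_congr rfl fun i hi => Finset.prod_congr rfl fun ω _ => ?_
    simp only [mem_formIndex_of_ne (Finset.ne_of_mem_erase hi)]

/-- Expanding every factor `L j - 1` leaves sub-products of one linear form, each of which falls
under the linear forms condition. -/
lemma blow_weightFamily_sub_one (x : Fin ℓ → ∀ i, X i) :
    blow j Finset.univ (weightFamily L j (fun x => L j x - 1) t) x
      = ∑ T ∈ (subbox ℓ (Finset.univ.erase j)).powerset,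
        (-1) ^ T.card * formProd L (formIndex j t (subbox ℓ (Finset.univ.erase j) \ T)) x := by
  rw [blow_weightFamily, Finset.prod_sub, Finset.sum_mul]
  refine Finset.sum_congr rfl fun T _ => ?_
  rw [formProd_formIndex _ Finset.sdiff_subset]
  simp [mul_assoc]

end Products

variable [∀ i, MeasurableSpace (X i)]

/-- The hypotheses on the functions `L i` and `Φ i`, as functions on the whole product space that
do not depend on the coordinate `i`. -/
structure FormsData (μ : ∀ i, Measure (X i)) (ℓ : ℕ) [NeZero ℓ] (C η : ℝ)
    (L Φ : ι → (∀ i, X i) → ℝ) : Prop where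
  two_le : 2 ≤ ℓ
  even : Even ℓ
  one_le : 1 ≤ C
  eta_pos : 0 < η
  eta_lt_one : η < 1
  measurable_L : ∀ i, Measurable (L i)
  measurable_Φ : ∀ i, Measurable (Φ i)
  L_nonneg : ∀ i x, 0 ≤ L i x
  Φ_nonneg : ∀ i x, 0 ≤ Φ i x
  L_update : ∀ i x u, L i (Function.update x i u) = L i x
  Φ_update : ∀ i x u, Φ i (Function.update x i u) = Φ i x
  forms : ∀ A : ι → Finset (ι → Fin ℓ),
    1 - η ≤ ∫ x, formProd L A x ∂(Measure.pi fun _ : Fin ℓ => Measure.pi μ) ∧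
    ∫ x, formProd L A x ∂(Measure.pi fun _ : Fin ℓ => Measure.pi μ) ≤ 1 + η
  moment : ∀ i, boxMoment μ ℓ (Finset.univ.erase i) (fun x => ‖Φ i x‖ₑ ^ dualExp ℓ)
    ≤ (ENNReal.ofReal C ^ dualExp ℓ) ^ ℓ ^ (Finset.univ.erase i).card

/-- Functions `h i k`, for `i ≠ j`, that do not depend on the coordinate `i` and are at most
`L i + Φ i` or at most `1`. -/
structure Admissible {ℓ : ℕ} (L Φ : ι → (∀ i, X i) → ℝ) (j : ι)
    (h : ι → Fin ℓ → (∀ i, X i) → ℝ) : Prop where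
  measurable : ∀ i k, Measurable (h i k)
  nonneg : ∀ i k x, 0 ≤ h i k x
  update : ∀ i ≠ j, ∀ k x u, h i k (Function.update x i u) = h i k x
  le : ∀ i ≠ j, ∀ k, (∀ x, h i k x ≤ L i x + Φ i x) ∨ ∀ x, h i k x ≤ 1

namespace FormsData

variable {μ : ∀ i, Measure (X i)} {ℓ : ℕ} [NeZero ℓ] {C η : ℝ}
  {L Φ : ι → (∀ i, X i) → ℝ}

lemma formProd_nonneg (D : FormsData μ ℓ C η L Φ) (A : ι → Finset (ι → Fin ℓ))
    (x : Fin ℓ → ∀ i, X i) : 0 ≤ formProd L A x := by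
  refine Finset.prod_nonneg fun i _ => Finset.prod_nonneg fun ω _ => ?_
  split_ifs
  · exact D.L_nonneg _ _
  · exact zero_le_one

/-- The Bochner integral of a non-integrable function is `0`, which would contradict the lower bound
`1 - η > 0`. -/
lemma integrable_formProd (D : FormsData μ ℓ C η L Φ) (A : ι → Finset (ι → Fin ℓ)) :
    Integrable (formProd L A) (Measure.pi fun _ : Fin ℓ => Measure.pi μ) := by
  by_contra h
  have h1 := (D.forms A).1
  rw [integral_undef h] at h1
  linarith [D.eta_lt_one]

lemma lintegral_formProd_le (D : FormsData μ ℓ C η L Φ) (A : ι → Finset (ι → Fin ℓ)) :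
    ∫⁻ x, ‖formProd L A x‖ₑ ∂(Measure.pi fun _ : Fin ℓ => Measure.pi μ) ≤ 2 := by
  rw [lintegral_congr fun x => Real.enorm_eq_ofReal (D.formProd_nonneg A x),
    ← ofReal_integral_eq_lintegral_ofReal (D.integrable_formProd A)
      (.of_forall (D.formProd_nonneg A)), ENNReal.ofReal_le_iff_le_toReal (by simp)]
  have := (D.forms A).2
  simp only [ENNReal.toReal_ofNat]
  linarith [D.eta_lt_one]

lemma integral_blow_weightFamily_sub_one (D : FormsData μ ℓ C η L Φ) (j : ι)
    (t : Finset (ι × Fin ℓ)) :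
    Integrable (blow j Finset.univ (weightFamily L j (fun x => L j x - 1) t))
      (Measure.pi fun _ : Fin ℓ => Measure.pi μ) ∧
    ‖∫ x, blow j Finset.univ (weightFamily L j (fun x => L j x - 1) t) x
      ∂(Measure.pi fun _ : Fin ℓ => Measure.pi μ)‖ₑ
      ≤ 2 ^ ℓ ^ (Finset.univ.erase j).card * ENNReal.ofReal η := by
  set U := subbox ℓ (Finset.univ.erase j) with hU
  have hne : U.Nonempty := ⟨0, mem_subbox.2 fun _ _ => rfl⟩
  have e : blow j Finset.univ (weightFamily L j (fun x => L j x - 1) t)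
      = fun x => ∑ T ∈ U.powerset, (-1) ^ T.card * formProd L (formIndex j t (U \ T)) x :=
    funext fun x => blow_weightFamily_sub_one x
  have hi : ∀ T ∈ U.powerset, Integrable
      (fun x => (-1) ^ T.card * formProd L (formIndex j t (U \ T)) x)
      (Measure.pi fun _ : Fin ℓ => Measure.pi μ) := fun T _ =>
    (D.integrable_formProd _).const_mul _
  rw [e]
  refine ⟨integrable_finsetSum _ hi, ?_⟩
  rw [integral_finsetSum _ hi]
  simp only [integral_const_mul]
  -- The alternating signs sum to zero, so `1` may be subtracted from every linear form, leaving
  -- `2^|U|` errors of size at most `η`.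
  have h0 : (∑ T ∈ U.powerset, (-1 : ℝ) ^ T.card) = 0 := by
    have := Finset.sum_powerset_neg_one_pow_card_of_nonempty hne
    exact_mod_cast this
  have e2 : ∑ T ∈ U.powerset, (-1 : ℝ) ^ T.card *
        ∫ x, formProd L (formIndex j t (U \ T)) x ∂(Measure.pi fun _ : Fin ℓ => Measure.pi μ)
      = ∑ T ∈ U.powerset, (-1 : ℝ) ^ T.card *
        (∫ x, formProd L (formIndex j t (U \ T)) x ∂(Measure.pi fun _ : Fin ℓ => Measure.pi μ)
          - 1) := by
    simp only [mul_sub, Finset.sum_sub_distrib, mul_one, h0, sub_zero]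
  rw [e2, ← ofReal_norm, show (2 : ℝ≥0∞) = ENNReal.ofReal 2 by simp,
    ← ENNReal.ofReal_pow (by norm_num), ← ENNReal.ofReal_mul (by positivity)]
  refine ENNReal.ofReal_le_ofReal ((norm_sum_le _ _).trans ?_)
  calc _ ≤ ∑ T ∈ U.powerset, η := by
        refine Finset.sum_le_sum fun T _ => ?_
        rw [norm_mul, norm_pow, norm_neg, norm_one, one_pow, one_mul, Real.norm_eq_abs, abs_le]
        have := D.forms (formIndex j t (U \ T))
        constructor <;> linarith
    _ = _ := by
        rw [Finset.sum_const, Finset.card_powerset, hU, card_subbox]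
        simp

lemma two_le_base (D : FormsData μ ℓ C η L Φ) :
    2 ≤ ENNReal.ofReal (2 * C) ^ dualExp ℓ := by
  have h2 : (2 : ℝ≥0∞) ≤ ENNReal.ofReal (2 * C) := by
    rw [show (2 : ℝ≥0∞) = ENNReal.ofReal 2 by simp]
    exact ENNReal.ofReal_le_ofReal (by linarith [D.one_le])
  calc (2 : ℝ≥0∞) ≤ ENNReal.ofReal (2 * C) ^ (1 : ℝ) := by simpa using h2
    _ ≤ _ := ENNReal.rpow_le_rpow_of_exponent_le ((by norm_num : (1 : ℝ≥0∞) ≤ 2).trans h2)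
        (one_le_dualExp D.two_le)

/-- The price of one Hölder step after the root, using `ℓ' (ℓ - 1) = ℓ`. -/
lemma base_pow (D : FormsData μ ℓ C η L Φ) :
    (ENNReal.ofReal (2 * C) ^ dualExp ℓ) ^ (ℓ - 1) = ENNReal.ofReal ((2 * C) ^ ℓ) := by
  have hC := D.one_le
  rw [← ENNReal.rpow_natCast, ← ENNReal.rpow_mul, dualExp_mul_pred D.two_le,
    ENNReal.rpow_natCast, ENNReal.ofReal_pow (by linarith)]

lemma boxMoment_Φ_le (D : FormsData μ ℓ C η L Φ) (i : ι) :
    boxMoment μ ℓ (Finset.univ.erase i) (fun x => ‖Φ i x‖ₑ ^ dualExp ℓ)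
      ≤ (ENNReal.ofReal (2 * C) ^ dualExp ℓ) ^ ℓ ^ (Finset.univ.erase i).card := by
  refine (D.moment i).trans (pow_le_pow_left₀ zero_le (ENNReal.rpow_le_rpow ?_ ?_) _)
  · exact ENNReal.ofReal_le_ofReal (by linarith [D.one_le])
  · exact zero_le_one.trans (one_le_dualExp D.two_le)

variable [∀ i, IsProbabilityMeasure (μ i)]

/-- The box moment of `L i` is itself a linear form, hence at most `2`. Using `2 * C` instead of `C`
in the base covers this case together with that of `Φ i`. -/
lemma boxMoment_L_le (D : FormsData μ ℓ C η L Φ) (i : ι) :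
    boxMoment μ ℓ (Finset.univ.erase i) (fun x => ‖L i x‖ₑ)
      ≤ (ENNReal.ofReal (2 * C) ^ dualExp ℓ) ^ ℓ ^ (Finset.univ.erase i).card := by
  have h := D.lintegral_formProd_le
    (formIndex i ∅ (subbox ℓ (Finset.univ.erase i)))
  have e : boxMoment μ ℓ (Finset.univ.erase i) (fun x => ‖L i x‖ₑ)
      = ∫⁻ x, ‖formProd L (formIndex i ∅ (subbox ℓ (Finset.univ.erase i))) x‖ₑ
        ∂(Measure.pi fun _ : Fin ℓ => Measure.pi μ) := by
    refine lintegral_congr fun x => ?_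
    rw [formProd_formIndex _ (Finset.Subset.refl _), enorm_mul, enorm_finset_prod]
    have : formProd L (formIndex i (∅ : Finset (ι × Fin ℓ)) ∅) x = 1 := by
      refine Finset.prod_eq_one fun m _ => Finset.prod_eq_one fun ω _ => ?_
      by_cases hm : m = i <;> simp [formIndex, hm]
    simp [this]
  rw [e]
  refine h.trans (D.two_le_base.trans (le_self_pow₀ ?_ (pow_ne_zero _ (NeZero.ne ℓ))))
  exact (by norm_num : (1 : ℝ≥0∞) ≤ 2).trans D.two_le_base

lemma boxMoment_one_le (D : FormsData μ ℓ C η L Φ) (i : ι) :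
    boxMoment μ ℓ (Finset.univ.erase i) (fun _ => 1)
      ≤ (ENNReal.ofReal (2 * C) ^ dualExp ℓ) ^ ℓ ^ (Finset.univ.erase i).card := by
  simp only [boxMoment, Finset.prod_const_one, lintegral_one, measure_univ]
  exact one_le_pow₀ ((by norm_num : (1 : ℝ≥0∞) ≤ 2).trans D.two_le_base)

/-- The lower part has weight `L` and majorant `1`; the upper part has weight `1` and majorant `Φ`
or `1`. So each moment to be bounded involves `L` alone, `Φ` alone or neither, never a product of
the two. -/
lemma weightedBound (D : FormsData μ ℓ C η L Φ) {j : ι} {F : (∀ i, X i) → ℝ} (hF : Measurable F)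
    {h : ι → Fin ℓ → (∀ i, X i) → ℝ} (hh : Admissible L Φ j h) (t : Finset (ι × Fin ℓ)) :
    WeightedBound μ j (splitFamily j (lowerPart L j F h) (upperPart L h) t)
      (weightFamily L j F t) (majorantFamily L Φ h t) (ENNReal.ofReal (2 * C) ^ dualExp ℓ) where
  measurable_f i k := by
    have h1 := hh.measurable i k
    have h2 := D.measurable_L i
    unfold splitFamily lowerPart upperPart
    split_ifs <;> fun_prop
  measurable_w i k := by
    have h2 := D.measurable_L i
    unfold weightFamily
    split_ifs
    · exact hF
    · exact h2
    · exact measurable_one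
  measurable_φ i k := by
    have h2 := D.measurable_Φ i
    unfold majorantFamily
    split_ifs
    · exact measurable_one
    · exact h2.enorm
    · exact measurable_one
  f_update i hij k x u := by
    simp only [splitFamily, hij, false_or]
    split_ifs <;> simp [lowerPart_of_ne hij, upperPart_apply, hh.update i hij, D.L_update]
  w_update i hij k x u := by
    simp only [weightFamily, hij, if_false]
    split_ifs <;> simp [D.L_update]
  w_nonneg i hij k x := by
    simp only [weightFamily, hij, if_false]
    split_ifs
    · exact D.L_nonneg i x
    · exact zero_le_one
  le i hij k x := by
    have h0 := hh.nonneg i k x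
    have hL := D.L_nonneg i x
    have hΦ := D.Φ_nonneg i x
    simp only [splitFamily, weightFamily, majorantFamily, hij, false_or, if_false]
    split_ifs with h1 h2
    · rw [lowerPart_of_ne hij, Pi.one_apply, mul_one, enorm_le_iff_norm_le, Real.norm_of_nonneg (le_min h0 hL),
        Real.norm_of_nonneg hL]
      exact min_le_right _ _
    · rw [upperPart_apply, Pi.one_apply, enorm_one, one_mul, enorm_le_iff_norm_le, Real.norm_of_nonneg hΦ,
        Real.norm_of_nonneg (sub_nonneg.2 (min_le_left _ _))]
      -- The upper part is the positive part of `h - L`, hence at most `Φ`.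
      have := h2 x
      rcases min_cases (h i k x) (L i x) with ⟨e, _⟩ | ⟨e, _⟩ <;> rw [e] <;> linarith
    · have h3 := ((hh.le i hij k).resolve_left h2) x
      rw [upperPart_apply, Pi.one_apply, enorm_one, one_mul, Pi.one_apply, ← enorm_one (G := ℝ),
        enorm_le_iff_norm_le, Real.norm_of_nonneg (sub_nonneg.2 (min_le_left _ _)), norm_one]
      have := le_min h0 hL
      linarith
  moment i hij k := by
    simp only [weightFamily, majorantFamily, hij, if_false]
    split_ifs
    · simpa using D.boxMoment_L_le i
    · simpa using D.boxMoment_Φ_le i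
    · simpa using D.boxMoment_one_le i
  eq := by
    ext k x
    simp [splitFamily, lowerPart, weightFamily]

end FormsData

end Forms

/-! ### Summing over the pieces: bounds for products of fibre averages. -/

section Counting

variable {ι : Type*} [Fintype ι] [DecidableEq ι] {X : ι → Type*} [∀ i, MeasurableSpace (X i)]

lemma measurable_fullFamily {ℓ : ℕ} {j : ι} {F : (∀ i, X i) → ℝ}
    {h : ι → Fin ℓ → (∀ i, X i) → ℝ} (hF : Measurable F) (hh : ∀ i k, Measurable (h i k)) (i : ι)
    (k : Fin ℓ) : Measurable (fullFamily j F h i k) := by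
  unfold fullFamily
  split_ifs
  · exact hF
  · exact hh i k

namespace FormsData

variable {μ : ∀ i, Measure (X i)} [∀ i, IsProbabilityMeasure (μ i)] {ℓ : ℕ} [NeZero ℓ] {C η : ℝ}
  {L Φ : ι → (∀ i, X i) → ℝ}

/-- There are `2^((n-1)ℓ)` pieces, each costing `(2C)^(ℓ(n-1))` times `2 r`, where `n` is the number
of coordinates. Together this is `(4C)^((n-1)ℓ) * 2 * r`, and the last `2` is absorbed by `(4C)^ℓ`.
-/
lemma total_le (D : FormsData μ ℓ C η L Φ) (j : ι) {r : ℝ} (hr : 0 ≤ r) {Y : ℝ≥0∞}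
    (hY : Y ≤ ∑ _t ∈ (Finset.univ.erase j ×ˢ (Finset.univ : Finset (Fin ℓ))).powerset,
      (((ENNReal.ofReal (2 * C) ^ dualExp ℓ) ^ (ℓ - 1)) ^ (Finset.univ.erase j).card
        * (2 * ENNReal.ofReal r))) :
    Y ≤ ENNReal.ofReal ((4 * C) ^ (Fintype.card ι * ℓ) * r) := by
  have hC := D.one_le
  refine hY.trans ?_
  rw [Finset.sum_const, Finset.card_powerset, Finset.card_product, Finset.card_univ,
    Fintype.card_fin, D.base_pow, nsmul_eq_mul, ← ENNReal.ofReal_pow (by positivity),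
    show ((2 ^ ((Finset.univ.erase j).card * ℓ) : ℕ) : ℝ≥0∞)
      = ENNReal.ofReal (2 ^ ((Finset.univ.erase j).card * ℓ)) by
        rw [ENNReal.ofReal_pow (by norm_num)]; simp,
    show (2 : ℝ≥0∞) = ENNReal.ofReal 2 by simp, ← ENNReal.ofReal_mul (by norm_num),
    ← ENNReal.ofReal_mul (by positivity), ← ENNReal.ofReal_mul (by positivity)]
  refine ENNReal.ofReal_le_ofReal ?_
  have hcard : Fintype.card ι * ℓ = (Finset.univ.erase j).card * ℓ + ℓ := by
    rw [← Nat.succ_mul, Finset.card_erase_of_mem (Finset.mem_univ j), Finset.card_univ,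
      Nat.succ_eq_add_one, Nat.sub_add_cancel (Fintype.card_pos_iff.2 ⟨j⟩)]
  rw [hcard, pow_add]
  have h4 : 2 ≤ (4 * C) ^ ℓ := by
    calc (2 : ℝ) ≤ 4 * C := by linarith
      _ ≤ _ := le_self_pow₀ (by linarith) (NeZero.ne ℓ)
  have e : (2 : ℝ) ^ ((Finset.univ.erase j).card * ℓ) *
      (((2 * C) ^ ℓ) ^ (Finset.univ.erase j).card * (2 * r))
      = (4 * C) ^ ((Finset.univ.erase j).card * ℓ) * 2 * r := by
    rw [← pow_mul, mul_comm ℓ, show 4 * C = 2 * (2 * C) by ring, mul_pow 2 (2 * C)]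
    ring
  rw [e]
  gcongr

lemma lintegral_blow_fullFamily_le (D : FormsData μ ℓ C η L Φ) {j : ι} {F : (∀ i, X i) → ℝ}
    (hF : Measurable F) {h : ι → Fin ℓ → (∀ i, X i) → ℝ} (hh : Admissible L Φ j h)
    (hF2 : ∀ t, ∫⁻ x, ‖blow j Finset.univ (weightFamily L j F t) x‖ₑ
      ∂(Measure.pi fun _ : Fin ℓ => Measure.pi μ) ≤ 2) :
    ∫⁻ x, ‖blow j {j} (fullFamily j F h) x‖ₑ ∂(Measure.pi fun _ : Fin ℓ => Measure.pi μ)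
      ≤ ENNReal.ofReal ((4 * C) ^ (Fintype.card ι * ℓ)) := by
  have key := D.total_le j zero_le_one (Y := ∫⁻ x, ‖blow j {j} (fullFamily j F h) x‖ₑ
    ∂(Measure.pi fun _ : Fin ℓ => Measure.pi μ)) ?_
  · simpa using key
  simp only [blow_fullFamily L]
  refine (lintegral_mono fun x => enorm_sum_le _ _).trans ?_
  rw [lintegral_finsetSum _ fun t _ => (measurable_blow j {j}
    (D.weightedBound hF hh t).measurable_f).enorm]
  refine Finset.sum_le_sum fun t _ => ?_
  have hN : ℓ ^ (Finset.univ.erase j).card ≠ 0 := pow_ne_zero _ (NeZero.ne ℓ)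
  refine (ENNReal.pow_le_pow_left_iff hN).1 (((D.weightedBound hF hh t).lintegral_le D.two_le).trans
    ?_)
  rw [mul_pow _ (2 * ENNReal.ofReal 1)]
  refine mul_le_mul_right ((hF2 t).trans ?_) _
  -- The bound `2` is weakened to `2^N`, so that the `N`-th root leaves the same factor `2` as in
  -- the signed case.
  simpa using le_self_pow₀ (by norm_num : (1 : ℝ≥0∞) ≤ 2) hN

lemma integrable_blow_fullFamily_sub_one (D : FormsData μ ℓ C η L Φ) {j : ι}
    {h : ι → Fin ℓ → (∀ i, X i) → ℝ} (hh : Admissible L Φ j h) :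
    Integrable (blow j {j} (fullFamily j (fun x => L j x - 1) h))
      (Measure.pi fun _ : Fin ℓ => Measure.pi μ) ∧
    ‖∫ x, blow j {j} (fullFamily j (fun x => L j x - 1) h) x
      ∂(Measure.pi fun _ : Fin ℓ => Measure.pi μ)‖ₑ
      ≤ ENNReal.ofReal ((4 * C) ^ (Fintype.card ι * ℓ) *
        η ^ (1 / (ℓ : ℝ) ^ (Finset.univ.erase j).card)) := by
  have hF : Measurable fun x => L j x - 1 := (D.measurable_L j).sub_const 1
  have hη := D.eta_pos
  have hD : ENNReal.ofReal (2 * C) ^ dualExp ℓ ≠ ∞ :=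
    ENNReal.rpow_ne_top_of_nonneg (zero_le_one.trans (one_le_dualExp D.two_le))
      ENNReal.ofReal_ne_top
  have hi : ∀ t ∈ (Finset.univ.erase j ×ˢ (Finset.univ : Finset (Fin ℓ))).powerset,
      Integrable (blow j {j} (splitFamily j (lowerPart L j (fun x => L j x - 1) h)
        (upperPart L h) t)) (Measure.pi fun _ : Fin ℓ => Measure.pi μ) := fun t _ => by
    have hb := D.weightedBound hF hh t
    have := hb.integrable_blow D.two_le hD (D.integral_blow_weightFamily_sub_one j t).1
      (Finset.mem_singleton_self j)
    rwa [hb.singleton_piecewise] at this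
  have e : blow j {j} (fullFamily j (fun x => L j x - 1) h)
      = fun x => ∑ t ∈ (Finset.univ.erase j ×ˢ (Finset.univ : Finset (Fin ℓ))).powerset,
        blow j {j} (splitFamily j (lowerPart L j (fun x => L j x - 1) h) (upperPart L h) t) x :=
    funext fun x => blow_fullFamily L j _ h x
  rw [e]
  refine ⟨integrable_finsetSum _ hi, D.total_le j (by positivity) ?_⟩
  rw [integral_finsetSum _ hi]
  refine (enorm_sum_le _ _).trans (Finset.sum_le_sum fun t _ => ?_)
  have hN : ℓ ^ (Finset.univ.erase j).card ≠ 0 := pow_ne_zero _ (NeZero.ne ℓ)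
  have hw := D.integral_blow_weightFamily_sub_one j t
  refine (ENNReal.pow_le_pow_left_iff hN).1
    (((D.weightedBound hF hh t).enorm_integral_le D.two_le D.even hD hw.1).trans ?_)
  -- With `N = ℓ^(n-1)`, where `n` is the number of coordinates, the bound `2^N η` equals `(2
  -- η^(1/N))^N`.
  rw [mul_pow _ (2 * ENNReal.ofReal _), mul_pow 2, ← ENNReal.ofReal_pow (by positivity),
    ← Real.rpow_natCast, ← Real.rpow_mul hη.le]
  refine mul_le_mul_right (hw.2.trans (le_of_eq ?_)) _
  congr 2
  rw [Nat.cast_pow, one_div_mul_cancel (by exact_mod_cast hN), Real.rpow_one]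

/-- The case `F = 1` yields the moments in (C3), the case `F = L j` the integrability in (C1). For
both, the weights remaining at the end form a single linear form. -/
lemma lintegral_fibre_le (D : FormsData μ ℓ C η L Φ) {j : ι} {F : (∀ i, X i) → ℝ}
    (hF : F = 1 ∨ F = L j) {h : ι → Fin ℓ → (∀ i, X i) → ℝ} (hh : Admissible L Φ j h) :
    ∫⁻ y, ‖F y‖ₑ * ∏ k, ∫⁻ u, ∏ i ∈ Finset.univ.erase j, ‖h i k (Function.update y j u)‖ₑ ∂(μ j)
      ∂(Measure.pi μ) ≤ ENNReal.ofReal ((4 * C) ^ (Fintype.card ι * ℓ)) := by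
  have hFm : Measurable F := by
    rcases hF with rfl | rfl
    · exact measurable_one
    · exact D.measurable_L j
  have hFj : ∀ x u, F (Function.update x j u) = F x := by
    rcases hF with rfl | rfl
    · simp
    · exact D.L_update j
  have key := D.lintegral_blow_fullFamily_le hFm hh fun t => by
    rcases hF with rfl | rfl
    · simpa [blow_weightFamily] using D.lintegral_formProd_le (formIndex j t ∅)
    · simpa only [blow_weightFamily, ← formProd_formIndex _ (Finset.Subset.refl _)] using
        D.lintegral_formProd_le (formIndex j t (subbox ℓ (Finset.univ.erase j)))
  simp only [enorm_blow] at key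
  rw [lintegral_blow_singleton μ (fun i k => (measurable_fullFamily hFm hh.measurable i k).enorm)
    (by simp [fullFamily, hFj])] at key
  refine le_trans (le_of_eq ?_) key
  refine lintegral_congr fun y => ?_
  simp only [fullFamily, if_true]
  congr 1
  refine Finset.prod_congr rfl fun k _ => lintegral_congr fun u => ?_
  refine Finset.prod_congr rfl fun i hi => ?_
  rw [if_neg (Finset.ne_of_mem_erase hi)]

/-- The common source of both halves of (C2), through different choices of the `ℓ` families. -/
lemma integral_fibre_sub_one (D : FormsData μ ℓ C η L Φ) {j : ι}
    {h : ι → Fin ℓ → (∀ i, X i) → ℝ} (hh : Admissible L Φ j h) :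
    Integrable (fun y => (L j y - 1) *
      ∏ k, ∫ u, ∏ i ∈ Finset.univ.erase j, h i k (Function.update y j u) ∂(μ j)) (Measure.pi μ) ∧
    |∫ y, (L j y - 1) *
      ∏ k, ∫ u, ∏ i ∈ Finset.univ.erase j, h i k (Function.update y j u) ∂(μ j) ∂(Measure.pi μ)|
      ≤ (4 * C) ^ (Fintype.card ι * ℓ) * η ^ (1 / (ℓ : ℝ) ^ (Finset.univ.erase j).card) := by
  have hC := D.one_le
  have hη := D.eta_pos
  obtain ⟨h1, h2⟩ := D.integrable_blow_fullFamily_sub_one hh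
  have h3 := integral_blow_singleton μ
    (measurable_fullFamily ((D.measurable_L j).sub_const 1) hh.measurable)
    (by simp [fullFamily, D.L_update]) h1
  rw [h3.2] at h2
  have e : (fun y => fullFamily j (fun x => L j x - 1) h j 0 y * ∏ k, ∫ u,
      ∏ i ∈ Finset.univ.erase j, fullFamily j (fun x => L j x - 1) h i k (Function.update y j u)
        ∂(μ j)) = fun y => (L j y - 1) *
      ∏ k, ∫ u, ∏ i ∈ Finset.univ.erase j, h i k (Function.update y j u) ∂(μ j) := by
    funext y
    simp only [fullFamily, if_true]
    congr 1
    refine Finset.prod_congr rfl fun k _ => integral_congr_ae (.of_forall fun u => ?_)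
    refine Finset.prod_congr rfl fun i hi => ?_
    rw [if_neg (Finset.ne_of_mem_erase hi)]
  rw [e] at h3 h2
  refine ⟨h3.1, ?_⟩
  rw [← ofReal_norm, ENNReal.ofReal_le_ofReal_iff (by positivity), Real.norm_eq_abs] at h2
  exact h2

end FormsData

end Counting

/-! ### The integrals behind (C1), the cut norm and (C3). -/

section Consequences

variable {ι : Type*} [Fintype ι] [DecidableEq ι] {X : ι → Type*} [∀ i, MeasurableSpace (X i)]

namespace FormsData

variable {μ : ∀ i, Measure (X i)} [∀ i, IsProbabilityMeasure (μ i)] {ℓ : ℕ} [NeZero ℓ] {C η : ℝ}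
  {L Φ : ι → (∀ i, X i) → ℝ}

/-- The factors `L i + Φ i` for `i ∈ J`, used for the copies `k ∈ K` only. -/
def sumFamily (L Φ : ι → (∀ i, X i) → ℝ) (J : Finset ι) (K : Finset (Fin ℓ)) :
    ι → Fin ℓ → (∀ i, X i) → ℝ :=
  fun i k x => if i ∈ J ∧ k ∈ K then L i x + Φ i x else 1

lemma admissible_sumFamily (D : FormsData μ ℓ C η L Φ) (j : ι) (J : Finset ι)
    (K : Finset (Fin ℓ)) : Admissible L Φ j (sumFamily L Φ J K) where
  measurable i k := by
    have h1 := D.measurable_L i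
    have h2 := D.measurable_Φ i
    unfold sumFamily
    split_ifs <;> fun_prop
  nonneg i k x := by
    have h1 := D.L_nonneg i x
    have h2 := D.Φ_nonneg i x
    unfold sumFamily
    split_ifs <;> positivity
  update i _ k x u := by simp [sumFamily, D.L_update, D.Φ_update]
  le i _ k := by
    by_cases h : i ∈ J ∧ k ∈ K
    · left; intro x; simp [sumFamily, h]
    · right; intro x; simp only [sumFamily, h, if_false, le_refl]

/-- The fibre average of `∏_{i ∈ J} (L i + Φ i)` over the coordinate `j`. -/
def fibreSum (μ : ∀ i, Measure (X i)) (L Φ : ι → (∀ i, X i) → ℝ) (J : Finset ι) (j : ι)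
    (y : ∀ i, X i) : ℝ≥0∞ :=
  ∫⁻ u, ∏ i ∈ J, ‖L i (Function.update y j u) + Φ i (Function.update y j u)‖ₑ ∂(μ j)

lemma measurable_fibreSum (D : FormsData μ ℓ C η L Φ) (J : Finset ι) (j : ι) :
    Measurable (fibreSum μ L Φ J j) := by
  have : Measurable fun q : (∀ i, X i) × X j =>
      ∏ i ∈ J, ‖L i (Function.update q.1 j q.2) + Φ i (Function.update q.1 j q.2)‖ₑ :=
    Finset.measurable_fun_prod _ fun i _ =>
      (((D.measurable_L i).add (D.measurable_Φ i)).comp measurable_update').enorm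
  exact this.lintegral_prod_right'

lemma lintegral_prod_sumFamily {J : Finset ι} {j : ι} (hj : j ∉ J) {K : Finset (Fin ℓ)}
    (k : Fin ℓ) (y : ∀ i, X i) :
    ∫⁻ u, ∏ i ∈ Finset.univ.erase j, ‖sumFamily L Φ J K i k (Function.update y j u)‖ₑ ∂(μ j)
      = if k ∈ K then fibreSum μ L Φ J j y else 1 := by
  split_ifs with hk
  · refine lintegral_congr fun u => ?_
    have hJ : J ⊆ Finset.univ.erase j := fun i hi =>
      Finset.mem_erase.2 ⟨fun h => hj (by rwa [← h]), Finset.mem_univ i⟩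
    rw [← Finset.prod_subset hJ fun i _ hi => by simp [sumFamily, hi]]
    exact Finset.prod_congr rfl fun i hi => by simp [sumFamily, hi, hk]
  · simp [sumFamily, hk]

lemma lintegral_fibreSum_pow_le (D : FormsData μ ℓ C η L Φ) {J : Finset ι} {j : ι} (hj : j ∉ J) :
    ∫⁻ y, fibreSum μ L Φ J j y ^ ℓ ∂(Measure.pi μ)
      ≤ ENNReal.ofReal ((4 * C) ^ (Fintype.card ι * ℓ)) := by
  have key := D.lintegral_fibre_le (F := 1) (Or.inl rfl)
    (D.admissible_sumFamily j J (Finset.univ : Finset (Fin ℓ)))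
  simp only [lintegral_prod_sumFamily hj] at key
  simpa using key

/-- The part with `L j` is a fibre bound using a single copy. For `Φ j`, Hölder pairs its finite
moment of order `ℓ'` with the moment of order `ℓ` of the fibre average. -/
lemma lintegral_mul_fibreSum_ne_top (D : FormsData μ ℓ C η L Φ) {J : Finset ι} {j : ι}
    (hj : j ∉ J) :
    ∫⁻ y, ‖L j y + Φ j y‖ₑ * fibreSum μ L Φ J j y ∂(Measure.pi μ) ≠ ∞ := by
  have hℓ := D.two_le
  have hA := D.measurable_fibreSum J j
  have hΦ := (D.measurable_Φ j).enorm
  have h1 : ∫⁻ y, ‖L j y‖ₑ * fibreSum μ L Φ J j y ∂(Measure.pi μ) < ∞ := by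
    have key := D.lintegral_fibre_le (F := L j) (Or.inr rfl)
      (D.admissible_sumFamily j J ({0} : Finset (Fin ℓ)))
    simp only [lintegral_prod_sumFamily hj, Finset.mem_singleton] at key
    simp only [Finset.prod_ite_eq', Finset.mem_univ, if_true] at key
    exact key.trans_lt ENNReal.ofReal_lt_top
  have h2 : ∫⁻ y, ‖Φ j y‖ₑ * fibreSum μ L Φ J j y ∂(Measure.pi μ) < ∞ := by
    have key := lintegral_weighted_holder (Measure.pi μ) hℓ measurable_one hΦ hA
    simp only [Pi.one_apply, one_mul] at key
    have h3 : ∫⁻ y, ‖Φ j y‖ₑ ^ dualExp ℓ ∂(Measure.pi μ) < ∞ := by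
      have h4 := boxMoment_le_of_subset μ hℓ (Finset.empty_subset _) (hΦ.pow_const (dualExp ℓ))
        (D.moment j)
      simp only [boxMoment, subbox_empty, Finset.prod_singleton, mixAll_zero] at h4
      rw [(measurePreserving_eval (fun _ : Fin ℓ => Measure.pi μ) 0).lintegral_comp
        (hΦ.pow_const (dualExp ℓ))] at h4
      refine h4.trans_lt (ENNReal.pow_lt_top (lt_top_iff_ne_top.2 ?_))
      exact ENNReal.rpow_ne_top_of_nonneg (zero_le_one.trans (one_le_dualExp hℓ))
        ENNReal.ofReal_ne_top
    have h5 := key.trans_lt (ENNReal.mul_lt_top (ENNReal.pow_lt_top h3)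
      ((D.lintegral_fibreSum_pow_le hj).trans_lt ENNReal.ofReal_lt_top))
    rw [lt_top_iff_ne_top] at h5 ⊢
    exact fun h0 => h5 (by rw [h0, ENNReal.top_pow (NeZero.ne ℓ)])
  refine ne_of_lt ((lintegral_mono fun y => (mul_le_mul_left (enorm_add_le _ _) _).trans_eq
    (add_mul _ _ _)).trans_lt ?_)
  rw [lintegral_add_left (by have := (D.measurable_L j).enorm; fun_prop)]
  exact ENNReal.add_lt_top.2 ⟨h1, h2⟩

lemma integrable_prod_sum (D : FormsData μ ℓ C η L Φ) (J : Finset ι) :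
    Integrable (fun x => ∏ i ∈ J, (L i x + Φ i x)) (Measure.pi μ) := by
  have hm : Measurable fun x => ∏ i ∈ J, (L i x + Φ i x) :=
    Finset.measurable_fun_prod _ fun i _ => (D.measurable_L i).add (D.measurable_Φ i)
  refine ⟨hm.aestronglyMeasurable, ?_⟩
  rcases J.eq_empty_or_nonempty with rfl | ⟨j, hj⟩
  · simp [HasFiniteIntegral]
  have hp := measurePreserving_update μ j
  rw [HasFiniteIntegral, ← hp.lintegral_comp hm.enorm,
    lintegral_prod _ (by exact (hm.enorm.comp hp.measurable).aemeasurable)]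
  have key := D.lintegral_mul_fibreSum_ne_top (Finset.notMem_erase j J)
  refine lt_top_iff_ne_top.2 (ne_of_eq_of_ne (lintegral_congr fun y => ?_) key)
  rw [fibreSum, ← lintegral_const_mul]
  -- Neither `L j` nor `Φ j` depends on coordinate `j`, so this factor leaves the fibre integral.
  · refine lintegral_congr fun u => ?_
    simp only [enorm_finset_prod]
    rw [← Finset.mul_prod_erase _ _ hj, D.L_update, D.Φ_update]
  · exact Finset.measurable_fun_prod _ fun i _ =>
      (((D.measurable_L i).add (D.measurable_Φ i)).comp
        (measurable_update y)).enorm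

lemma one_sub_le_integral_prod_sum (D : FormsData μ ℓ C η L Φ) (J : Finset ι) :
    1 - η ≤ ∫ x, ∏ i ∈ J, (L i x + Φ i x) ∂(Measure.pi μ) := by
  have hm : Measurable fun x => ∏ i ∈ J, L i x :=
    Finset.measurable_fun_prod _ fun i _ => D.measurable_L i
  -- Selecting only the zero index vector for `i ∈ J` gives a linear form in the single point `x 0`.
  have e : ∀ x : Fin ℓ → ∀ i, X i,
      formProd L (fun i => if i ∈ J then {0} else ∅) x = ∏ i ∈ J, L i (x 0) := by
    intro x
    rw [formProd, ← Finset.prod_subset (Finset.subset_univ J)]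
    · refine Finset.prod_congr rfl fun i hi => ?_
      simp only [hi, if_true, Finset.mem_singleton]
      rw [Finset.prod_ite_eq' _ _ fun ω => L i (mixAll x ω), if_pos]
      · rfl
      · exact mem_subbox.2 fun _ _ => rfl
    · intro i _ hi
      simp [hi]
  have h1 := (D.forms fun i => if i ∈ J then {0} else ∅).1
  simp only [e] at h1
  rw [integral_comp_measurePreserving (measurePreserving_eval (fun _ : Fin ℓ => Measure.pi μ) 0)
    (g := fun x => ∏ i ∈ J, L i x) hm.aestronglyMeasurable] at h1
  refine h1.trans (integral_mono_of_nonneg (.of_forall fun x => Finset.prod_nonneg fun i _ =>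
    D.L_nonneg i x) (D.integrable_prod_sum J) (.of_forall fun x => ?_))
  exact Finset.prod_le_prod (fun i _ => D.L_nonneg i x) fun i _ => by
    linarith [D.Φ_nonneg i x]

/-- Independence of coordinate `i` makes the indicator of `B i` an admissible `i`-th function;
independence of `j` makes the fibre average over `j` equal to the indicator of the intersection.
Only copy `0` is used. -/
lemma abs_setIntegral_sub_one_le (D : FormsData μ ℓ C η L Φ) {j : ι} {B : ι → Set (∀ i, X i)}
    (hB : ∀ i ≠ j, MeasurableSet (B i))
    (hBi : ∀ i ≠ j, ∀ x u, Function.update x i u ∈ B i ↔ x ∈ B i)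
    (hBj : ∀ i ≠ j, ∀ x u, Function.update x j u ∈ B i ↔ x ∈ B i) :
    |∫ x in ⋂ i ∈ Finset.univ.erase j, B i, (L j x - 1) ∂(Measure.pi μ)|
      ≤ (4 * C) ^ (Fintype.card ι * ℓ) * η ^ (1 / (ℓ : ℝ) ^ (Finset.univ.erase j).card) := by
  classical
  set h : ι → Fin ℓ → (∀ i, X i) → ℝ := fun i k x =>
    if i = j ∨ k ≠ 0 then 1 else (B i).indicator 1 x with hh
  have hadm : Admissible L Φ j h := by
    refine ⟨fun i k => ?_, fun i k x => ?_, fun i hij k x u => ?_, fun i hij k => Or.inr fun x => ?_⟩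
    · by_cases hc : i = j ∨ k ≠ 0
      · simp only [hh, hc, if_true, measurable_const]
      · simp only [hh, hc, if_false]
        exact measurable_one.indicator (hB i fun e => hc (Or.inl e))
    · simp only [hh]
      split_ifs
      · exact zero_le_one
      · exact Set.indicator_nonneg (fun _ _ => zero_le_one) _
    · simp [hh, Set.indicator_apply, hBi i hij]
    · simp only [hh]
      split_ifs
      · exact le_rfl
      · exact Set.indicator_le_self' (fun _ _ => zero_le_one) _
  have e1 : ∀ y : ∀ i, X i,
      ∏ k, ∫ u, ∏ i ∈ Finset.univ.erase j, h i k (Function.update y j u) ∂(μ j)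
      = (⋂ i ∈ Finset.univ.erase j, B i).indicator 1 y := by
    intro y
    rw [Finset.prod_eq_single 0]
    · have : ∀ u, ∏ i ∈ Finset.univ.erase j, h i 0 (Function.update y j u)
          = (⋂ i ∈ Finset.univ.erase j, B i).indicator 1 y := by
        intro u
        have e2 : ∏ i ∈ Finset.univ.erase j, h i 0 (Function.update y j u)
            = ∏ i ∈ Finset.univ.erase j, if y ∈ B i then (1 : ℝ) else 0 := by
          refine Finset.prod_congr rfl fun i hi => ?_
          have hij := Finset.ne_of_mem_erase hi
          simp [hh, hij, Set.indicator_apply, hBj i hij]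
        rw [e2, Finset.prod_ite_zero]
        simp [Set.indicator_apply]
      simp [this]
    · intro k _ hk
      simp [hh, hk]
    · simp
  have key := (D.integral_fibre_sub_one hadm).2
  simp only [e1] at key
  rw [← integral_indicator (Finset.measurableSet_biInter _ fun i hi =>
    hB i (Finset.ne_of_mem_erase hi))]
  convert key using 3
  ext y
  by_cases hy : y ∈ ⋂ i ∈ Finset.univ.erase j, B i
  · rw [Set.indicator_of_mem hy, Set.indicator_of_mem hy, Pi.one_apply, mul_one]
  · rw [Set.indicator_of_notMem hy, Set.indicator_of_notMem hy, mul_zero]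

end FormsData

end Consequences

/-! ### Laws of mixed points and of projections. -/

section MeasurePreserving

variable {ι : Type*} [Fintype ι] {X : ι → Type*} [∀ i, MeasurableSpace (X i)]
  (μ : ∀ i, Measure (X i)) [∀ i, IsProbabilityMeasure (μ i)]

/-- Each coordinate of a mixed point comes from one of `ℓ` independent points, so its law is the
product measure. Hence almost-everywhere statements pass to all mixed points. -/
lemma measurePreserving_mixAll {ℓ : ℕ} (ω : ι → Fin ℓ) :
    MeasurePreserving (fun x : Fin ℓ → ∀ i, X i => mixAll x ω)
      (Measure.pi fun _ => Measure.pi μ) (Measure.pi μ) := by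
  refine ⟨measurable_mixAll ω, (Measure.pi_eq fun s hs => ?_).symm⟩
  rw [Measure.map_apply (measurable_mixAll ω) (MeasurableSet.univ_pi hs)]
  have : (fun x : Fin ℓ → ∀ i, X i => mixAll x ω) ⁻¹' (Set.univ.pi s)
      = Set.univ.pi fun k => Set.univ.pi fun i => if ω i = k then s i else Set.univ := by
    ext x
    simp only [Set.mem_preimage, Set.mem_pi, Set.mem_univ, forall_const, mixAll]
    constructor
    · intro h k i
      split_ifs with hk
      · rw [← hk]; exact h i
      · trivial
    · intro h i
      simpa using h (ω i) i
  rw [this, Measure.pi_pi]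
  simp only [Measure.pi_pi]
  rw [Finset.prod_comm]
  refine Finset.prod_congr rfl fun i _ => ?_
  rw [Finset.prod_eq_single (ω i)]
  · simp
  · intro k _ hk
    simp [hk.symm]
  · simp

lemma measurePreserving_restrict [DecidableEq ι] (e : Finset ι) :
    MeasurePreserving (e.restrict : (∀ i, X i) → ∀ i : e, X i) (Measure.pi μ)
      (Measure.pi fun i : e => μ i) := by
  convert measurePreserving_fst.comp (measurePreserving_piEquivPiSubtypeProd μ (· ∈ e))
  rfl

end MeasurePreserving

/-! ### Arithmetic of the moment exponent. -/

section Exponent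

lemma momentExponent_spec {C : ℝ} {p : ℝ≥0∞} :
    Even (momentExponent C p) ∧
      2 * (ENNReal.conjExponent p).toReal + (1 - 1 / C) + (p⁻¹).toReal ≤ momentExponent C p := by
  -- The infimum of an empty set of naturals is `0`; nonemptiness is what makes the infimum a member
  -- of the set.
  have hne : {m : ℕ | ∃ k : ℕ, m = 2 * k ∧
      2 * (ENNReal.conjExponent p).toReal + (1 - 1 / C) + (p⁻¹).toReal ≤ (m : ℝ)}.Nonempty := by
    obtain ⟨k, hk⟩ := exists_nat_ge
      (2 * (ENNReal.conjExponent p).toReal + (1 - 1 / C) + (p⁻¹).toReal)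
    refine ⟨2 * k, k, rfl, hk.trans ?_⟩
    exact_mod_cast Nat.le_mul_of_pos_left k (by norm_num)
  obtain ⟨k, hk, h⟩ := Nat.sInf_mem hne
  exact ⟨⟨k, by rw [← two_mul]; exact hk⟩, h⟩

lemma two_mul_conjExponent_le {C : ℝ} (hC : 1 ≤ C) {p : ℝ≥0∞} :
    2 * (ENNReal.conjExponent p).toReal ≤ momentExponent C p := by
  have h := (momentExponent_spec (C := C) (p := p)).2
  have h1 : 1 / C ≤ 1 := by rw [div_le_one (by linarith)]; exact hC
  have h2 : 0 ≤ (p⁻¹).toReal := ENNReal.toReal_nonneg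
  linarith

/-- The case `p = ∞` is set apart because `(∞).toReal = 0` would give the wrong value. -/
lemma conjExponent_toReal {p : ℝ≥0∞} (hp : 1 < p) :
    (ENNReal.conjExponent p).toReal = 1 + (p.toReal - 1)⁻¹ ∨ p = ∞ := by
  by_cases h : p = ∞
  · exact Or.inr h
  · left
    have h1 : p - 1 ≠ 0 := (tsub_pos_of_lt hp).ne'
    rw [ENNReal.conjExponent, ENNReal.toReal_add (by simp) (by simp [h1]), ENNReal.toReal_inv,
      ENNReal.toReal_sub_of_le hp.le h]
    simp

lemma two_le_momentExponent {C : ℝ} (hC : 1 ≤ C) {p : ℝ≥0∞} (hp : 1 < p) :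
    2 ≤ momentExponent C p := by
  have h := two_mul_conjExponent_le hC (p := p)
  have h1 : 1 ≤ (ENNReal.conjExponent p).toReal := by
    rcases conjExponent_toReal hp with h1 | rfl
    · rw [h1]
      by_cases h : p = ∞
      · simp [h] at h1 ⊢
        simp [ENNReal.conjExponent] at h1
      · have : 1 < p.toReal := by
          rw [← ENNReal.toReal_one]
          exact (ENNReal.toReal_lt_toReal (by simp) h).2 hp
        have : 0 < (p.toReal - 1)⁻¹ := inv_pos.2 (by linarith)
        linarith
    · simp [ENNReal.conjExponent]
  have : (2 : ℝ) ≤ momentExponent C p := by linarith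
  exact_mod_cast this

/-- From `ℓ ≥ 2q ≥ q` conjugation gives `ℓ' ≤ p`; this makes moments of order `ℓ'` accessible to the
`p`-box norm. -/
lemma dualExp_le_toReal {C : ℝ} (hC : 1 ≤ C) {p : ℝ≥0∞} (hp : 1 < p) (hp' : p ≠ ∞) :
    dualExp (momentExponent C p) ≤ p.toReal := by
  have h := two_mul_conjExponent_le hC (p := p)
  have h1 := (conjExponent_toReal hp).resolve_right hp'
  have h2 : 1 < p.toReal := by
    rw [← ENNReal.toReal_one]
    exact (ENNReal.toReal_lt_toReal (by simp) hp').2 hp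
  have hpos : 0 < (p.toReal - 1)⁻¹ := inv_pos.2 (by linarith)
  rw [h1] at h
  have h3 : (p.toReal - 1)⁻¹ ≤ (momentExponent C p : ℝ) - 1 := by linarith
  have h4 : ((momentExponent C p : ℝ) - 1)⁻¹ ≤ p.toReal - 1 := by
    rw [inv_le_comm₀ (by linarith) (by linarith)]
    exact h3
  have h5 : dualExp (momentExponent C p) = 1 + ((momentExponent C p : ℝ) - 1)⁻¹ := by
    rw [dualExp]
    field_simp [show (momentExponent C p : ℝ) - 1 ≠ 0 by linarith]
    ring
  rw [h5]
  linarith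

end Exponent

/-! ### Index vectors on a subset versus vectors extended by zero. -/

section Extend

variable {ι : Type*} [Fintype ι] [DecidableEq ι] {ℓ : ℕ} [NeZero ℓ]

/-- Extension of an index vector by zero. -/
def extendIdx (e : Finset ι) (ω : e → Fin ℓ) : ι → Fin ℓ :=
  fun i => if h : i ∈ e then ω ⟨i, h⟩ else 0

lemma prod_subbox_eq {R : Type*} [CommMonoid R] (e : Finset ι) (g : (ι → Fin ℓ) → R) :
    ∏ ω ∈ subbox ℓ e, g ω = ∏ ω : e → Fin ℓ, g (extendIdx e ω) := by
  have h : ∀ ω ∈ subbox ℓ e, extendIdx e (fun i : e => ω i) = ω := by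
    intro ω hω
    ext i
    by_cases hi : i ∈ e
    · simp [extendIdx, hi]
    · simp [extendIdx, hi, mem_subbox.1 hω i hi]
  refine Finset.prod_bij' (fun ω _ => fun i : e => ω i) (fun ω _ => extendIdx e ω)
    (fun _ _ => Finset.mem_univ _) ?_ h ?_ ?_
  · intro ω _
    refine mem_subbox.2 fun i hi => ?_
    simp [extendIdx, hi]
  · intro ω _
    ext i
    simp [extendIdx]
  · intro ω hω
    rw [h ω hω]

end Extend

/-! ### From box norms to box moments. -/

section BoxNorm

variable {n : ℕ} {X : Fin n → Type*} {ℓ : ℕ} [NeZero ℓ]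

lemma restrict_mixAll_extendIdx (e : Finset (Fin n)) (x : Fin ℓ → ∀ i, X i) (ω : e → Fin ℓ) :
    e.restrict (mixAll x (extendIdx e ω)) = mix e x ω := by
  ext i
  simp [mixAll, mix, extendIdx, Finset.restrict]

variable [∀ i, MeasurableSpace (X i)] (μ : ∀ i, Measure (X i)) [∀ i, IsProbabilityMeasure (μ i)]

lemma boxMoment_restrict (e : Finset (Fin n)) {g : PartSpace X e → ℝ≥0∞} (hg : Measurable g) :
    boxMoment μ ℓ e (fun x => g (e.restrict x))
      = ∫⁻ z : Fin ℓ → PartSpace X e, ∏ ω : e → Fin ℓ, g (mixPart e z ω)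
        ∂(Measure.pi fun _ : Fin ℓ => partMeasure μ e) := by
  have hp := measurePreserving_pi (fun _ : Fin ℓ => Measure.pi μ)
    (fun _ : Fin ℓ => partMeasure μ e) (fun _ => measurePreserving_restrict μ e)
  have hm : Measurable fun z : Fin ℓ → PartSpace X e => ∏ ω : e → Fin ℓ, g (mixPart e z ω) := by
    refine Finset.measurable_fun_prod _ fun ω _ => hg.comp ?_
    exact measurable_mixAll (X := fun i : e => X i) ω
  rw [← hp.lintegral_comp hm, boxMoment]
  refine lintegral_congr fun x => ?_
  rw [prod_subbox_eq]
  refine Finset.prod_congr rfl fun ω _ => ?_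
  rw [restrict_mixAll_extendIdx]
  rfl

lemma boxMoment_univ_eq (e : Finset (Fin n)) (g : PartSpace X e → ℝ≥0∞) :
    boxMoment (fun i : e => μ i) ℓ Finset.univ g
      = ∫⁻ z : Fin ℓ → PartSpace X e, ∏ ω : e → Fin ℓ, g (mixPart e z ω)
        ∂(Measure.pi fun _ : Fin ℓ => partMeasure μ e) := by
  have : subbox ℓ (Finset.univ : Finset e) = Finset.univ := by
    ext ω; simp [mem_subbox]
  rw [boxMoment, this]
  rfl

lemma boxLpNorm_congr {p : ℝ≥0∞} (e : Finset (Fin n)) {f g : PartSpace X e → ℝ}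
    (h : f =ᵐ[partMeasure μ e] g) : boxLpNorm μ ℓ p e f = boxLpNorm μ ℓ p e g := by
  unfold boxLpNorm
  split_ifs
  · exact eLpNorm_congr_ae h
  · congr 1
    unfold boxNorm
    congr 1
    refine lintegral_congr_ae ?_
    have : ∀ᵐ z ∂(Measure.pi fun _ : Fin ℓ => partMeasure μ e), ∀ ω : e → Fin ℓ,
        f (mixPart e z ω) = g (mixPart e z ω) := by
      refine ae_all_iff.2 fun ω => ?_
      exact (measurePreserving_mixAll (fun i : e => μ i) ω).quasiMeasurePreserving.ae h
    filter_upwards [this] with z hz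
    simp only [hz]

lemma lintegral_box_le_of_boxLpNorm_le {p : ℝ≥0∞} (hp : 1 < p) (hp' : p ≠ ∞) {C : ℝ}
    {e : Finset (Fin n)} {f : PartSpace X e → ℝ} (h : boxLpNorm μ ℓ p e f ≤ ENNReal.ofReal C) :
    ∫⁻ z : Fin ℓ → PartSpace X e, ∏ ω : e → Fin ℓ, ‖f (mixPart e z ω)‖ₑ ^ p.toReal
        ∂(Measure.pi fun _ : Fin ℓ => partMeasure μ e)
      ≤ (ENNReal.ofReal C ^ p.toReal) ^ ℓ ^ e.card := by
  have hp0 : 0 < p.toReal := ENNReal.toReal_pos (zero_lt_one.trans hp).ne' hp'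
  have hN : ((ℓ : ℝ) ^ e.card) ≠ 0 := pow_ne_zero _ (by exact_mod_cast NeZero.ne ℓ)
  rw [boxLpNorm, if_neg hp', one_div, ENNReal.rpow_inv_le_iff hp0, boxNorm, one_div,
    ENNReal.rpow_inv_le_iff (by positivity)] at h
  rw [← ENNReal.rpow_natCast _ (ℓ ^ e.card)]
  push_cast
  exact h

/-- For finite `p`, the moment over the empty set of coordinates is the plain `p`-th moment, so
monotonicity of box moments applies. -/
lemma eLpNorm_le_of_boxLpNorm_le (hℓ : 2 ≤ ℓ) {p : ℝ≥0∞} (hp : 1 < p) {C : ℝ}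
    {e : Finset (Fin n)} {f : PartSpace X e → ℝ} (hf : Measurable f)
    (h : boxLpNorm μ ℓ p e f ≤ ENNReal.ofReal C) :
    eLpNorm f p (partMeasure μ e) ≤ ENNReal.ofReal C := by
  by_cases hp' : p = ∞
  · subst hp'
    simpa [boxLpNorm] using h
  have hp0 : 0 < p.toReal := ENNReal.toReal_pos (zero_lt_one.trans hp).ne' hp'
  have h1 := lintegral_box_le_of_boxLpNorm_le μ hp hp' h
  rw [← boxMoment_univ_eq μ e fun x => ‖f x‖ₑ ^ p.toReal] at h1
  have hm : Measurable fun x => ‖f x‖ₑ ^ p.toReal := hf.enorm.pow_const _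
  have h2 := boxMoment_le_of_subset (fun i : e => μ i) hℓ (Finset.empty_subset Finset.univ) hm
    (by simpa using h1)
  simp only [boxMoment, subbox_empty, Finset.prod_singleton, mixAll_zero] at h2
  rw [(measurePreserving_eval (fun _ : Fin ℓ => partMeasure μ e) 0).lintegral_comp hm] at h2
  rw [eLpNorm_eq_lintegral_rpow_enorm_toReal (zero_lt_one.trans hp).ne' hp', one_div,
    ENNReal.rpow_inv_le_iff hp0]
  simpa using h2

lemma boxMoment_rpow_le_of_boxLpNorm_le {p : ℝ≥0∞} (hp : 1 < p) {s : ℝ} (hs : 0 < s)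
    (hsp : p ≠ ∞ → s ≤ p.toReal) {C : ℝ}
    {e : Finset (Fin n)} {f : PartSpace X e → ℝ} (hf : Measurable f)
    (h : boxLpNorm μ ℓ p e f ≤ ENNReal.ofReal C) :
    boxMoment μ ℓ e (fun x => ‖f (e.restrict x)‖ₑ ^ s)
      ≤ (ENNReal.ofReal C ^ s) ^ ℓ ^ e.card := by
  rw [boxMoment_restrict μ e (g := fun x => ‖f x‖ₑ ^ s) (hf.enorm.pow_const _)]
  by_cases hp' : p = ∞
  · subst hp'
    rw [boxLpNorm, if_pos rfl] at h
    have hb : ∀ᵐ x ∂(partMeasure μ e), ‖f x‖ₑ ≤ ENNReal.ofReal C := by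
      filter_upwards [ae_le_eLpNormEssSup (f := f) (μ := partMeasure μ e)] with x hx
      exact hx.trans (by simpa using h)
    have : ∀ᵐ z ∂(Measure.pi fun _ : Fin ℓ => partMeasure μ e), ∀ ω : e → Fin ℓ,
        ‖f (mixPart e z ω)‖ₑ ≤ ENNReal.ofReal C := by
      refine ae_all_iff.2 fun ω => ?_
      exact (measurePreserving_mixAll (fun i : e => μ i) ω).quasiMeasurePreserving.ae hb
    calc _ ≤ ∫⁻ _z : Fin ℓ → PartSpace X e, ∏ _ω : e → Fin ℓ, ENNReal.ofReal C ^ s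
        ∂(Measure.pi fun _ : Fin ℓ => partMeasure μ e) := by
          refine lintegral_mono_ae ?_
          filter_upwards [this] with z hz
          exact Finset.prod_le_prod' fun ω _ => ENNReal.rpow_le_rpow (hz ω) hs.le
      _ = _ := by simp
  · have hp0 : 0 < p.toReal := ENNReal.toReal_pos (zero_lt_one.trans hp).ne' hp'
    have h1 := lintegral_box_le_of_boxLpNorm_le μ hp hp' h
    have hr : s / p.toReal ≤ 1 := (div_le_one hp0).2 (hsp hp')
    have hr0 : 0 ≤ s / p.toReal := by positivity
    have hm : Measurable fun z : Fin ℓ → PartSpace X e =>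
        ∏ ω : e → Fin ℓ, ‖f (mixPart e z ω)‖ₑ ^ p.toReal := by
      refine Finset.measurable_fun_prod _ fun ω _ => (hf.comp ?_).enorm.pow_const _
      exact measurable_mixAll (X := fun i : e => X i) ω
    -- Jensen on a probability space, as Hölder against the constant `1`, lowers the exponent from
    -- `p` to `s`.
    have h2 := ENNReal.lintegral_mul_norm_pow_le
      (μ := Measure.pi fun _ : Fin ℓ => partMeasure μ e) hm.aemeasurable
      (measurable_const (a := (1 : ℝ≥0∞))).aemeasurable hr0 (sub_nonneg.2 hr)
      (add_sub_cancel _ _)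
    calc _ = ∫⁻ z : Fin ℓ → PartSpace X e,
          (∏ ω : e → Fin ℓ, ‖f (mixPart e z ω)‖ₑ ^ p.toReal) ^ (s / p.toReal)
          ∂(Measure.pi fun _ : Fin ℓ => partMeasure μ e) := by
          refine lintegral_congr fun z => ?_
          rw [← ENNReal.prod_rpow_of_nonneg hr0]
          refine Finset.prod_congr rfl fun ω _ => ?_
          rw [← ENNReal.rpow_mul, mul_div_cancel₀ _ hp0.ne']
      _ ≤ (∫⁻ z : Fin ℓ → PartSpace X e, ∏ ω : e → Fin ℓ, ‖f (mixPart e z ω)‖ₑ ^ p.toReal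
          ∂(Measure.pi fun _ : Fin ℓ => partMeasure μ e)) ^ (s / p.toReal) := by
          simpa using h2
      _ ≤ ((ENNReal.ofReal C ^ p.toReal) ^ ℓ ^ e.card) ^ (s / p.toReal) :=
          ENNReal.rpow_le_rpow h1 hr0
      _ = _ := by
          rw [← ENNReal.rpow_natCast, ← ENNReal.rpow_natCast, ← ENNReal.rpow_mul,
            ← ENNReal.rpow_mul, ← ENNReal.rpow_mul]
          congr 1
          field_simp

end BoxNorm

/-! ### Fibre means, and invariance of all conditions under null-set changes. -/

section FiberMean

variable {n : ℕ} {X : Fin n → Type*}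

lemma glue_restrict_erase (j : Fin n) (x : ∀ i, X i)
    (y : ∀ i : {i // i ∉ Finset.univ.erase j}, X i) :
    glue (Finset.univ.erase j) ((Finset.univ.erase j).restrict x) y
      = Function.update x j (y ⟨j, Finset.notMem_erase j _⟩) := by
  ext i
  by_cases hi : i = j
  · subst hi
    simp [glue, Equiv.piEquivPiSubtypeProd]
  · simp [glue, Equiv.piEquivPiSubtypeProd, hi]

variable [∀ i, MeasurableSpace (X i)] (μ : ∀ i, Measure (X i)) [∀ i, IsProbabilityMeasure (μ i)]

lemma measurePreserving_glue (e : Finset (Fin n)) :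
    MeasurePreserving (fun q : PartSpace X e × (∀ i : {i // i ∉ e}, X i) => glue e q.1 q.2)
      ((partMeasure μ e).prod (complMeasure μ e)) (Measure.pi μ) := by
  convert (measurePreserving_piEquivPiSubtypeProd μ (· ∈ e)).symm
  rfl

lemma ae_restrict (e : Finset (Fin n)) {P : PartSpace X e → Prop}
    (h : ∀ᵐ x ∂(partMeasure μ e), P x) : ∀ᵐ x ∂(Measure.pi μ), P (e.restrict x) :=
  (measurePreserving_restrict μ e).quasiMeasurePreserving.ae h

lemma fiberMean_congr_ae (e : Finset (Fin n)) {𝒢 : Finset (Finset (Fin n))}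
    {f g : ∀ e', PartSpace X e' → ℝ} (h : ∀ e' ∈ 𝒢, f e' =ᵐ[partMeasure μ e'] g e') :
    fiberMean μ e 𝒢 f =ᵐ[partMeasure μ e] fiberMean μ e 𝒢 g := by
  have h1 : ∀ᵐ x ∂(Measure.pi μ), ∀ e' ∈ 𝒢, f e' (e'.restrict x) = g e' (e'.restrict x) :=
    (Finset.eventually_all 𝒢).2 fun e' he' => ae_restrict μ e' (h e' he')
  have h2 := Measure.ae_ae_of_ae_prod
    ((measurePreserving_glue μ e).quasiMeasurePreserving.ae h1)
  filter_upwards [h2] with x hx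
  refine integral_congr_ae ?_
  filter_upwards [hx] with y hy
  exact Finset.prod_congr rfl hy

lemma measurable_fiberMean (e : Finset (Fin n)) {𝒢 : Finset (Finset (Fin n))}
    {f : ∀ e', PartSpace X e' → ℝ} (h : ∀ e' ∈ 𝒢, Measurable (f e')) :
    Measurable (fiberMean μ e 𝒢 f) := by
  have : Measurable fun q : PartSpace X e × (∀ i : {i // i ∉ e}, X i) =>
      ∏ e' ∈ 𝒢, f e' (e'.restrict (glue e q.1 q.2)) :=
    Finset.measurable_fun_prod _ fun e' he' =>
      (h e' he').comp ((measurable_pi_lambda _ fun i => measurable_pi_apply _).comp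
        (measurePreserving_glue μ e).measurable)
  exact this.stronglyMeasurable.integral_prod_right'.measurable

/-- The complement of a facet is one vertex, so the fibre mean is an integral over a single updated
coordinate. -/
lemma fiberMean_restrict (j : Fin n) {𝒢 : Finset (Finset (Fin n))}
    {f : ∀ e', PartSpace X e' → ℝ} (h : ∀ e' ∈ 𝒢, Measurable (f e')) (x : ∀ i, X i) :
    fiberMean μ (Finset.univ.erase j) 𝒢 f ((Finset.univ.erase j).restrict x)
      = ∫ u, ∏ e' ∈ 𝒢, f e' (e'.restrict (Function.update x j u)) ∂(μ j) := by
  have hm : Measurable fun u => ∏ e' ∈ 𝒢, f e' (e'.restrict (Function.update x j u)) :=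
    Finset.measurable_fun_prod _ fun e' he' =>
      (h e' he').comp ((measurable_pi_lambda _ fun i => measurable_pi_apply _).comp
        (measurable_update x))
  rw [← integral_comp_measurePreserving (measurePreserving_eval
    (fun i : {i // i ∉ Finset.univ.erase j} => μ i) ⟨j, Finset.notMem_erase j _⟩)
    hm.aestronglyMeasurable]
  simp only [fiberMean, glue_restrict_erase]

lemma integral_restrict (e : Finset (Fin n)) {f : PartSpace X e → ℝ}
    (hf : AEStronglyMeasurable f (partMeasure μ e)) :
    ∫ x, f (e.restrict x) ∂(Measure.pi μ) = ∫ x, f x ∂(partMeasure μ e) :=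
  integral_comp_measurePreserving (measurePreserving_restrict μ e) hf

lemma integrable_restrict (e : Finset (Fin n)) {f : PartSpace X e → ℝ}
    (hf : AEStronglyMeasurable f (partMeasure μ e)) :
    Integrable (fun x => f (e.restrict x)) (Measure.pi μ) ↔ Integrable f (partMeasure μ e) :=
  (measurePreserving_restrict μ e).integrable_comp hf

lemma cutNorm_congr (e : Finset (Fin n)) {f g : PartSpace X e → ℝ}
    (h : f =ᵐ[partMeasure μ e] g) : cutNorm μ e f = cutNorm μ e g := by
  unfold cutNorm
  refine iSup_congr fun A => iSup_congr fun _ => ?_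
  congr 2
  exact integral_congr_ae (ae_restrict_of_ae (ae_restrict μ e h))

variable {μ}

/-- Allows measurable, everywhere nonnegative representatives, on which the pointwise substitution
arguments can operate. -/
lemma IsPseudorandomOfOrder.congr {ℋ : Finset (Finset (Fin n))} {C η : ℝ} {p : ℝ≥0∞} {m : ℕ}
    {f g : ∀ e, PartSpace X e → ℝ} (H : IsPseudorandomOfOrder μ ℋ C η p m f)
    (h : ∀ e ∈ ℋ, f e =ᵐ[partMeasure μ e] g e) : IsPseudorandomOfOrder μ ℋ C η p m g where
  integrable e he := (H.integrable e he).congr (h e he)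
  nonneg e he := (H.nonneg e he).trans_eq (h e he)
  c1 𝒢 h𝒢 hne := by
    have e1 : (fun x => ∏ e ∈ 𝒢, f e (e.restrict x)) =ᵐ[Measure.pi μ]
        fun x => ∏ e ∈ 𝒢, g e (e.restrict x) := by
      have : ∀ᵐ x ∂(Measure.pi μ), ∀ e ∈ 𝒢, f e (e.restrict x) = g e (e.restrict x) :=
        (Finset.eventually_all 𝒢).2 fun e' he' => ae_restrict μ e' (h e' (h𝒢 he'))
      filter_upwards [this] with x hx
      exact Finset.prod_congr rfl hx
    obtain ⟨h1, h2⟩ := H.c1 𝒢 h𝒢 hne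
    exact ⟨h1.congr e1, by rwa [← integral_congr_ae e1]⟩
  c2 e he := by
    obtain ⟨ψ, h1, h2, h3, h4⟩ := H.c2 e he
    refine ⟨ψ, h1, h2, ?_, fun q hq => ?_⟩
    · rwa [← cutNorm_congr μ e (f := fun x => f e x - ψ x)]
      filter_upwards [h e he] with x hx
      rw [hx]
    · have e1 : (fun x => (f e x - ψ x) * ∏ ω, fiberMean μ e (ℋ.erase e) (q ω) x)
          =ᵐ[partMeasure μ e]
          fun x => (g e x - ψ x) * ∏ ω, fiberMean μ e (ℋ.erase e) (q ω) x := by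
        filter_upwards [h e he] with x hx
        rw [hx]
      obtain ⟨h5, h6⟩ := h4 q fun ω e' he' => by
        obtain ⟨a, b, c⟩ := hq ω e' he'
        refine ⟨a, b, c.imp_left fun c => c.trans_eq (h e' (Finset.mem_of_mem_erase he')).symm⟩
      exact ⟨h5.congr e1, by rwa [← integral_congr_ae e1]⟩
  c3 e he 𝒢 h𝒢 hne := by
    have e1 : (fun x => fiberMean μ e 𝒢 f x ^ m) =ᵐ[partMeasure μ e]
        fun x => fiberMean μ e 𝒢 g x ^ m := by
      filter_upwards [fiberMean_congr_ae μ e fun e' he' =>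
        h e' (Finset.mem_of_mem_erase (h𝒢 he'))] with x hx
      rw [hx]
    obtain ⟨h1, h2⟩ := H.c3 e he 𝒢 h𝒢 hne
    exact ⟨h1.congr e1, by rwa [← integral_congr_ae e1]⟩

lemma LinearForms.congr {ℋ : Finset (Finset (Fin n))} {η : ℝ} {ℓ : ℕ} [NeZero ℓ]
    {f g : ∀ e, PartSpace X e → ℝ} (H : LinearForms μ ℋ ℓ η f)
    (h : ∀ e ∈ ℋ, f e =ᵐ[partMeasure μ e] g e) : LinearForms μ ℋ ℓ η g := by
  intro k
  have h1 : ∀ᵐ x ∂(Measure.pi fun _ : Fin ℓ => Measure.pi μ), ∀ e ∈ ℋ, ∀ ω : e → Fin ℓ,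
      f e (mix e x ω) = g e (mix e x ω) := by
    refine (Finset.eventually_all ℋ).2 fun e he => ae_all_iff.2 fun ω => ?_
    have := (measurePreserving_mixAll μ (extendIdx e ω)).quasiMeasurePreserving.ae
      (ae_restrict μ e (h e he))
    simpa only [restrict_mixAll_extendIdx] using this
  have e1 : (fun x : Fin ℓ → ∀ i, X i =>
      ∏ e ∈ ℋ, ∏ ω : e → Fin ℓ, f e (mix e x ω) ^ (k e ω : ℕ))
      =ᵐ[Measure.pi fun _ : Fin ℓ => Measure.pi μ]
      fun x => ∏ e ∈ ℋ, ∏ ω : e → Fin ℓ, g e (mix e x ω) ^ (k e ω : ℕ) := by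
    filter_upwards [h1] with x hx
    refine Finset.prod_congr rfl fun e he => Finset.prod_congr rfl fun ω _ => ?_
    rw [hx e he]
  rw [← integral_congr_ae e1]
  exact H k

lemma exists_measurable_nonneg_ae_eq {α : Type*} [MeasurableSpace α] {m : Measure α} {f : α → ℝ}
    (hf : AEStronglyMeasurable f m) (h0 : 0 ≤ᵐ[m] f) :
    ∃ g : α → ℝ, Measurable g ∧ (∀ x, 0 ≤ g x) ∧ f =ᵐ[m] g := by
  refine ⟨fun x => max (hf.mk f x) 0, hf.stronglyMeasurable_mk.measurable.max measurable_const,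
    fun x => le_max_right _ _, ?_⟩
  filter_upwards [hf.ae_eq_mk, h0] with x h1 h2
  rw [← h1]
  exact (max_eq_left h2).symm

lemma exists_measurable_bounded_ae_eq {α : Type*} [MeasurableSpace α] {m : Measure α} {f b : α → ℝ}
    (hf : AEStronglyMeasurable f m) (h0 : 0 ≤ᵐ[m] f) (hb : Measurable b) (hb0 : ∀ x, 0 ≤ b x)
    (hfb : f ≤ᵐ[m] b) :
    ∃ g : α → ℝ, Measurable g ∧ (∀ x, 0 ≤ g x) ∧ (∀ x, g x ≤ b x) ∧ f =ᵐ[m] g := by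
  obtain ⟨g, hg, hg0, he⟩ := exists_measurable_nonneg_ae_eq hf h0
  refine ⟨fun x => min (g x) (b x), hg.min hb, fun x => le_min (hg0 x) (hb0 x),
    fun x => min_le_right _ _, ?_⟩
  filter_upwards [he, hfb] with x h1 h2
  rw [← h1]
  exact (min_eq_left h2).symm

end FiberMean

/-! ### Facets indexed by their missing vertex. -/

section Facets

variable {n : ℕ}

lemma mem_facets {e : Finset (Fin n)} (hn : 1 ≤ n) :
    e ∈ (Finset.univ : Finset (Fin n)).powersetCard (n - 1) ↔ ∃ i, e = Finset.univ.erase i := by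
  simp only [Finset.mem_powersetCard_univ]
  constructor
  · intro h
    have : eᶜ.card = 1 := by rw [Finset.card_compl, h, Fintype.card_fin]; omega
    obtain ⟨i, hi⟩ := Finset.card_eq_one.1 this
    exact ⟨i, by rw [← compl_compl e, hi, Finset.compl_singleton]⟩
  · rintro ⟨i, rfl⟩
    simp

lemma erase_univ_injective : Function.Injective fun i : Fin n => Finset.univ.erase i := by
  intro i j h
  by_contra hij
  have : j ∈ Finset.univ.erase i := Finset.mem_erase.2 ⟨fun h => hij h.symm, Finset.mem_univ j⟩
  simp only at h
  rw [h] at this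
  exact Finset.notMem_erase j _ this

/-- The indices of the facets in `𝒢`. -/
def facetIndex (𝒢 : Finset (Finset (Fin n))) : Finset (Fin n) :=
  Finset.univ.filter fun i => Finset.univ.erase i ∈ 𝒢

lemma prod_facets {R : Type*} [CommMonoid R] (hn : 1 ≤ n) {𝒢 : Finset (Finset (Fin n))}
    (h𝒢 : 𝒢 ⊆ (Finset.univ : Finset (Fin n)).powersetCard (n - 1)) (F : Finset (Fin n) → R) :
    ∏ e ∈ 𝒢, F e = ∏ i ∈ facetIndex 𝒢, F (Finset.univ.erase i) := by
  have : 𝒢 = (facetIndex 𝒢).image fun i => Finset.univ.erase i := by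
    ext e
    simp only [facetIndex, Finset.mem_image, Finset.mem_filter, Finset.mem_univ, true_and]
    constructor
    · intro he
      obtain ⟨i, rfl⟩ := (mem_facets hn).1 (h𝒢 he)
      exact ⟨i, he, rfl⟩
    · rintro ⟨i, hi, rfl⟩
      exact hi
  conv_lhs => rw [this]
  exact Finset.prod_image fun i _ j _ h => erase_univ_injective h

lemma facetIndex_erase (hn : 1 ≤ n) (j : Fin n) :
    facetIndex (((Finset.univ : Finset (Fin n)).powersetCard (n - 1)).erase (Finset.univ.erase j))
      = Finset.univ.erase j := by
  ext i
  simp only [facetIndex, Finset.mem_filter, Finset.mem_univ, true_and, Finset.mem_erase,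
    and_true]
  constructor
  · rintro ⟨h, _⟩ rfl
    exact h rfl
  · exact fun h => ⟨fun h' => h (erase_univ_injective h'), (mem_facets hn).2 ⟨i, rfl⟩⟩

lemma facetIndex_facets (hn : 1 ≤ n) :
    facetIndex ((Finset.univ : Finset (Fin n)).powersetCard (n - 1)) = Finset.univ := by
  ext i
  simp only [facetIndex, Finset.mem_filter, Finset.mem_univ, true_and, iff_true]
  exact (mem_facets hn).2 ⟨i, rfl⟩

variable {X : Fin n → Type*}

lemma restrict_update_of_notMem {e : Finset (Fin n)} {i : Fin n} (hi : i ∉ e) (x : ∀ i, X i)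
    (u : X i) : e.restrict (Function.update x i u) = e.restrict x := by
  ext m
  have : (m : Fin n) ≠ i := fun h => hi (h ▸ m.2)
  simp [Finset.restrict, this]

/-- A function on `𝑿_e`, for `e = [n] ∖ {i}`, as a function on `𝑿`. -/
def lift (f : ∀ e : Finset (Fin n), PartSpace X e → ℝ) (i : Fin n) (x : ∀ i, X i) : ℝ :=
  f (Finset.univ.erase i) ((Finset.univ.erase i).restrict x)

lemma lift_update (f : ∀ e : Finset (Fin n), PartSpace X e → ℝ) (i : Fin n) (x : ∀ i, X i)
    (u : X i) : lift f i (Function.update x i u) = lift f i x := by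
  rw [lift, restrict_update_of_notMem (Finset.notMem_erase i _), lift]

variable [∀ i, MeasurableSpace (X i)]

lemma measurable_lift {f : ∀ e : Finset (Fin n), PartSpace X e → ℝ} (hf : ∀ e, Measurable (f e))
    (i : Fin n) : Measurable (lift f i) :=
  (hf _).comp (measurable_pi_lambda _ fun _ => measurable_pi_apply _)

variable {μ : ∀ i, Measure (X i)} {ℓ : ℕ} [NeZero ℓ]

lemma LinearForms.integral_formProd (hn : 1 ≤ n) {η : ℝ}
    {f : ∀ e : Finset (Fin n), PartSpace X e → ℝ}
    (H : LinearForms μ ((Finset.univ : Finset (Fin n)).powersetCard (n - 1)) ℓ η f)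
    (A : Fin n → Finset (Fin n → Fin ℓ)) :
    1 - η ≤ ∫ x, formProd (lift f) A x ∂(Measure.pi fun _ : Fin ℓ => Measure.pi μ) ∧
    ∫ x, formProd (lift f) A x ∂(Measure.pi fun _ : Fin ℓ => Measure.pi μ) ≤ 1 + η := by
  classical
  -- The exponents must be defined for every `e`; the missing vertex is quantified existentially and
  -- is unique for a facet.
  have key := H fun e ω => if ∃ i, e = Finset.univ.erase i ∧ extendIdx e ω ∈ A i then 1 else 0
  have hk : ∀ i (ω : ↥(Finset.univ.erase i) → Fin ℓ),
      (∃ m, Finset.univ.erase i = Finset.univ.erase m ∧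
        extendIdx (Finset.univ.erase i) ω ∈ A m) ↔ extendIdx (Finset.univ.erase i) ω ∈ A i := by
    intro i ω
    constructor
    · rintro ⟨m, h1, h2⟩
      obtain rfl : i = m := erase_univ_injective h1
      exact h2
    · exact fun h => ⟨i, rfl, h⟩
  have e : ∀ x : Fin ℓ → ∀ i, X i, formProd (lift f) A x
      = ∏ e ∈ (Finset.univ : Finset (Fin n)).powersetCard (n - 1), ∏ ω : e → Fin ℓ,
        f e (mix e x ω) ^ ((if ∃ i, e = Finset.univ.erase i ∧ extendIdx e ω ∈ A i then 1 else 0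
          : Fin 2) : ℕ) := by
    intro x
    rw [prod_facets hn (Finset.Subset.refl _), facetIndex_facets hn, formProd]
    refine Finset.prod_congr rfl fun i _ => ?_
    rw [prod_subbox_eq]
    refine Finset.prod_congr rfl fun ω _ => ?_
    simp only [hk]
    split_ifs with h
    · rw [lift, restrict_mixAll_extendIdx]
      simp
    · simp
  simp only [e]
  exact key

end Facets

/-! ### Verification of (C1)–(C3) and the theorem. -/

section Main

lemma prod_fin_dite_lt_two {R : Type*} [CommMonoid R] {ℓ : ℕ} (hℓ : 2 ≤ ℓ) (a : Fin 2 → R) :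
    ∏ k : Fin ℓ, (if h : k.val < 2 then a ⟨k.val, h⟩ else 1) = ∏ ω : Fin 2, a ω := by
  obtain ⟨m, rfl⟩ := Nat.exists_eq_add_of_le hℓ
  rw [Fin.prod_univ_add, Finset.prod_eq_one (s := (Finset.univ : Finset (Fin m))), mul_one]
  · exact Finset.prod_congr rfl fun k _ => dif_pos k.2
  · exact fun k _ => dif_neg (by rw [Fin.val_natAdd]; omega)

variable {n : ℕ} {X : Fin n → Type*} [∀ i, MeasurableSpace (X i)]
  {μ : ∀ i, Measure (X i)} [∀ i, IsProbabilityMeasure (μ i)] {ℓ : ℕ} [NeZero ℓ] {C η : ℝ}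
  {lam φ : ∀ e : Finset (Fin n), PartSpace X e → ℝ}

/-- The family `g` as a family of functions on `𝑿`, used for the copies `0` and `1` only. -/
def pairFamily (ℓ : ℕ) (g : Fin 2 → ∀ e : Finset (Fin n), PartSpace X e → ℝ) :
    Fin n → Fin ℓ → (∀ i, X i) → ℝ :=
  fun i k x => if h : k.val < 2 then lift (g ⟨k.val, h⟩) i x else 1

lemma prod_integral_pairFamily (hn : 1 ≤ n) (hℓ : 2 ≤ ℓ) (j : Fin n)
    {g : Fin 2 → ∀ e : Finset (Fin n), PartSpace X e → ℝ} (hg : ∀ ω e, Measurable (g ω e))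
    (y : ∀ i, X i) :
    ∏ k : Fin ℓ, ∫ u, ∏ i ∈ Finset.univ.erase j, pairFamily ℓ g i k (Function.update y j u) ∂(μ j)
      = ∏ ω, fiberMean μ (Finset.univ.erase j)
        (((Finset.univ : Finset (Fin n)).powersetCard (n - 1)).erase (Finset.univ.erase j)) (g ω)
        ((Finset.univ.erase j).restrict y) := by
  rw [← prod_fin_dite_lt_two hℓ]
  refine Finset.prod_congr rfl fun k _ => ?_
  by_cases h : k.val < 2
  · rw [dif_pos h, fiberMean_restrict μ j fun e _ => hg _ e]
    refine integral_congr_ae (.of_forall fun u => ?_)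
    simp only
    rw [prod_facets hn (Finset.erase_subset _ _), facetIndex_erase hn]
    refine Finset.prod_congr rfl fun i _ => ?_
    rw [pairFamily, dif_pos h, lift]
  · simp [pairFamily, h]

/-- A boundary face of `[n] ∖ {j}` misses `j` and one further vertex `i`, so the sets `B` depend on
neither coordinate. -/
lemma FormsData.cutNorm_sub_one_le (D : FormsData μ ℓ C η (lift lam) (lift φ)) (hn : 2 ≤ n)
    (j : Fin n) :
    cutNorm μ (Finset.univ.erase j) (fun x => lam _ x - 1)
      ≤ ENNReal.ofReal ((4 * C) ^ (n * ℓ) * η ^ (1 / (ℓ : ℝ) ^ (n - 1))) := by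
  refine iSup₂_le fun A hA => ENNReal.ofReal_le_ofReal ?_
  obtain ⟨B, hB, rfl⟩ := hA
  set e := Finset.univ.erase j with he
  have hmem : ∀ i ≠ j, e.erase i ∈ e.powersetCard (e.card - 1) := fun i hij =>
    Finset.mem_powersetCard.2 ⟨Finset.erase_subset _ _,
      Finset.card_erase_of_mem (Finset.mem_erase.2 ⟨hij, Finset.mem_univ i⟩)⟩
  have hset : (⋂ e' ∈ e.powersetCard (e.card - 1), B e') = ⋂ i ∈ e, B (e.erase i) := by
    ext x
    simp only [Set.mem_iInter]
    constructor
    · exact fun h i hi => h _ (hmem i (Finset.ne_of_mem_erase hi))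
    · intro h e' he'
      obtain ⟨hsub, hcard⟩ := Finset.mem_powersetCard.1 he'
      have hpos : 0 < e.card := by
        rw [he, Finset.card_erase_of_mem (Finset.mem_univ j), Finset.card_univ, Fintype.card_fin]
        omega
      obtain ⟨i, hi⟩ := Finset.card_eq_one.1 (show (e \ e').card = 1 by
        rw [Finset.card_sdiff_of_subset hsub, hcard]; omega)
      have hie : i ∈ e := (Finset.mem_sdiff.1 (hi ▸ Finset.mem_singleton_self i)).1
      have : e' = e.erase i := by
        rw [← Finset.sdiff_singleton_eq_erase, ← hi, Finset.sdiff_sdiff_eq_self hsub]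
      rw [this]
      exact h i hie
  have hinv : ∀ i ≠ j, ∀ m ∉ e.erase i, ∀ x u,
      Function.update x m u ∈ B (e.erase i) ↔ x ∈ B (e.erase i) := by
    intro i hij m hm x u
    obtain ⟨S, _, hS⟩ := hB _ (hmem i hij)
    rw [← hS, Set.mem_preimage, Set.mem_preimage, restrict_update_of_notMem hm]
  have key := D.abs_setIntegral_sub_one_le (j := j) (B := fun i => B (e.erase i))
    (fun i hij => by
      obtain ⟨S, hS, hS'⟩ := hB _ (hmem i hij)
      rw [← hS']
      exact hS.preimage (measurable_pi_lambda _ fun _ => measurable_pi_apply _))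
    (fun i hij => hinv i hij i (Finset.notMem_erase i _))
    (fun i hij => hinv i hij j fun h => Finset.notMem_erase j _ (Finset.mem_of_mem_erase h))
  rw [Finset.card_erase_of_mem (Finset.mem_univ j), Finset.card_univ, Fintype.card_fin] at key
  rw [hset]
  exact key

lemma FormsData.integral_mul_fiberMean_le (D : FormsData μ ℓ C η (lift lam) (lift φ)) (hn : 1 ≤ n)
    (hlam : ∀ e, Measurable (lam e)) (j : Fin n)
    {g : Fin 2 → ∀ e : Finset (Fin n), PartSpace X e → ℝ} (hg : ∀ ω e, Measurable (g ω e))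
    (hg0 : ∀ ω e x, 0 ≤ g ω e x) (hle : ∀ ω, ∀ i ≠ j,
      (∀ x, g ω (Finset.univ.erase i) x
        ≤ lam (Finset.univ.erase i) x + φ (Finset.univ.erase i) x) ∨
      ∀ x, g ω (Finset.univ.erase i) x ≤ 1) :
    Integrable (fun x => (lam _ x - 1) * ∏ ω, fiberMean μ (Finset.univ.erase j)
        (((Finset.univ : Finset (Fin n)).powersetCard (n - 1)).erase (Finset.univ.erase j)) (g ω) x)
      (partMeasure μ (Finset.univ.erase j)) ∧
    |∫ x, (lam _ x - 1) * ∏ ω, fiberMean μ (Finset.univ.erase j)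
        (((Finset.univ : Finset (Fin n)).powersetCard (n - 1)).erase (Finset.univ.erase j)) (g ω) x
      ∂(partMeasure μ (Finset.univ.erase j))|
      ≤ (4 * C) ^ (n * ℓ) * η ^ (1 / (ℓ : ℝ) ^ (n - 1)) := by
  have hadm : Admissible (lift lam) (lift φ) j (pairFamily ℓ g) := by
    refine ⟨fun i k => ?_, fun i k x => ?_, fun i _ k x u => ?_, fun i hij k => ?_⟩
    · by_cases h : k.val < 2
      · have : pairFamily ℓ g i k = lift (g ⟨k.val, h⟩) i := by
          ext x; simp [pairFamily, h]
        exact this ▸ measurable_lift (hg _) i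
      · have : pairFamily ℓ g i k = fun _ => 1 := by
          ext x; simp [pairFamily, h]
        exact this ▸ measurable_const
    · unfold pairFamily
      split_ifs
      · exact hg0 _ _ _
      · exact zero_le_one
    · simp [pairFamily, lift_update]
    · by_cases h : k.val < 2
      · simp only [pairFamily, h, dif_pos]
        exact (hle ⟨k.val, h⟩ i hij).imp (fun h x => h _) fun h x => h _
      · right
        simp [pairFamily, h]
  have hm : Measurable fun x => (lam _ x - 1) * ∏ ω, fiberMean μ (Finset.univ.erase j)
        (((Finset.univ : Finset (Fin n)).powersetCard (n - 1)).erase (Finset.univ.erase j))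
          (g ω) x :=
    ((hlam _).sub_const 1).mul (Finset.measurable_fun_prod _ fun ω _ =>
      measurable_fiberMean μ _ fun e _ => hg ω e)
  obtain ⟨h1, h2⟩ := D.integral_fibre_sub_one hadm
  simp only [prod_integral_pairFamily hn D.two_le j hg] at h1 h2
  rw [← integrable_restrict μ _ hm.aestronglyMeasurable,
    ← integral_restrict μ _ hm.aestronglyMeasurable]
  refine ⟨h1, ?_⟩
  simpa [Finset.card_erase_of_mem, lift] using h2

/-- A power of order `ℓ` is a product over `ℓ` copies of coordinate `j`, so all copies are filled
with the factors `lam + φ` from `𝒢`. -/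
lemma FormsData.integral_fiberMean_pow_le (D : FormsData μ ℓ C η (lift lam) (lift φ)) (hn : 1 ≤ n)
    (hlam : ∀ e, Measurable (lam e)) (hφ : ∀ e, Measurable (φ e)) (j : Fin n)
    {𝒢 : Finset (Finset (Fin n))} (h𝒢 : 𝒢 ⊆
      ((Finset.univ : Finset (Fin n)).powersetCard (n - 1)).erase (Finset.univ.erase j)) :
    Integrable (fun x => fiberMean μ (Finset.univ.erase j) 𝒢 (fun e x => lam e x + φ e x) x ^ ℓ)
      (partMeasure μ (Finset.univ.erase j)) ∧
    ∫ x, fiberMean μ (Finset.univ.erase j) 𝒢 (fun e x => lam e x + φ e x) x ^ ℓ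
      ∂(partMeasure μ (Finset.univ.erase j)) ≤ (4 * C) ^ (n * ℓ) := by
  have hC := D.one_le
  have hs : ∀ e, Measurable fun x => lam e x + φ e x := fun e => (hlam e).add (hφ e)
  have hm : Measurable fun x =>
      fiberMean μ (Finset.univ.erase j) 𝒢 (fun e x => lam e x + φ e x) x ^ ℓ :=
    (measurable_fiberMean μ _ fun e _ => hs e).pow_const ℓ
  have hj : j ∉ facetIndex 𝒢 := by
    intro h
    simp only [facetIndex, Finset.mem_filter, Finset.mem_univ, true_and] at h
    exact Finset.notMem_erase _ _ (h𝒢 h)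
  have key : ∫⁻ x, ‖fiberMean μ (Finset.univ.erase j) 𝒢 (fun e x => lam e x + φ e x)
      ((Finset.univ.erase j).restrict x) ^ ℓ‖ₑ ∂(Measure.pi μ)
      ≤ ENNReal.ofReal ((4 * C) ^ (n * ℓ)) := by
    have h1 := D.lintegral_fibreSum_pow_le hj
    rw [Fintype.card_fin] at h1
    refine (lintegral_mono fun x => ?_).trans h1
    simp only
    rw [enorm_pow, fiberMean_restrict μ j (fun e _ => hs e)]
    refine pow_le_pow_left₀ zero_le ((enorm_integral_le_lintegral_enorm _).trans
      (le_of_eq (lintegral_congr fun u => ?_))) ℓ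
    rw [prod_facets hn (h𝒢.trans (Finset.erase_subset _ _)), enorm_finset_prod]
    rfl
  have hint := (integrable_restrict μ _ hm.aestronglyMeasurable).1
    ⟨(hm.comp (measurable_pi_lambda _ fun _ => measurable_pi_apply _)).aestronglyMeasurable,
      key.trans_lt ENNReal.ofReal_lt_top⟩
  refine ⟨hint, ?_⟩
  rw [← integral_restrict μ _ hm.aestronglyMeasurable]
  have h2 := (enorm_integral_le_lintegral_enorm _).trans key
  rw [← ofReal_norm, ENNReal.ofReal_le_ofReal_iff (by positivity)] at h2
  exact (le_abs_self _).trans h2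

lemma isPseudorandomOfOrder_add (hn : 3 ≤ n) {p : ℝ≥0∞} (hp : 1 < p)
    (hℓ : ℓ = momentExponent C p) (hC : 1 ≤ C) (hη : 0 < η) (hη1 : η < 1)
    (hlam : ∀ e, Measurable (lam e)) (hlam0 : ∀ e x, 0 ≤ lam e x)
    (hφ : ∀ e, Measurable (φ e)) (hφ0 : ∀ e x, 0 ≤ φ e x)
    (hlamI : ∀ e ∈ (Finset.univ : Finset (Fin n)).powersetCard (n - 1),
      Integrable (lam e) (partMeasure μ e))
    (hφp : ∀ e ∈ (Finset.univ : Finset (Fin n)).powersetCard (n - 1),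
      MemLp (φ e) p (partMeasure μ e))
    (hI : LinearForms μ ((Finset.univ : Finset (Fin n)).powersetCard (n - 1)) ℓ η lam)
    (hII : ∀ e ∈ (Finset.univ : Finset (Fin n)).powersetCard (n - 1),
      boxLpNorm μ ℓ p e (φ e) ≤ ENNReal.ofReal C) :
    IsPseudorandomOfOrder μ ((Finset.univ : Finset (Fin n)).powersetCard (n - 1))
      ((4 * C) ^ (n * ℓ)) ((4 * C) ^ (n * ℓ) * η ^ (1 / (ℓ : ℝ) ^ (n - 1))) p ℓ
      (fun e x => lam e x + φ e x) := by
  have hn1 : 1 ≤ n := by omega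
  have h2ℓ : 2 ≤ ℓ := hℓ ▸ two_le_momentExponent hC hp
  have hs : 0 < dualExp ℓ := zero_lt_one.trans_le (one_le_dualExp h2ℓ)
  have D : FormsData μ ℓ C η (lift lam) (lift φ) :=
    { two_le := h2ℓ
      even := hℓ ▸ momentExponent_spec.1
      one_le := hC
      eta_pos := hη
      eta_lt_one := hη1
      measurable_L := measurable_lift hlam
      measurable_Φ := measurable_lift hφ
      L_nonneg := fun _ _ => hlam0 _ _
      Φ_nonneg := fun _ _ => hφ0 _ _
      L_update := lift_update lam
      Φ_update := lift_update φ
      forms := hI.integral_formProd hn1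
      moment := fun i => boxMoment_rpow_le_of_boxLpNorm_le μ hp hs
        (fun h => by rw [hℓ]; exact dualExp_le_toReal hC hp h) (hφ _)
        (hII _ ((mem_facets hn1).2 ⟨i, rfl⟩)) }
  have hK : 4 * C ≤ (4 * C) ^ (n * ℓ) :=
    le_self_pow₀ (by linarith) (Nat.mul_ne_zero (by omega) (by omega))
  -- Needed for (C1), whose proof gives the error `η` rather than the larger `η'`.
  have hηη : η ≤ η ^ (1 / (ℓ : ℝ) ^ (n - 1)) := by
    have h1 : (1 : ℝ) ≤ (ℓ : ℝ) ^ (n - 1) := one_le_pow₀ (by exact_mod_cast (by omega : 1 ≤ ℓ))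
    have := Real.rpow_le_rpow_of_exponent_ge hη hη1.le
      ((div_le_one (by linarith)).2 h1 : 1 / (ℓ : ℝ) ^ (n - 1) ≤ 1)
    simpa using this
  have hη'0 : 0 ≤ η ^ (1 / (ℓ : ℝ) ^ (n - 1)) := by positivity
  refine ⟨fun e he => (hlamI e he).add ((hφp e he).integrable hp.le),
    fun e _ => .of_forall fun x => add_nonneg (hlam0 e x) (hφ0 e x), ?_, ?_, ?_⟩
  · intro 𝒢 h𝒢 _
    have e1 : (fun x : ∀ i, X i => ∏ e ∈ 𝒢, (lam e (e.restrict x) + φ e (e.restrict x)))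
        = fun x => ∏ i ∈ facetIndex 𝒢, (lift lam i x + lift φ i x) :=
      funext fun x => prod_facets hn1 h𝒢 _
    rw [e1]
    refine ⟨D.integrable_prod_sum _, le_trans ?_ (D.one_sub_le_integral_prod_sum _)⟩
    nlinarith
  · intro e he
    obtain ⟨j, rfl⟩ := (mem_facets hn1).1 he
    have hψ : ∀ x, lam (Finset.univ.erase j) x + φ (Finset.univ.erase j) x
        - (φ (Finset.univ.erase j) x + 1) = lam (Finset.univ.erase j) x - 1 := fun x => by ring
    -- With `ψ = φ + 1` the difference is `lam - 1`, and the norm is at most `C + 1 ≤ 4 * C`.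
    refine ⟨fun x => φ _ x + 1, (hφp _ he).add (memLp_const 1), ?_, ?_, fun g hg => ?_⟩
    · have h1 : eLpNorm (fun _ : PartSpace X (Finset.univ.erase j) => (1 : ℝ)) p
          (partMeasure μ (Finset.univ.erase j)) = 1 := by
        rw [eLpNorm_const _ (zero_lt_one.trans hp).ne' (IsProbabilityMeasure.ne_zero _)]
        simp
      refine (eLpNorm_add_le (hφ _).aestronglyMeasurable aestronglyMeasurable_const hp.le).trans ?_
      rw [h1]
      refine (add_le_add_left (eLpNorm_le_of_boxLpNorm_le μ h2ℓ hp (hφ _) (hII _ he)) 1).trans ?_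
      rw [← ENNReal.ofReal_one, ← ENNReal.ofReal_add (by linarith) zero_le_one]
      exact ENNReal.ofReal_le_ofReal (by linarith)
    · simp only [hψ]
      exact D.cutNorm_sub_one_le (by omega) j
    · simp only [hψ]
      -- Truncation at the bound makes the almost-everywhere domination of `g` hold everywhere; away
      -- from the relevant facets any value, here `0`, will do.
      have hex : ∀ ω e', ∃ q : PartSpace X e' → ℝ, Measurable q ∧ (∀ x, 0 ≤ q x) ∧
          (e' ∈ ((Finset.univ : Finset (Fin n)).powersetCard (n - 1)).erase
            (Finset.univ.erase j) → ((∀ x, q x ≤ lam e' x + φ e' x) ∨ ∀ x, q x ≤ 1) ∧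
              g ω e' =ᵐ[partMeasure μ e'] q) := by
        intro ω e'
        by_cases he' : e' ∈ ((Finset.univ : Finset (Fin n)).powersetCard (n - 1)).erase
            (Finset.univ.erase j)
        · obtain ⟨h1, h2, h3⟩ := hg ω e' he'
          rcases h3 with h3 | h3
          · obtain ⟨q, hq, hq0, hq1, hq2⟩ := exists_measurable_bounded_ae_eq h1.1 h2
              ((hlam e').add (hφ e')) (fun x => add_nonneg (hlam0 e' x) (hφ0 e' x)) h3
            exact ⟨q, hq, hq0, fun _ => ⟨Or.inl hq1, hq2⟩⟩
          · obtain ⟨q, hq, hq0, hq1, hq2⟩ := exists_measurable_bounded_ae_eq h1.1 h2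
              measurable_const (fun x => zero_le_one) h3
            exact ⟨q, hq, hq0, fun _ => ⟨Or.inr hq1, hq2⟩⟩
        · exact ⟨0, measurable_zero, fun _ => le_rfl, fun h => absurd h he'⟩
      choose q hq hq0 hq1 using hex
      obtain ⟨h1, h2⟩ := D.integral_mul_fiberMean_le hn1 hlam j hq hq0 fun ω i hij =>
        (hq1 ω _ (Finset.mem_erase.2 ⟨fun h => hij (erase_univ_injective h),
          (mem_facets hn1).2 ⟨i, rfl⟩⟩)).1
      have hae : (fun x => (lam _ x - 1) * ∏ ω, fiberMean μ (Finset.univ.erase j)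
          (((Finset.univ : Finset (Fin n)).powersetCard (n - 1)).erase (Finset.univ.erase j))
            (q ω) x) =ᵐ[partMeasure μ (Finset.univ.erase j)]
          fun x => (lam _ x - 1) * ∏ ω, fiberMean μ (Finset.univ.erase j)
          (((Finset.univ : Finset (Fin n)).powersetCard (n - 1)).erase (Finset.univ.erase j))
            (g ω) x := by
        have : ∀ᵐ x ∂(partMeasure μ (Finset.univ.erase j)), ∀ ω, fiberMean μ (Finset.univ.erase j)
            (((Finset.univ : Finset (Fin n)).powersetCard (n - 1)).erase (Finset.univ.erase j))
              (g ω) x = fiberMean μ (Finset.univ.erase j)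
            (((Finset.univ : Finset (Fin n)).powersetCard (n - 1)).erase (Finset.univ.erase j))
              (q ω) x :=
          ae_all_iff.2 fun ω => fiberMean_congr_ae μ _ fun e' he' => (hq1 ω e' he').2
        filter_upwards [this] with x hx
        simp only [hx]
      exact ⟨h1.congr hae, by rwa [← integral_congr_ae hae]⟩
  · intro e he 𝒢 h𝒢 _
    obtain ⟨j, rfl⟩ := (mem_facets hn1).1 he
    obtain ⟨h1, h2⟩ := D.integral_fiberMean_pow_le hn1 hlam hφ j h𝒢
    refine ⟨h1, h2.trans (le_add_of_nonneg_right ?_)⟩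
    positivity

end Main

end

end BoxHypergraph

theorem theorem4p2 (n : ℕ) (hn : 3 ≤ n) (X : Fin n → Type*) [∀ i, MeasurableSpace (X i)]
    (μ : ∀ i, Measure (X i)) [∀ i, IsProbabilityMeasure (μ i)]
    (ℋ : Finset (Finset (Fin n))) (hℋ : ℋ = Finset.univ.powersetCard (n - 1))
    (C : ℝ) (hC : 1 ≤ C) (p : ℝ≥0∞) (hp : 1 < p)
    (ℓ : ℕ) (hℓ : ℓ = BoxHypergraph.momentExponent C p)
    (η : ℝ) (hη : 0 < η) (hη' : η ≤ ((4 * C) ^ (n * ℓ ^ n))⁻¹)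
    (lam φ : ∀ e : Finset (Fin n), BoxHypergraph.PartSpace X e → ℝ)
    (hlam : ∀ e ∈ ℋ, Integrable (lam e) (BoxHypergraph.partMeasure μ e))
    (hlam0 : ∀ e ∈ ℋ, 0 ≤ᵐ[BoxHypergraph.partMeasure μ e] lam e)
    (hφ : ∀ e ∈ ℋ, MemLp (φ e) p (BoxHypergraph.partMeasure μ e))
    (hφ0 : ∀ e ∈ ℋ, 0 ≤ᵐ[BoxHypergraph.partMeasure μ e] φ e)
    (hI : BoxHypergraph.LinearForms μ ℋ ℓ η lam)
    (hII : ∀ e ∈ ℋ, BoxHypergraph.boxLpNorm μ ℓ p e (φ e) ≤ ENNReal.ofReal C)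
    (C' η' : ℝ) (hC' : C' = (4 * C) ^ (n * ℓ))
    (hη'' : η' = (4 * C) ^ (n * ℓ) * η ^ (1 / (ℓ : ℝ) ^ (n - 1))) :
    BoxHypergraph.IsPseudorandomOfOrder μ ℋ C' η' p ℓ (fun e x => lam e x + φ e x) ∧
    (BoxHypergraph.momentExponent C' p = ℓ →
      BoxHypergraph.IsPseudorandom μ ℋ C' η' p (fun e x => lam e x + φ e x)) := by
  have h2ℓ : 2 ≤ ℓ := hℓ ▸ BoxHypergraph.two_le_momentExponent hC hp
  have : NeZero ℓ := ⟨by omega⟩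
  -- The smallness of `η` enters as `η < 1`, which forces the linear forms to be integrable with
  -- integrals at most `2`.
  have hη1 : η < 1 := by
    refine hη'.trans_lt (inv_lt_one_of_one_lt₀ (one_lt_pow₀ (by linarith) ?_))
    exact Nat.mul_ne_zero (by omega) (pow_ne_zero _ (by omega))
  have hexists : ∀ f : ∀ e : Finset (Fin n), BoxHypergraph.PartSpace X e → ℝ,
      (∀ e ∈ ℋ, AEStronglyMeasurable (f e) (BoxHypergraph.partMeasure μ e)) →
      (∀ e ∈ ℋ, 0 ≤ᵐ[BoxHypergraph.partMeasure μ e] f e) →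
      ∀ e, ∃ g : BoxHypergraph.PartSpace X e → ℝ, Measurable g ∧ (∀ x, 0 ≤ g x) ∧
        (e ∈ ℋ → f e =ᵐ[BoxHypergraph.partMeasure μ e] g) := by
    intro f hf hf0 e
    by_cases he : e ∈ ℋ
    · obtain ⟨g, h1, h2, h3⟩ :=
        BoxHypergraph.exists_measurable_nonneg_ae_eq (hf e he) (hf0 e he)
      exact ⟨g, h1, h2, fun _ => h3⟩
    · exact ⟨0, measurable_zero, fun _ => le_rfl, fun h => absurd h he⟩
  choose lam' hlam' hlam0' hlame using hexists lam (fun e he => (hlam e he).1) hlam0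
  choose φ' hφ' hφ0' hφe using hexists φ (fun e he => (hφ e he).1) hφ0
  subst hℋ hC' hη''
  have key : BoxHypergraph.IsPseudorandomOfOrder μ (Finset.univ.powersetCard (n - 1))
      ((4 * C) ^ (n * ℓ)) ((4 * C) ^ (n * ℓ) * η ^ (1 / (ℓ : ℝ) ^ (n - 1))) p ℓ
      (fun e x => lam e x + φ e x) := by
    refine (BoxHypergraph.isPseudorandomOfOrder_add hn hp hℓ hC hη hη1 hlam' hlam0' hφ' hφ0'
      (fun e he => (hlam e he).congr (hlame e he)) (fun e he => (hφ e he).ae_eq (hφe e he))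
      (hI.congr hlame) (fun e he => ?_)).congr fun e he => ?_
    · rw [← BoxHypergraph.boxLpNorm_congr μ e (hφe e he)]
      exact hII e he
    · filter_upwards [hlame e he, hφe e he] with x h1 h2
      rw [h1, h2]
  refine ⟨key, fun h => ?_⟩
  rw [BoxHypergraph.IsPseudorandom, h]
  exact key
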